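/- **Setting.** Let $m\ge 1$, $n\ge 1$ be integers, $\alpha>-1$, and let $\omega_0,\dots,\omega_m\in\mathbb R$, not all zero, satisfy $\sum_{k=0}^{\ell}\omega_k\ge 0$ for $\ell=0,\dots,m$. For $\vec t=(t_1,\dots,t_m)$ with $0<t_1<\dots<t_m$ put $w_0(x)=x^\alpha e^{-x}$ and $$w(x;\vec t)=w_0(x)\Big(\omega_0+\sum_{k=1}^m\omega_k\theta(x-t_k)\Big),\qquad x>0,$$ where $\theta(x)=1$ for $x>0$ and $\theta(x)=0$ otherwise. Let $P_j(x;\vec t)$, $j\ge0$, be the monic orthogonal polynomials, $\int_0^\infty P_iP_jw\,dx=h_i\delta_{ij}$; let $p(j,\vec t)$ be the coefficient of $x^{j-1}$ in $P_j$ ($p(0,\vec t)=0$), and let $\alpha_n=p(n,\vec t)-p(n+1,\vec t)$, $\beta_n=h_n/h_{n-1}$ be the recurrence coefficients. For $1\le k\le m$ the ladder-operator quantities are $$R_{n,k}=\omega_k\frac{w_0(t_k)}{h_n}P_n(t_k)^2,\qquad r_{n,k}=\omega_k\frac{w_0(t_k)}{h_{n-1}}P_n(t_k)P_{n-1}(t_k).$$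 **Lax-pair quantities.** For $z\notin\mathbb R$ let $$Y(z)=\begin{pmatrix}P_n(z)&\frac1{2\pi i}\int_0^\infty\frac{P_n(x)w(x;\vec t)}{x-z}dx\\ -\frac{2\pi i}{h_{n-1}}P_{n-1}(z)&-\frac1{h_{n-1}}\int_0^\infty\frac{P_{n-1}(x)w(x;\vec t)}{x-z}dx\end{pmatrix},\qquad \Psi(z)=t_1^{-(n+\frac\alpha2)\sigma_3}\,Y(t_1z)\,(t_1z)^{\frac\alpha2\sigma_3}e^{-\frac{t_1}2z\sigma_3},$$ with $\sigma_3=\mathrm{diag}(1,-1)$ and principal powers. Complex numbers $u_1,\dots,u_m$, $v_1,\dots,v_m$ and $y\ne0$ are called the Lax-pair quantities at $\vec t$ if $\frac{d}{dz}\Psi=L\Psi$ for all $z\notin\mathbb R$, where $$L(z)=-\frac{t_1}2\sigma_3+\frac1z\begin{pmatrix}a&-(a-\frac\alpha2)y\\(a+\frac\alpha2)/y&-a\end{pmatrix}+\sum_{k=1}^m\frac1{z-t_k/t_1}\begin{pmatrix}-u_kv_k&u_ky\\-u_kv_k^2/y&u_kv_k\end{pmatrix},\qquad a=\sum_{k=1}^m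 u_kv_k+n+\frac\alpha2 .$$ Put $b_1=-\sum_k u_k(v_k-1)-n$ and $b_2=-\sum_k u_kv_k(v_k-1)+n+\alpha$. Call $\vec t$ *regular* if $R_{n,k}\neq0$ for all $k$, $\sum_jR_{n,j}\ne1$ and $\sum_jr_{n,j}+n\neq0$. Write $\partial_{t_k}=\partial/\partial t_k$ and $\delta=\sum_kt_k\partial_{t_k}$. **Theorem 1.3.** 1. At every regular $\vec t$ the Lax-pair quantities exist and are unique. 2. For all $\vec t$ with $0<t_1<\dots<t_m$, $$\alpha_n=\sum_{k=1}^m t_kR_{n,k}+2n+1+\alpha,\qquad h_n>0,\qquad \partial_{t_k}\ln h_n=-R_{n,k}\quad(1\le k\le m).$$ 3. Whenever $u_k,v_k,y$ are Lax-pair quantities at $\vec t$, one has $b_1\ne0$ and, for $1\le k\le m$, $$R_{n,k}=\frac{u_k}{b_1},\qquad r_{n,k}=u_kv_k,\qquad \alpha_n=\frac1{b_1}\sum_{j=1}^m t_ju_j+2n+1+\alpha,$$ $$\beta_n=-b_1b_2,\qquad h_n=-2\pi i\,t_1^{2n+\alpha}\,b_1\,y,\qquad \partial_{t_k}\ln h_n=-\frac{u_k}{b_1}.$$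 4. At every regular $\vec t$, for $1\le k\le m$, $$u_k=R_{n,k}\,\frac{\sum_jr_{n,j}+n}{\sum_jR_{n,j}-1},\qquad v_k=\frac{r_{n,k}}{R_{n,k}}\cdot\frac{\sum_jR_{n,j}-1}{\sum_jr_{n,j}+n}.$$ Moreover, at such $\vec t$, for arbitrary complex $u_k,v_k$ (with $b_1$ formed from them) this system is equivalent to the system $R_{n,k}=u_k/b_1$, $r_{n,k}=u_kv_k$ $(1\le k\le m)$. 5. If $R_{n,k}\ne0$ for all $k$ and $\sum_kR_{n,k}\neq1$, then $$\beta_n=\frac{\left(n+\alpha+\sum_kr_{n,k}\right)\left(n+\sum_kr_{n,k}\right)}{1-\sum_kR_{n,k}}+\sum_{k=1}^m\frac{r_{n,k}^2}{R_{n,k}}.$$ 6. On the set of regular $\vec t$, where $u_k,v_k,y$ are functions of $\vec t$, $y$ is connected with $u_k$ and $v_k$ by $$\delta\ln y=\sum_{k=1}^mu_k(v_k-1)^2-2n-\alpha .$$ -/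

import Mathlib

open scoped Polynomial

noncomputable section

namespace JumpLaguerre

/-! ### The weight and its monic orthogonal polynomials -/

/-- The step function: `1` for `x > 0` and `0` otherwise. -/
def theta (x : ℝ) : ℝ := if 0 < x then 1 else 0

/-- The Laguerre weight `w₀(x) = x ^ α * exp (-x)` (used for `x > 0` only). -/
def w0 (α x : ℝ) : ℝ := x ^ α * Real.exp (-x)

/-- The Laguerre weight with jumps at `t 0 < t 1 < ⋯ < t (m - 1)`. The constant term of the jump
factor is `ω 0`; the jump at the `k`-th point `t k` is `ω k.succ`. -/
def weight {m : ℕ} (α : ℝ) (ω : Fin (m + 1) → ℝ) (t : Fin m → ℝ) (x : ℝ) : ℝ :=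
  w0 α x * (ω 0 + ∑ k, ω k.succ * theta (x - t k))

/-- The admissible jump positions, `0 < t 0 < t 1 < ⋯ < t (m - 1)`. -/
def chamber (m : ℕ) : Set (Fin m → ℝ) := {t | (∀ k, 0 < t k) ∧ StrictMono t}

/-- The bilinear form `∫₀^∞ p(x) q(x) w(x; t) dx` on real polynomials. -/
def form {m : ℕ} (α : ℝ) (ω : Fin (m + 1) → ℝ) (t : Fin m → ℝ) (p q : ℝ[X]) : ℝ :=
  ∫ x in Set.Ioi (0 : ℝ), p.eval x * q.eval x * weight α ω t x

/-- The monic orthogonal polynomials `P_n(x; t)`, built by the Gram–Schmidt process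
from `1, X, X ^ 2, …`. -/
def P {m : ℕ} (α : ℝ) (ω : Fin (m + 1) → ℝ) (t : Fin m → ℝ) : ℕ → ℝ[X]
  | n => Polynomial.X ^ n - ∑ j : Fin n,
      Polynomial.C (form α ω t (Polynomial.X ^ n) (P α ω t j) /
        form α ω t (P α ω t j) (P α ω t j)) * P α ω t j
termination_by n => n
decreasing_by all_goals exact j.2

/-- The squared norm `h_n(t) = ∫₀^∞ P_n(x; t)² w(x; t) dx`. -/
def h {m : ℕ} (n : ℕ) (α : ℝ) (ω : Fin (m + 1) → ℝ) (t : Fin m → ℝ) : ℝ :=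
  form α ω t (P α ω t n) (P α ω t n)

/-- The coefficient `p(n, t)` of `x ^ (n - 1)` in `P_n(x; t)`, with `p(0, t) = 0`. -/
def subleading {m : ℕ} (n : ℕ) (α : ℝ) (ω : Fin (m + 1) → ℝ) (t : Fin m → ℝ) : ℝ :=
  if n = 0 then 0 else (P α ω t n).coeff (n - 1)

/-- The recurrence coefficient `α_n(t) = p(n, t) - p(n + 1, t)`. -/
def recAlpha {m : ℕ} (n : ℕ) (α : ℝ) (ω : Fin (m + 1) → ℝ) (t : Fin m → ℝ) : ℝ :=
  subleading n α ω t - subleading (n + 1) α ω t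

/-- The recurrence coefficient `β_n(t) = h_n(t) / h_{n-1}(t)`, used for `n ≥ 1`. -/
def recBeta {m : ℕ} (n : ℕ) (α : ℝ) (ω : Fin (m + 1) → ℝ) (t : Fin m → ℝ) : ℝ :=
  h n α ω t / h (n - 1) α ω t

/-! ### The ladder operator quantities -/

/-- `R_{n,k}(t) = ω_k w₀(t_k) P_n(t_k; t)² / h_n(t)`. -/
def R {m : ℕ} (n : ℕ) (α : ℝ) (ω : Fin (m + 1) → ℝ) (t : Fin m → ℝ) (k : Fin m) : ℝ :=
  ω k.succ * (w0 α (t k) / h n α ω t) * ((P α ω t n).eval (t k)) ^ 2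

/-- `r_{n,k}(t) = ω_k w₀(t_k) P_n(t_k; t) P_{n-1}(t_k; t) / h_{n-1}(t)`, used for `n ≥ 1`. -/
def r {m : ℕ} (n : ℕ) (α : ℝ) (ω : Fin (m + 1) → ℝ) (t : Fin m → ℝ) (k : Fin m) : ℝ :=
  ω k.succ * (w0 α (t k) / h (n - 1) α ω t) *
    ((P α ω t n).eval (t k) * (P α ω t (n - 1)).eval (t k))

/-! ### The Riemann–Hilbert matrices -/

/-- The Cauchy integral `∫₀^∞ p(x) w(x; t) / (x - z) dx`. -/
def cauchy {m : ℕ} (α : ℝ) (ω : Fin (m + 1) → ℝ) (t : Fin m → ℝ) (p : ℝ[X]) (z : ℂ) : ℂ :=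
  ∫ x in Set.Ioi (0 : ℝ), ((p.eval x * weight α ω t x : ℝ) : ℂ) / ((x : ℂ) - z)

/-- The solution `Y(z; t)` of the Riemann–Hilbert problem of the orthogonal polynomials
(`n ≥ 1`, `z ∉ [0, ∞)`). -/
def Y {m : ℕ} (n : ℕ) (α : ℝ) (ω : Fin (m + 1) → ℝ) (t : Fin m → ℝ) (z : ℂ) :
    Matrix (Fin 2) (Fin 2) ℂ :=
  !![(P α ω t n).aeval z,
      1 / (2 * Real.pi * Complex.I) * cauchy α ω t (P α ω t n) z;
    -(2 * Real.pi * Complex.I) / (h (n - 1) α ω t : ℂ) * (P α ω t (n - 1)).aeval z,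
      -1 / (h (n - 1) α ω t : ℂ) * cauchy α ω t (P α ω t (n - 1)) z]

/-- The Pauli matrix `σ₃`. -/
def sigma3 : Matrix (Fin 2) (Fin 2) ℂ := !![1, 0; 0, -1]

/-- `c ^ (s σ₃)`, with the principal branch of the power. -/
def powSigma3 (c s : ℂ) : Matrix (Fin 2) (Fin 2) ℂ := !![c ^ s, 0; 0, c ^ (-s)]

/-- `exp (s σ₃)`. -/
def expSigma3 (s : ℂ) : Matrix (Fin 2) (Fin 2) ℂ := !![Complex.exp s, 0; 0, Complex.exp (-s)]

/-- `Ψ(z; t) = t₁ ^ (-(n + α/2) σ₃) Y(t₁ z; t) (t₁ z) ^ ((α/2) σ₃) exp (-(t₁ z/2) σ₃)`, where `t₁`,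
the smallest jump position, is `t 0`. -/
def Psi {m : ℕ} [NeZero m] (n : ℕ) (α : ℝ) (ω : Fin (m + 1) → ℝ) (t : Fin m → ℝ) (z : ℂ) :
    Matrix (Fin 2) (Fin 2) ℂ :=
  powSigma3 (t 0 : ℂ) (-((n : ℂ) + α / 2)) * Y n α ω t ((t 0 : ℂ) * z) *
    powSigma3 ((t 0 : ℂ) * z) ((α : ℂ) / 2) * expSigma3 (-((t 0 : ℂ) / 2 * z))

/-! ### The Lax matrix and its parameters -/

/-- `b₁ = - ∑ u_k (v_k - 1) - n`. -/
def b1 {m : ℕ} (n : ℕ) (u v : Fin m → ℂ) : ℂ := -(∑ k, u k * (v k - 1)) - n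

/-- `b₂ = - ∑ u_k v_k (v_k - 1) + n + α`. -/
def b2 {m : ℕ} (n : ℕ) (α : ℝ) (u v : Fin m → ℂ) : ℂ :=
  -(∑ k, u k * v k * (v k - 1)) + n + α

/-- `a = ∑ u_k v_k + n + α / 2`. -/
def aCoef {m : ℕ} (n : ℕ) (α : ℝ) (u v : Fin m → ℂ) : ℂ := ∑ k, u k * v k + n + α / 2

/-- The residue of the Lax matrix at `0`. -/
def A0 {m : ℕ} (n : ℕ) (α : ℝ) (u v : Fin m → ℂ) (y : ℂ) : Matrix (Fin 2) (Fin 2) ℂ :=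
  !![aCoef n α u v, -(aCoef n α u v - α / 2) * y;
    (aCoef n α u v + α / 2) / y, -aCoef n α u v]

/-- The residue of the Lax matrix at `a_k = t_k / t₁`. -/
def Ak (uk vk y : ℂ) : Matrix (Fin 2) (Fin 2) ℂ :=
  !![-(uk * vk), uk * y; -(uk * vk ^ 2) / y, uk * vk]

/-- The Lax matrix `L(z) = -(t₁/2) σ₃ + A₀ / z + ∑ A_k / (z - t_k / t₁)`. -/
def L {m : ℕ} [NeZero m] (n : ℕ) (α : ℝ) (t : Fin m → ℝ) (u v : Fin m → ℂ) (y z : ℂ) :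
    Matrix (Fin 2) (Fin 2) ℂ :=
  (-((t 0 : ℂ) / 2)) • sigma3 + (1 / z) • A0 n α u v y +
    ∑ k, (1 / (z - ((t k / t 0 : ℝ) : ℂ))) • Ak (u k) (v k) y

/-- `u_k`, `v_k` and `y` are the Lax pair quantities at the parameter `t`: the matrix `Ψ(z; t)`
solves `dΨ/dz = L Ψ` off the real line (where both `Y(t₁ z; t)` and the principal power are
analytic), with the Lax matrix `L` parametrized by `u_k`, `v_k` and `y ≠ 0`. -/
def IsLaxParam {m : ℕ} [NeZero m] (n : ℕ) (α : ℝ) (ω : Fin (m + 1) → ℝ) (t : Fin m → ℝ)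
    (u v : Fin m → ℂ) (y : ℂ) : Prop :=
  y ≠ 0 ∧ ∀ z : ℂ, z.im ≠ 0 → ∀ i j : Fin 2,
    HasDerivAt (fun ζ : ℂ => Psi n α ω t ζ i j) ((L n α t u v y z * Psi n α ω t z) i j) z

/-- The jump positions at which none of the denominators `R_{n,k}`, `∑ R_{n,j} - 1` and
`∑ r_{n,j} + n` of the inverse formulas vanishes. -/
def regular {m : ℕ} (n : ℕ) (α : ℝ) (ω : Fin (m + 1) → ℝ) : Set (Fin m → ℝ) :=
  {t | t ∈ chamber m ∧ (∀ k, R n α ω t k ≠ 0) ∧ ∑ j, R n α ω t j - 1 ≠ 0 ∧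
    ∑ j, r n α ω t j + n ≠ 0}

/-- `f` has partial derivatives at `t` and `δ f = ∑ t_k ∂f/∂t_k` equals `d` there. -/
def HasDelta {m : ℕ} (f : (Fin m → ℝ) → ℂ) (d : ℂ) (t : Fin m → ℝ) : Prop :=
  ∃ f' : Fin m → ℂ,
    (∀ k, HasDerivAt (fun s : ℝ => f (Function.update t k s)) (f' k) (t k)) ∧
      ∑ k, (t k : ℂ) * f' k = d

end JumpLaguerre

end

open JumpLaguerre

noncomputable section

namespace JumpLaguerre
open MeasureTheory Set Filter Topology Polynomial

/-! ### Integrability -/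

/-! The whole theorem follows from one integral identity. Since `(x w₀)' = (α + 1 - x) w₀`,
integrating by parts on `(0, ∞)` and on each `(t_k, ∞)` gives a weak Pearson equation
(`mom_pearson`): the functional `q ↦ ∫ q w` applied to `(α + 1 - x) q + x q'` leaves only point
evaluations at the jumps. The functional is positive definite (`mom_mul_self_pos`), because the
partial sums of `ω` are the values of the jump factor.

Pairing `x P'` with lower orthogonal polynomials turns the Pearson equation into a lowering and a
raising relation (`X_mul_derivative_succ`, `X_mul_derivative_add`), in which the jumps enter through
Christoffel–Darboux kernels at `t_k`. Multiplied by `x - t_k`, such a kernel collapses to two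
consecutive polynomials, with coefficients `R`, `r` and `β R_{n-1}`. At `x = 0` the relations become
a homogeneous 2×2 system for `P_n(0)` and `P_{n-1}(0)`, which do not both vanish. The zero
determinant is `compatibility_zero`; with `r² = β R_n R_{n-1}` it yields the formula for `β_n`.

The Cauchy transforms of `P_n` and `P_{n-1}` obey the same first-order system up to a common
diagonal shift, which the scalar factors in `Ψ` remove. Hence `Ψ` solves a linear system with
explicit residues (`hasDerivAt_Psi`). As `det Ψ = 1`, its coefficient matrix is unique, and a matrix
with simple poles determines its residues. Being a Lax parameter is therefore a finite set of scalar
equations (`isLaxParam_iff`), from which existence, uniqueness, the direct and inverse formulas and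
`β_n = -b₁ b₂` follow by algebra.

For the derivatives in `t_k`, differentiating the orthogonality relations gives `∂P_n` as `P_n(t_k)`
times a weighted kernel, and `∂ ln h_n = -R_{n,k}`. At regular points `y` equals `i h_{n-1}
t₁^{-(2n+α)} P_n(0) / (2π P_{n-1}(0))` (`IsLaxParam.eq_gauge`), so `δ ln y` reduces to derivatives
already known. -/

lemma w0_continuousOn (α : ℝ) : ContinuousOn (w0 α) (Ioi 0) := by
  unfold w0
  refine ContinuousOn.mul (fun x hx => ?_) (by fun_prop)
  exact (Real.continuousAt_rpow_const x α (Or.inl (ne_of_gt hx))).continuousWithinAt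

lemma integrableOn_pow_mul_w0 {α : ℝ} (hα : -1 < α) (j : ℕ) :
    IntegrableOn (fun x => x ^ j * w0 α x) (Ioi 0) := by
  have h1 : (0 : ℝ) < α + 1 + j := by
    have : (0 : ℝ) ≤ j := Nat.cast_nonneg j
    linarith
  refine (Real.GammaIntegral_convergent h1).congr_fun (fun x hx => ?_) measurableSet_Ioi
  have hx : (0 : ℝ) < x := hx
  have h2 : α + 1 + j - 1 = α + j := by ring
  simp only [w0, h2, Real.rpow_add hx, Real.rpow_natCast]
  ring

lemma integrableOn_eval_mul_w0 {α : ℝ} (hα : -1 < α) (p : ℝ[X]) :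
    IntegrableOn (fun x => p.eval x * w0 α x) (Ioi 0) := by
  simp only [eval_eq_sum_range, Finset.sum_mul]
  refine integrable_finsetSum _ (fun i _ => ?_)
  simp only [mul_assoc]
  exact (integrableOn_pow_mul_w0 hα i).const_mul _

/-- `w₀` times a polynomial times a bounded continuous function is integrable. -/
lemma integrableOn_w0_mul {α : ℝ} (hα : -1 < α) (p : ℝ[X]) {g : ℝ → ℂ} (hg : Continuous g)
    {B : ℝ} (hB : ∀ x, ‖g x‖ ≤ B) :
    IntegrableOn (fun x => (w0 α x : ℂ) * ((p.eval x : ℝ) * g x)) (Ioi 0) := by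
  have h1 : IntegrableOn (fun x => ((p.eval x * w0 α x : ℝ) : ℂ)) (Ioi 0) :=
    (integrableOn_eval_mul_w0 hα p).ofReal
  have h2 : Integrable (fun x => g x * ((p.eval x * w0 α x : ℝ) : ℂ))
      (volume.restrict (Ioi 0)) :=
    h1.bdd_mul (c := B) hg.aestronglyMeasurable (Eventually.of_forall hB)
  refine h2.congr (Eventually.of_forall fun x => ?_)
  push_cast
  ring

section Jump

variable {m : ℕ} {α : ℝ} {ω : Fin (m + 1) → ℝ} {t : Fin m → ℝ}

/-- The jump factor is a combination of indicators of half-lines. This reduces integration against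
the weight to integrals of the smooth Laguerre weight over `(0, ∞)` and `(t_k, ∞)`, where
integration by parts is available. -/
lemma weight_mul_eq (ω : Fin (m + 1) → ℝ) (t : Fin m → ℝ) (G : ℝ → ℂ) (x : ℝ) :
    (weight α ω t x : ℂ) * G x = ω 0 * (w0 α x * G x) +
      ∑ k, ω k.succ * (Ioi (t k)).indicator (fun x => w0 α x * G x) x := by
  have h1 : ∀ k, (Ioi (t k)).indicator (fun x => (w0 α x : ℂ) * G x) x =
      (theta (x - t k) : ℂ) * (w0 α x * G x) := by
    intro k
    simp only [indicator, theta, mem_Ioi, sub_pos]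
    split_ifs <;> simp
  simp only [h1, weight]
  push_cast
  rw [mul_add, add_mul, Finset.mul_sum, Finset.sum_mul]
  congr 1
  · ring
  · exact Finset.sum_congr rfl fun k _ => by ring

lemma integrableOn_weight_mul (ω : Fin (m + 1) → ℝ) (t : Fin m → ℝ) {G : ℝ → ℂ}
    (hG : IntegrableOn (fun x => (w0 α x : ℂ) * G x) (Ioi 0)) :
    IntegrableOn (fun x => (weight α ω t x : ℂ) * G x) (Ioi 0) := by
  simp only [weight_mul_eq]
  refine Integrable.add (hG.const_mul _) (integrable_finsetSum _ fun k _ => ?_)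
  exact (Integrable.indicator hG measurableSet_Ioi).const_mul _

/-- Integration against the jump weight splits into integrals over half-lines. -/
lemma integral_weight_mul (ω : Fin (m + 1) → ℝ) (ht : ∀ k, 0 ≤ t k) {G : ℝ → ℂ}
    (hG : IntegrableOn (fun x => (w0 α x : ℂ) * G x) (Ioi 0)) :
    ∫ x in Ioi (0 : ℝ), (weight α ω t x : ℂ) * G x =
      ω 0 * (∫ x in Ioi (0 : ℝ), (w0 α x : ℂ) * G x) +
        ∑ k, ω k.succ * ∫ x in Ioi (t k), (w0 α x : ℂ) * G x := by
  simp only [weight_mul_eq]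
  have h2 : ∀ k ∈ Finset.univ, Integrable (fun x => (ω (Fin.succ k) : ℂ) *
      (Ioi (t k)).indicator (fun x => (w0 α x : ℂ) * G x) x) (volume.restrict (Ioi 0)) :=
    fun k _ => (Integrable.indicator hG measurableSet_Ioi).const_mul _
  rw [integral_add (hG.const_mul _) (integrable_finsetSum _ h2), integral_finsetSum _ h2,
    integral_const_mul]
  congr 1
  refine Finset.sum_congr rfl fun k _ => ?_
  rw [integral_const_mul, setIntegral_indicator measurableSet_Ioi]
  congr 3
  rw [Ioi_inter_Ioi, sup_eq_right.2 (ht k)]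

/-! ### Integration by parts -/

/-- The pointwise Pearson equation of the Laguerre weight. -/
lemma hasDerivAt_mul_w0 (α : ℝ) {x : ℝ} (hx : 0 < x) :
    HasDerivAt (fun x => x * w0 α x) ((α + 1 - x) * w0 α x) x := by
  have h1 : HasDerivAt (fun x : ℝ => x ^ α) (α * x ^ (α - 1)) x :=
    Real.hasDerivAt_rpow_const (Or.inl hx.ne')
  have h2 : HasDerivAt (fun x : ℝ => Real.exp (-x)) (Real.exp (-x) * (-1)) x :=
    (hasDerivAt_neg x).exp
  have h3 := (hasDerivAt_id x).mul (h1.mul h2)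
  refine h3.congr_deriv ?_
  simp only [w0, id, Pi.mul_apply]
  have h4 : x * x ^ (α - 1) = x ^ α := by
    rw [Real.rpow_sub_one hx.ne']
    field_simp
  linear_combination (Real.exp (-x) * α) * h4

/-- The factor `x` turns `x ^ α` into `x ^ (α + 1)` with positive exponent, so the endpoint `0` is
harmless even where `w0` blows up there. -/
lemma continuousWithinAt_mul_w0 {α : ℝ} (hα : -1 < α) {a : ℝ} (ha : 0 ≤ a) :
    ContinuousWithinAt (fun x => x * w0 α x) (Ici a) a := by
  have h1 : ContinuousWithinAt (fun x => x ^ (α + 1) * Real.exp (-x)) (Ici a) a := by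
    refine ContinuousAt.continuousWithinAt (ContinuousAt.mul ?_ (by fun_prop))
    exact Real.continuousAt_rpow_const a (α + 1) (Or.inr (by linarith))
  have h2 : ∀ x, 0 ≤ x → x * w0 α x = x ^ (α + 1) * Real.exp (-x) := by
    intro x hx
    rw [Real.rpow_add_one' hx (by linarith), w0]
    ring
  exact h1.congr (fun x hx => h2 x (ha.trans hx)) (h2 a ha)

/-- Integration by parts on a half-line against the Laguerre weight. -/
lemma integral_Ioi_w0_deriv {α : ℝ} (hα : -1 < α) (p : ℝ[X]) {g g' : ℝ → ℂ}
    (hg : ∀ x, HasDerivAt g (g' x) x) (hg' : Continuous g') {B B' : ℝ}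
    (hB : ∀ x, ‖g x‖ ≤ B) (hB' : ∀ x, ‖g' x‖ ≤ B') :
    IntegrableOn (fun x => (w0 α x : ℂ) *
      ((((C (α + 1) - X) * p + X * derivative p).eval x : ℝ) * g x +
        ((X * p).eval x : ℝ) * g' x)) (Ioi 0) ∧
    ∀ a, 0 ≤ a → ∫ x in Ioi a, (w0 α x : ℂ) *
      ((((C (α + 1) - X) * p + X * derivative p).eval x : ℝ) * g x +
        ((X * p).eval x : ℝ) * g' x) = -((a * w0 α a * p.eval a : ℝ) * g a) := by
  have hgc : Continuous g := continuous_iff_continuousAt.2 fun x => (hg x).continuousAt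
  have hint := (integrableOn_w0_mul hα ((C (α + 1) - X) * p + X * derivative p) hgc hB).add
    (integrableOn_w0_mul hα (X * p) hg' hB')
  have hint' : IntegrableOn (fun x => (w0 α x : ℂ) *
      ((((C (α + 1) - X) * p + X * derivative p).eval x : ℝ) * g x +
        ((X * p).eval x : ℝ) * g' x)) (Ioi 0) := by
    refine hint.congr (Eventually.of_forall fun x => ?_)
    simp only [Pi.add_apply]
    ring
  refine ⟨hint', fun a ha => ?_⟩
  have hderiv : ∀ x ∈ Ioi a, HasDerivAt
      (fun x => ((x * w0 α x : ℝ) : ℂ) * ((p.eval x : ℝ) * g x))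
      ((w0 α x : ℂ) * ((((C (α + 1) - X) * p + X * derivative p).eval x : ℝ) * g x +
        ((X * p).eval x : ℝ) * g' x)) x := by
    intro x hx
    have h1 := (hasDerivAt_mul_w0 α (lt_of_le_of_lt ha hx)).ofReal_comp
    have h2 := (p.hasDerivAt x).ofReal_comp
    refine (h1.mul (h2.mul (hg x))).congr_deriv ?_
    simp only [eval_add, eval_mul, eval_sub, eval_C, eval_X, Pi.mul_apply]
    push_cast
    ring
  have hsub : Ioi a ⊆ Ioi 0 := Ioi_subset_Ioi ha
  have hF : IntegrableOn (fun x => ((x * w0 α x : ℝ) : ℂ) * ((p.eval x : ℝ) * g x)) (Ioi a) := by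
    refine ((integrableOn_w0_mul hα (X * p) hgc hB).mono_set hsub).congr
      (Eventually.of_forall fun x => ?_)
    simp only [eval_mul, eval_X]
    push_cast
    ring
  -- An integrable function with integrable derivative tends to zero, which removes the boundary
  -- term at infinity without any growth estimate.
  have hlim := tendsto_zero_of_hasDerivAt_of_integrableOn_Ioi hderiv (hint'.mono_set hsub) hF
  have hcont : ContinuousWithinAt
      (fun x => ((x * w0 α x : ℝ) : ℂ) * ((p.eval x : ℝ) * g x)) (Ici a) a := by
    refine ContinuousWithinAt.mul ?_ ?_
    · exact Complex.continuous_ofReal.continuousAt.comp_continuousWithinAt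
        (continuousWithinAt_mul_w0 hα ha)
    · exact ((Complex.continuous_ofReal.comp p.continuous).mul hgc).continuousWithinAt
  rw [integral_Ioi_of_hasDerivAt_of_tendsto hcont hderiv (hint'.mono_set hsub) hlim]
  push_cast
  ring

/-- Integration by parts against the jump weight. -/
lemma integral_weight_deriv (hα : -1 < α) (ω : Fin (m + 1) → ℝ) (ht : ∀ k, 0 ≤ t k) (p : ℝ[X])
    {g g' : ℝ → ℂ} (hg : ∀ x, HasDerivAt g (g' x) x) (hg' : Continuous g') {B B' : ℝ}
    (hB : ∀ x, ‖g x‖ ≤ B) (hB' : ∀ x, ‖g' x‖ ≤ B') :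
    ∫ x in Ioi (0 : ℝ), (weight α ω t x : ℂ) *
      ((((C (α + 1) - X) * p + X * derivative p).eval x : ℝ) * g x +
        ((X * p).eval x : ℝ) * g' x) =
      -∑ k, (ω k.succ * t k * w0 α (t k) * p.eval (t k) : ℝ) * g (t k) := by
  obtain ⟨h1, h2⟩ := integral_Ioi_w0_deriv hα p hg hg' hB hB'
  -- The boundary term carries the factor `a`, so the half-line from `0` contributes nothing and
  -- only the jumps remain.
  rw [integral_weight_mul ω ht h1, h2 0 le_rfl, Finset.sum_congr rfl fun k _ => by
    rw [h2 (t k) (ht k)]]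
  rw [← Finset.sum_neg_distrib]
  simp only [zero_mul, Complex.ofReal_zero, neg_zero, mul_zero, zero_add]
  exact Finset.sum_congr rfl fun k _ => by push_cast; ring

/-! ### The moment functional -/

lemma integrableOn_eval_mul_weight (hα : -1 < α) (ω : Fin (m + 1) → ℝ) (t : Fin m → ℝ)
    (p : ℝ[X]) : IntegrableOn (fun x => p.eval x * weight α ω t x) (Ioi 0) := by
  have h1 := integrableOn_weight_mul ω t (integrableOn_w0_mul hα p (g := fun _ => 1)
    continuous_const (B := 1) (by simp))
  refine (Integrable.re h1).congr (Eventually.of_forall fun x => ?_)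
  simp [mul_comm]

/-- The moment functional `p ↦ ∫₀^∞ p w`. -/
def mom (hα : -1 < α) (ω : Fin (m + 1) → ℝ) (t : Fin m → ℝ) : ℝ[X] →ₗ[ℝ] ℝ where
  toFun p := ∫ x in Ioi (0 : ℝ), p.eval x * weight α ω t x
  map_add' p q := by
    simp only [eval_add, add_mul]
    exact integral_add (integrableOn_eval_mul_weight hα ω t p)
      (integrableOn_eval_mul_weight hα ω t q)
  map_smul' c p := by
    simp only [eval_smul, smul_eq_mul, mul_assoc, RingHom.id_apply]
    exact integral_const_mul _ _

lemma mom_apply (hα : -1 < α) (p : ℝ[X]) :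
    mom hα ω t p = ∫ x in Ioi (0 : ℝ), p.eval x * weight α ω t x := rfl

lemma form_eq_mom (hα : -1 < α) (p q : ℝ[X]) : form α ω t p q = mom hα ω t (p * q) := by
  simp only [form, mom_apply, eval_mul]

/-- The factor `1` stands for a test function `g`, so that moments have the same shape as Cauchy
integrals, where `g x = 1 / (x - z)`. -/
lemma ofReal_mom (hα : -1 < α) (p : ℝ[X]) : (mom hα ω t p : ℂ) =
    ∫ x in Ioi (0 : ℝ), (weight α ω t x : ℂ) * ((p.eval x : ℝ) * (1 : ℂ)) := by
  rw [mom_apply, ← integral_complex_ofReal]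
  congr 1
  ext x
  push_cast
  ring

/-- The Pearson equation of the weight, in weak form. -/
lemma mom_pearson (hα : -1 < α) (ω : Fin (m + 1) → ℝ) (ht : ∀ k, 0 ≤ t k) (p : ℝ[X]) :
    mom hα ω t ((C (α + 1) - X) * p + X * derivative p) =
      -∑ k, ω k.succ * t k * w0 α (t k) * p.eval (t k) := by
  have h1 := integral_weight_deriv hα ω ht p (g := fun _ => 1) (g' := fun _ => 0)
    (fun x => hasDerivAt_const x 1) continuous_const (B := 1) (B' := 0) (by simp) (by simp)
  simp only [mul_zero, add_zero] at h1
  rw [← ofReal_mom hα] at h1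
  have h2 : (mom hα ω t ((C (α + 1) - X) * p + X * derivative p) : ℂ) =
      ((-∑ k, ω k.succ * t k * w0 α (t k) * p.eval (t k) : ℝ) : ℂ) := by
    rw [h1]
    push_cast
    simp
  exact_mod_cast h2

/-! ### Positivity -/

/-- The index `l` marks the last jump passed before `x`. This is what connects the sign condition on
the partial sums of `ω` with the sign of the weight. -/
lemma jump_eq_sum_Iic (ω : Fin (m + 1) → ℝ) {x : ℝ} {l : Fin (m + 1)}
    (hl : ∀ k : Fin m, t k < x ↔ k.succ ≤ l) :
    ω 0 + ∑ k : Fin m, ω k.succ * theta (x - t k) = ∑ k ∈ Finset.Iic l, ω k := by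
  have h1 : Finset.Iic l = Finset.univ.filter (fun i => i ≤ l) := by ext; simp
  rw [h1, Finset.sum_filter, Fin.sum_univ_succ, if_pos (Fin.zero_le l)]
  congr 1
  refine Finset.sum_congr rfl fun k _ => ?_
  simp only [theta, sub_pos, hl k]
  split_ifs <;> simp

lemma exists_lt_iff_succ_le (ht : StrictMono t) (x : ℝ) :
    ∃ l : Fin (m + 1), ∀ k : Fin m, t k < x ↔ k.succ ≤ l := by
  classical
  -- The index `0` belongs to `S` by default, so a maximum exists even when no jump lies to the left
  -- of `x`.
  let S : Finset (Fin (m + 1)) := Finset.univ.filter fun i => i = 0 ∨ ∃ k, i = Fin.succ k ∧ t k < x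
  have hS : S.Nonempty := ⟨0, by simp [S]⟩
  refine ⟨S.max' hS, fun k => ⟨fun hk => Finset.le_max' _ _ (by simp [S, hk]), fun hk => ?_⟩⟩
  have h1 := S.max'_mem hS
  simp only [S, Finset.mem_filter, Finset.mem_univ, true_and] at h1
  rcases h1 with h1 | ⟨j, h1, h2⟩
  · rw [h1] at hk
    exact absurd hk (by simp)
  · rw [h1, Fin.succ_le_succ_iff] at hk
    exact (ht.monotone hk).trans_lt h2

/-- Every partial sum is the value of the jump factor on a nonempty open interval; a single positive
partial sum therefore makes the weight positive on a set of positive measure. -/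
lemma exists_interval_lt_iff_succ_le (ht : t ∈ chamber m) (l : Fin (m + 1)) :
    ∃ a b : ℝ, 0 ≤ a ∧ a < b ∧ ∀ x ∈ Ioo a b, ∀ k : Fin m, t k < x ↔ k.succ ≤ l := by
  obtain ⟨a, ha, hlow, hup⟩ : ∃ a : ℝ, 0 ≤ a ∧ (∀ k : Fin m, k.succ ≤ l → t k ≤ a) ∧
      ∀ k : Fin m, l < k.succ → a < t k := by
    induction l using Fin.cases with
    | zero => exact ⟨0, le_rfl, fun k hk => absurd hk (by simp), fun k _ => ht.1 k⟩
    | succ j =>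
      exact ⟨t j, (ht.1 j).le, fun k hk => ht.2.monotone (Fin.succ_le_succ_iff.1 hk),
        fun k hk => ht.2 (Fin.succ_lt_succ_iff.1 hk)⟩
  by_cases hl : l.val < m
  · refine ⟨a, t ⟨l, hl⟩, ha, hup _ ?_, fun x hx k => ⟨fun hk => ?_, fun hk => ?_⟩⟩
    · rw [Fin.lt_def]
      simp
    · by_contra hc
      have h2 : (⟨l, hl⟩ : Fin m) ≤ k := by
        rw [not_le, Fin.lt_def, Fin.val_succ] at hc
        rw [Fin.le_def]
        exact Nat.lt_succ_iff.1 hc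
      exact absurd (ht.2.monotone h2) (not_le.2 (hk.trans hx.2))
    · exact (hlow k hk).trans_lt hx.1
  · refine ⟨a, a + 1, ha, by linarith, fun x hx k => ⟨fun _ => ?_, fun hk => ?_⟩⟩
    · rw [Fin.le_def, Fin.val_succ]
      have := k.2
      omega
    · exact (hlow k hk).trans_lt hx.1

/-- If all partial sums vanished, their successive differences, which are the `ω k`, would vanish
too. -/
lemma exists_sum_Iic_pos (hω : ∀ l : Fin (m + 1), 0 ≤ ∑ k ∈ Finset.Iic l, ω k) (hω0 : ω ≠ 0) :
    ∃ l : Fin (m + 1), 0 < ∑ k ∈ Finset.Iic l, ω k := by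
  by_contra! hc
  have h0 : ∀ l : Fin (m + 1), ∑ k ∈ Finset.Iic l, ω k = 0 := fun l => le_antisymm (hc l) (hω l)
  refine hω0 (funext fun l => ?_)
  induction l using WellFoundedLT.induction with
  | ind l ih =>
    have h1 := h0 l
    have h2 : Finset.Iic l = insert l (Finset.Iio l) := by
      ext i
      simp [le_iff_eq_or_lt]
    rw [h2, Finset.sum_insert (by simp), Finset.sum_eq_zero fun i hi => ih i (by simpa using hi)]
      at h1
    simpa using h1

lemma w0_pos (α : ℝ) {x : ℝ} (hx : 0 < x) : 0 < w0 α x :=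
  mul_pos (Real.rpow_pos_of_pos hx α) (Real.exp_pos _)

/-- The moment functional of the jump weight is positive definite. -/
lemma mom_mul_self_pos (hα : -1 < α) (hω : ∀ l : Fin (m + 1), 0 ≤ ∑ k ∈ Finset.Iic l, ω k)
    (hω0 : ω ≠ 0) (ht : t ∈ chamber m) {p : ℝ[X]} (hp : p ≠ 0) : 0 < mom hα ω t (p * p) := by
  rw [mom_apply]
  have hnn : ∀ x ∈ Ioi (0 : ℝ), 0 ≤ (p * p).eval x * weight α ω t x := by
    intro x hx
    obtain ⟨l, hl⟩ := exists_lt_iff_succ_le ht.2 x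
    rw [weight, jump_eq_sum_Iic ω hl, eval_mul]
    exact mul_nonneg (mul_self_nonneg _) (mul_nonneg (w0_pos α hx).le (hω l))
  rw [setIntegral_pos_iff_support_of_nonneg_ae
    ((ae_restrict_iff' measurableSet_Ioi).2 (Eventually.of_forall hnn))
    (integrableOn_eval_mul_weight hα ω t (p * p))]
  obtain ⟨l, hl⟩ := exists_sum_Iic_pos hω hω0
  obtain ⟨a, b, ha, hab, hx⟩ := exists_interval_lt_iff_succ_le ht l
  -- The finitely many roots of `p` form a null set, so removing them from the interval keeps its
  -- measure positive.
  have hfin : volume {x | p.IsRoot x} = 0 := (Polynomial.finite_setOfPred_isRoot hp).measure_zero _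
  have h1 : 0 < volume (Ioo a b \ {x | p.IsRoot x}) := by
    rw [measure_sdiff_null hfin, Real.volume_Ioo]
    simpa using hab
  refine h1.trans_le (measure_mono fun x hxx => ?_)
  have hx0 : 0 < x := ha.trans_lt hxx.1.1
  refine ⟨?_, hx0⟩
  rw [Function.mem_support, weight, jump_eq_sum_Iic ω (hx x hxx.1), eval_mul]
  have h2 : p.eval x ≠ 0 := hxx.2
  exact mul_ne_zero (mul_ne_zero h2 h2) (mul_ne_zero (w0_pos α hx0).ne' hl.ne')

end Jump

end JumpLaguerre

namespace JumpLaguerre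
open Polynomial

/-! ### Monic orthogonal polynomials of a moment functional -/

/-- `p` is the sequence of monic orthogonal polynomials of the functional `M`, with squared
norms `h`. -/
structure IsOPS (M : ℝ[X] →ₗ[ℝ] ℝ) (p : ℕ → ℝ[X]) (h : ℕ → ℝ) : Prop where
  monic : ∀ n, (p n).Monic
  natDegree : ∀ n, (p n).natDegree = n
  orth : ∀ i j, j < i → M (p i * p j) = 0
  norm : ∀ n, M (p n * p n) = h n
  ne_zero : ∀ n, h n ≠ 0

/-- The Christoffel–Darboux kernel as a polynomial in its first variable. -/
def kernel (p : ℕ → ℝ[X]) (h : ℕ → ℝ) (n : ℕ) (s : ℝ) : ℝ[X] :=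
  ∑ j ∈ Finset.range n, C ((p j).eval s / h j) * p j

namespace IsOPS

variable {M : ℝ[X] →ₗ[ℝ] ℝ} {p : ℕ → ℝ[X]} {h : ℕ → ℝ}

lemma map_C_mul (M : ℝ[X] →ₗ[ℝ] ℝ) (c : ℝ) (q : ℝ[X]) : M (C c * q) = c * M q := by
  rw [← smul_eq_C_mul, map_smul, smul_eq_mul]

lemma degree_eq (hp : IsOPS M p h) (n : ℕ) : (p n).degree = n := by
  rw [degree_eq_natDegree (hp.monic n).ne_zero, hp.natDegree]

lemma degree_lt (hp : IsOPS M p h) {i n : ℕ} (hi : i < n) : (p i).degree < n := by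
  rw [hp.degree_eq]
  exact_mod_cast hi

lemma zero_eq (hp : IsOPS M p h) : p 0 = 1 :=
  (hp.monic 0).natDegree_eq_zero.1 (hp.natDegree 0)

lemma orth_of_ne (hp : IsOPS M p h) {i j : ℕ} (hij : i ≠ j) : M (p i * p j) = 0 := by
  rcases lt_or_gt_of_ne hij with h1 | h1
  · rw [mul_comm]
    exact hp.orth j i h1
  · exact hp.orth i j h1

lemma degree_C_mul_lt {q : ℝ[X]} {n : ℕ} (c : ℝ) (hq : q.degree < n) : (C c * q).degree < n := by
  rw [← smul_eq_C_mul]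
  exact (degree_smul_le c q).trans_lt hq

lemma degree_sub_lt_of_monic {q r : ℝ[X]} {n : ℕ} (hq : q.degree ≤ n) (hr : r.degree ≤ n)
    (hc : q.coeff n = r.coeff n) : (q - r).degree < n := by
  rw [degree_lt_iff_coeff_zero]
  intro i hi
  rcases hi.eq_or_lt with h1 | h1
  · rw [coeff_sub, ← h1, hc, sub_self]
  · have h2 : (n : WithBot ℕ) < (i : ℕ) := by exact_mod_cast h1
    rw [coeff_sub, coeff_eq_zero_of_degree_lt (hq.trans_lt h2),
      coeff_eq_zero_of_degree_lt (hr.trans_lt h2), sub_self]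

lemma coeff_self (hp : IsOPS M p h) (n : ℕ) : (p n).coeff n = 1 := by
  have := (hp.monic n).coeff_natDegree
  rwa [hp.natDegree] at this

lemma exists_expansion (hp : IsOPS M p h) (n : ℕ) (q : ℝ[X]) (hq : q.degree < n) :
    ∃ c : ℕ → ℝ, q = ∑ j ∈ Finset.range n, C (c j) * p j := by
  induction n generalizing q with
  | zero =>
    refine ⟨0, ?_⟩
    rw [Finset.range_zero, Finset.sum_empty]
    rw [degree_lt_iff_coeff_zero] at hq
    ext i
    exact hq i (Nat.zero_le i)
  | succ n ih =>
    have hle : q.degree ≤ n := by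
      rw [degree_le_iff_coeff_zero]
      rw [degree_lt_iff_coeff_zero] at hq
      intro i hi
      exact hq i (by exact_mod_cast hi)
    have hle2 : (C (q.coeff n) * p n).degree ≤ n := by
      rw [← smul_eq_C_mul]
      exact (degree_smul_le _ _).trans (hp.degree_eq n).le
    obtain ⟨c, hc⟩ := ih (q - C (q.coeff n) * p n)
      (degree_sub_lt_of_monic hle hle2 (by rw [coeff_C_mul, hp.coeff_self, mul_one]))
    refine ⟨Function.update c n (q.coeff n), ?_⟩
    rw [Finset.sum_range_succ, Function.update_self,
      Finset.sum_congr rfl fun j hj => by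
        rw [Function.update_of_ne (Finset.mem_range.1 hj).ne], ← hc]
    ring

lemma map_mul_sum (hp : IsOPS M p h) (c : ℕ → ℝ) {n i : ℕ} (hi : i < n) :
    M ((∑ j ∈ Finset.range n, C (c j) * p j) * p i) = c i * h i := by
  rw [Finset.sum_mul, map_sum, Finset.sum_eq_single i]
  · rw [mul_assoc, map_C_mul, hp.norm]
  · intro j _ hj
    rw [mul_assoc, map_C_mul, hp.orth_of_ne hj, mul_zero]
  · intro hc
    exact absurd (Finset.mem_range.2 hi) hc

lemma map_mul_eq_zero (hp : IsOPS M p h) {n : ℕ} {q : ℝ[X]} (hq : q.degree < n) :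
    M (q * p n) = 0 := by
  obtain ⟨c, rfl⟩ := hp.exists_expansion n q hq
  rw [Finset.sum_mul, map_sum]
  refine Finset.sum_eq_zero fun j hj => ?_
  rw [mul_assoc, map_C_mul, hp.orth_of_ne (Finset.mem_range.1 hj).ne, mul_zero]

/-- Polynomials of degree `< n` are determined by their pairings with `p 0, …, p (n - 1)`. -/
lemma ext_of_pairing (hp : IsOPS M p h) {n : ℕ} {q r : ℝ[X]} (hq : q.degree < n)
    (hr : r.degree < n) (hqr : ∀ j < n, M (q * p j) = M (r * p j)) : q = r := by
  obtain ⟨c, rfl⟩ := hp.exists_expansion n q hq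
  obtain ⟨d, rfl⟩ := hp.exists_expansion n r hr
  refine Finset.sum_congr rfl fun j hj => ?_
  have h1 := hqr j (Finset.mem_range.1 hj)
  rw [hp.map_mul_sum c (Finset.mem_range.1 hj), hp.map_mul_sum d (Finset.mem_range.1 hj)] at h1
  rw [mul_right_cancel₀ (hp.ne_zero j) h1]

lemma degree_X_mul_le {q : ℝ[X]} {n : ℕ} (hq : q.degree ≤ n) : (X * q).degree ≤ ((n + 1 : ℕ) : WithBot ℕ) := by
  rw [degree_mul, degree_X, add_comm]
  push_cast
  gcongr

/-- `X * p n` and `p (n + 1)` differ by a polynomial of degree at most `n`, which is orthogonal to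
`p (n + 1)`. -/
lemma map_X_mul_succ (hp : IsOPS M p h) (n : ℕ) : M (X * p n * p (n + 1)) = h (n + 1) := by
  have h1 : (X * p n - p (n + 1)).degree < ((n + 1 : ℕ) : WithBot ℕ) :=
    degree_sub_lt_of_monic (degree_X_mul_le (hp.degree_eq n).le) (hp.degree_eq (n + 1)).le
      (by rw [coeff_X_mul, hp.coeff_self, hp.coeff_self])
  have h2 := hp.map_mul_eq_zero h1
  rw [sub_mul, map_sub, hp.norm] at h2
  linarith

/-- Multiplication by `X` is symmetric for the form, so it may be moved onto `p j`, whose degree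
stays below `n`. -/
lemma map_X_mul_eq_zero (hp : IsOPS M p h) {n j : ℕ} (hj : j + 1 < n) :
    M (X * p n * p j) = 0 := by
  have h1 : (X * p j).degree < (n : WithBot ℕ) :=
    (degree_X_mul_le (hp.degree_eq j).le).trans_lt (by exact_mod_cast hj)
  rw [mul_assoc, mul_left_comm, mul_comm]
  exact hp.map_mul_eq_zero h1

lemma degree_X_mul_sub_lt (hp : IsOPS M p h) (n : ℕ) :
    (X * p n - p (n + 1)).degree < ((n + 1 : ℕ) : WithBot ℕ) :=
  degree_sub_lt_of_monic (degree_X_mul_le (hp.degree_eq n).le) (hp.degree_eq (n + 1)).le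
    (by rw [coeff_X_mul, hp.coeff_self, hp.coeff_self])

lemma X_mul_zero (hp : IsOPS M p h) :
    X * p 0 = p 1 + C (M (X * p 0 * p 0) / h 0) * p 0 := by
  have h1 := hp.degree_X_mul_sub_lt 0
  have h2 : X * p 0 - p 1 = C (M (X * p 0 * p 0) / h 0) * p 0 := by
    refine hp.ext_of_pairing (n := 1) h1 (degree_C_mul_lt _ (hp.degree_lt Nat.zero_lt_one)) ?_
    intro j hj
    obtain rfl : j = 0 := by omega
    rw [sub_mul, map_sub, hp.orth 1 0 Nat.zero_lt_one, mul_assoc (C _), map_C_mul, hp.norm,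
      div_mul_cancel₀ _ (hp.ne_zero 0), sub_zero]
  linear_combination h2

/-- The three-term recurrence. -/
lemma X_mul_succ (hp : IsOPS M p h) (n : ℕ) :
    X * p (n + 1) = p (n + 2) + C (M (X * p (n + 1) * p (n + 1)) / h (n + 1)) * p (n + 1) +
      C (h (n + 1) / h n) * p n := by
  have h1 := hp.degree_X_mul_sub_lt (n + 1)
  have h2 : X * p (n + 1) - p (n + 2) =
      C (M (X * p (n + 1) * p (n + 1)) / h (n + 1)) * p (n + 1) + C (h (n + 1) / h n) * p n := by
    refine hp.ext_of_pairing (n := n + 2) h1 ?_ ?_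
    · exact (degree_add_le _ _).trans_lt (max_lt (degree_C_mul_lt _ (hp.degree_lt (by omega)))
        (degree_C_mul_lt _ (hp.degree_lt (by omega))))
    intro j hj
    rw [sub_mul, map_sub, add_mul, map_add, mul_assoc (C _), mul_assoc (C _), map_C_mul,
      map_C_mul, hp.orth (n + 2) j hj, sub_zero]
    rcases Nat.lt_succ_iff_lt_or_eq.1 hj with h3 | rfl
    · rcases Nat.lt_succ_iff_lt_or_eq.1 h3 with h4 | rfl
      · rw [hp.map_X_mul_eq_zero (by omega), hp.orth _ _ h3, hp.orth _ _ h4]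
        ring
      · rw [hp.norm, hp.orth _ _ h3, mul_right_comm, hp.map_X_mul_succ,
          div_mul_cancel₀ _ (hp.ne_zero j)]
        ring
    · rw [hp.norm, hp.orth_of_ne (show n ≠ n + 1 by omega), div_mul_cancel₀ _ (hp.ne_zero _)]
      ring
  linear_combination h2

/-- The Christoffel–Darboux formula, in any commutative algebra. -/
lemma christoffel_darboux (hp : IsOPS M p h) {A : Type*} [CommRing A] [Algebra ℝ A] (a b : A)
    (n : ℕ) :
    (a - b) * ∑ j ∈ Finset.range (n + 1),
        algebraMap ℝ A (h j)⁻¹ * (aeval a (p j) * aeval b (p j)) =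
      algebraMap ℝ A (h n)⁻¹ *
        (aeval a (p (n + 1)) * aeval b (p n) - aeval a (p n) * aeval b (p (n + 1))) := by
  induction n with
  | zero =>
    have ha := congrArg (aeval a) hp.X_mul_zero
    have hb := congrArg (aeval b) hp.X_mul_zero
    simp only [map_mul, map_add, aeval_X, aeval_C] at ha hb
    rw [zero_add, Finset.sum_range_one]
    linear_combination algebraMap ℝ A (h 0)⁻¹ * aeval b (p 0) * ha -
      algebraMap ℝ A (h 0)⁻¹ * aeval a (p 0) * hb
  | succ n ih =>
    have ha := congrArg (aeval a) (hp.X_mul_succ n)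
    have hb := congrArg (aeval b) (hp.X_mul_succ n)
    simp only [map_mul, map_add, aeval_X, aeval_C] at ha hb
    -- The identity `β_{n+1} / h_{n+1} = 1 / h_n` is what makes the sum telescope.
    have hβ : algebraMap ℝ A (h (n + 1))⁻¹ * algebraMap ℝ A (h (n + 1) / h n) =
        algebraMap ℝ A (h n)⁻¹ := by
      rw [← map_mul]
      congr 1
      have h1 := hp.ne_zero n
      have h2 := hp.ne_zero (n + 1)
      field_simp
    rw [Finset.sum_range_succ, mul_add, ih]
    linear_combination algebraMap ℝ A (h (n + 1))⁻¹ * aeval b (p (n + 1)) * ha -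
      algebraMap ℝ A (h (n + 1))⁻¹ * aeval a (p (n + 1)) * hb -
      (aeval a (p (n + 1)) * aeval b (p n) - aeval a (p n) * aeval b (p (n + 1))) * hβ

/-- Consecutive orthogonal polynomials have no common zero. -/
lemma not_common_zero (hp : IsOPS M p h) (x : ℝ) (n : ℕ) :
    ¬((p n).eval x = 0 ∧ (p (n + 1)).eval x = 0) := by
  induction n with
  | zero =>
    rintro ⟨h1, -⟩
    rw [hp.zero_eq, eval_one] at h1
    exact one_ne_zero h1
  | succ n ih =>
    rintro ⟨h1, h2⟩
    have h3 := congrArg (eval x) (hp.X_mul_succ n)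
    simp only [eval_mul, eval_add, eval_C, h1, h2, mul_zero, zero_add] at h3
    -- Since this recurrence coefficient is nonzero, a common zero would descend through the
    -- recurrence to `p 0 = 1`.
    have h4 : h (n + 1) / h n ≠ 0 := div_ne_zero (hp.ne_zero _) (hp.ne_zero _)
    exact ih ⟨(mul_eq_zero.1 h3.symm).resolve_left h4, h1⟩

lemma degree_kernel_lt (hp : IsOPS M p h) (n : ℕ) (s : ℝ) : (kernel p h n s).degree < n := by
  refine (degree_sum_le _ _).trans_lt ((Finset.sup_lt_iff (WithBot.bot_lt_coe n)).2 fun j hj => ?_)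
  exact degree_C_mul_lt _ (hp.degree_lt (Finset.mem_range.1 hj))

/-- The reproducing property: on polynomials of degree below `n`, the kernel represents evaluation
at `s`. -/
lemma map_kernel_mul (hp : IsOPS M p h) {n j : ℕ} (hj : j < n) (s : ℝ) :
    M (kernel p h n s * p j) = (p j).eval s := by
  rw [kernel, hp.map_mul_sum _ hj, div_mul_cancel₀ _ (hp.ne_zero j)]

/-- The reproducing property for `p 0 = 1`. This unit mass later cancels the boundary terms in the
equations of the Cauchy transforms. -/
lemma map_kernel (hp : IsOPS M p h) (n : ℕ) (s : ℝ) : M (kernel p h (n + 1) s) = 1 := by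
  have h1 := hp.map_kernel_mul (Nat.succ_pos n) s
  rwa [hp.zero_eq, mul_one, eval_one] at h1

/-- Christoffel–Darboux over the algebra `ℝ[X]`, at the points `X` and `C s`. It turns the kernels
of the ladder relations into two consecutive polynomials divided by `x - s`. -/
lemma sub_mul_kernel (hp : IsOPS M p h) (n : ℕ) (s : ℝ) :
    (X - C s) * kernel p h (n + 1) s =
      C ((p n).eval s / h n) * p (n + 1) - C ((p (n + 1)).eval s / h n) * p n := by
  have h1 := hp.christoffel_darboux (X : ℝ[X]) (C s) n
  have h2 : ∀ q : ℝ[X], aeval (C s) q = C (q.eval s) := by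
    intro q
    have := aeval_algebraMap_apply ℝ[X] s q
    rwa [algebraMap_eq, coe_aeval_eq_eval] at this
  simp only [aeval_X_left_apply, h2, algebraMap_eq] at h1
  rw [kernel, Finset.sum_congr rfl fun j _ => show C ((p j).eval s / h j) * p j =
    C (h j)⁻¹ * (p j * C ((p j).eval s)) by rw [div_eq_mul_inv, C_mul]; ring, h1]
  simp only [div_eq_mul_inv, C_mul]
  ring

/-! ### Semiclassical orthogonal polynomials: ladder relations -/

section Ladder

variable {ι : Type*} [Fintype ι] {α : ℝ} {c t : ι → ℝ}

lemma degree_X_mul_derivative_le {q : ℝ[X]} {n : ℕ} (hq : q.degree ≤ n) :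
    (X * derivative q).degree ≤ (n : WithBot ℕ) := by
  rw [degree_le_iff_coeff_zero] at hq ⊢
  intro i hi
  cases i with
  | zero => simp
  | succ i => rw [coeff_X_mul, coeff_derivative, hq _ hi, zero_mul]

/-- The Euler operator `x d/dx` multiplies the leading coefficient by `n`. -/
lemma degree_X_mul_derivative_sub_lt (hp : IsOPS M p h) (n : ℕ) :
    (X * derivative (p n) - C (n : ℝ) * p n).degree < (n : WithBot ℕ) := by
  refine degree_sub_lt_of_monic (degree_X_mul_derivative_le (hp.degree_eq n).le) ?_ ?_
  · rw [← smul_eq_C_mul]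
    exact (degree_smul_le _ _).trans (hp.degree_eq n).le
  · rw [coeff_C_mul]
    cases n with
    | zero => simp
    | succ n => rw [coeff_X_mul, coeff_derivative]; push_cast; ring

lemma map_X_mul_derivative_mul (hp : IsOPS M p h) (n : ℕ) :
    M (X * derivative (p n) * p n) = n * h n := by
  have h1 := hp.map_mul_eq_zero (hp.degree_X_mul_derivative_sub_lt n)
  rw [sub_mul, map_sub, mul_assoc (C _), map_C_mul, hp.norm] at h1
  linarith

lemma map_X_mul_derivative_mul_of_lt (hp : IsOPS M p h) {n j : ℕ} (hj : j < n) :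
    M (X * derivative (p j) * p n) = 0 :=
  hp.map_mul_eq_zero ((degree_X_mul_derivative_le (hp.degree_eq j).le).trans_lt
    (by exact_mod_cast hj))

/-- The Pearson equation for a product `q * r`: up to the jump terms, `x d/dx + α - x` has the
adjoint `-1 - x d/dx`, and the latter does not raise degrees. -/
lemma pearson_mul
    (hM : ∀ q, M ((C (α + 1) - X) * q + X * derivative q) = -∑ k, c k * t k * q.eval (t k))
    (q r : ℝ[X]) : M ((X * derivative q + (C α - X) * q) * r) =
      -M (q * r) - M (X * derivative r * q) - ∑ k, c k * t k * (q.eval (t k) * r.eval (t k)) := by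
  have h1 := hM (q * r)
  rw [show (C (α + 1) - X) * (q * r) + X * derivative (q * r) =
    (X * derivative q + (C α - X) * q) * r + q * r + X * derivative r * q by
      rw [derivative_mul, C_add, C_1]; ring, map_add, map_add] at h1
  simp only [eval_mul] at h1
  linarith

/-- The diagonal recurrence coefficient in terms of the values at the jumps. -/
lemma map_X_mul_self (hp : IsOPS M p h)
    (hM : ∀ q, M ((C (α + 1) - X) * q + X * derivative q) = -∑ k, c k * t k * q.eval (t k))
    (n : ℕ) : M (X * p n * p n) =
      (2 * n + 1 + α) * h n + ∑ k, c k * t k * (p n).eval (t k) ^ 2 := by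
  have h1 := pearson_mul hM (p n) (p n)
  rw [show (X * derivative (p n) + (C α - X) * p n) * p n = X * derivative (p n) * p n +
    C α * (p n * p n) - X * p n * p n by ring, map_sub, map_add, hp.map_X_mul_derivative_mul,
    map_C_mul, hp.norm] at h1
  simp only [← pow_two] at h1
  linarith

lemma degree_sum_kernel_lt (hp : IsOPS M p h) (n : ℕ) (d : ι → ℝ) :
    (∑ k, C (d k) * kernel p h n (t k)).degree < n := by
  refine (degree_sum_le _ _).trans_lt ((Finset.sup_lt_iff (WithBot.bot_lt_coe n)).2 fun j _ => ?_)
  exact degree_C_mul_lt _ (hp.degree_kernel_lt n _)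

lemma map_sum_kernel_mul (hp : IsOPS M p h) {n j : ℕ} (hj : j < n) (d : ι → ℝ) :
    M ((∑ k, C (d k) * kernel p h n (t k)) * p j) = ∑ k, d k * (p j).eval (t k) := by
  rw [Finset.sum_mul, map_sum]
  refine Finset.sum_congr rfl fun k _ => ?_
  rw [mul_assoc, map_C_mul, hp.map_kernel_mul hj]

/-- The lowering relation. -/
lemma X_mul_derivative_succ (hp : IsOPS M p h)
    (hM : ∀ q, M ((C (α + 1) - X) * q + X * derivative q) = -∑ k, c k * t k * q.eval (t k))
    (n : ℕ) : X * derivative (p (n + 1)) =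
      C ((n : ℝ) + 1) * p (n + 1) + C (h (n + 1) / h n) * p n -
        ∑ k, C (c k * t k * (p (n + 1)).eval (t k)) * kernel p h (n + 1) (t k) := by
  have h1 : X * derivative (p (n + 1)) - C ((n + 1 : ℕ) : ℝ) * p (n + 1) =
      C (h (n + 1) / h n) * p n -
        ∑ k, C (c k * t k * (p (n + 1)).eval (t k)) * kernel p h (n + 1) (t k) := by
    refine hp.ext_of_pairing (hp.degree_X_mul_derivative_sub_lt (n + 1)) ?_ fun j hj => ?_
    · exact (degree_sub_le _ _).trans_lt (max_lt (degree_C_mul_lt _ (hp.degree_lt (by omega)))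
        (hp.degree_sum_kernel_lt _ _))
    · have h2 := pearson_mul hM (p (n + 1)) (p j)
      rw [show (X * derivative (p (n + 1)) + (C α - X) * p (n + 1)) * p j =
        X * derivative (p (n + 1)) * p j + C α * (p (n + 1) * p j) - X * p (n + 1) * p j by ring,
        map_sub, map_add, map_C_mul, hp.orth _ _ hj, hp.map_X_mul_derivative_mul_of_lt hj] at h2
      rw [sub_mul, sub_mul, map_sub, map_sub, mul_assoc (C _), mul_assoc (C _), map_C_mul,
        map_C_mul, hp.map_sum_kernel_mul hj, hp.orth _ _ hj]
      have h3 : ∑ k, c k * t k * (p (n + 1)).eval (t k) * (p j).eval (t k) =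
          ∑ k, c k * t k * ((p (n + 1)).eval (t k) * (p j).eval (t k)) :=
        Finset.sum_congr rfl fun k _ => by ring
      rw [h3]
      -- Multiplication by `X` couples `p (n + 1)` to `p j` only for `j = n`; that case produces the
      -- term with `p n`.
      rcases Nat.lt_succ_iff_lt_or_eq.1 hj with h4 | rfl
      · rw [hp.map_X_mul_eq_zero (by omega)] at h2
        rw [hp.orth _ _ h4]
        linarith
      · rw [mul_right_comm X (p (j + 1)), hp.map_X_mul_succ] at h2
        rw [hp.norm, div_mul_cancel₀ _ (hp.ne_zero j)]
        linarith
  push_cast at h1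
  linear_combination h1

/-- The raising relation. -/
lemma X_mul_derivative_add (hp : IsOPS M p h)
    (hM : ∀ q, M ((C (α + 1) - X) * q + X * derivative q) = -∑ k, c k * t k * q.eval (t k))
    (n : ℕ) : X * derivative (p n) + (C α - X) * p n =
      -p (n + 1) - C ((n : ℝ) + 1) * p n -
        ∑ k, C (c k * t k * (p n).eval (t k)) * kernel p h (n + 1) (t k) := by
  have hlt : (p n).degree < (n + 1 : ℕ) := hp.degree_lt (by omega)
  -- Adding `p (n + 1)` cancels the leading term of `-X * p n`, which brings the degree down to at
  -- most `n`.
  have h0 : (X * derivative (p n) + (C α - X) * p n) + p (n + 1) =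
      X * derivative (p n) + C α * p n - (X * p n - p (n + 1)) := by ring
  have h1 : (X * derivative (p n) + (C α - X) * p n) + p (n + 1) =
      -(C ((n : ℝ) + 1) * p n) -
        ∑ k, C (c k * t k * (p n).eval (t k)) * kernel p h (n + 1) (t k) := by
    refine hp.ext_of_pairing (n := n + 1) ?_ ?_ fun j hj => ?_
    · rw [h0]
      refine (degree_sub_le _ _).trans_lt (max_lt ((degree_add_le _ _).trans_lt (max_lt ?_
        (degree_C_mul_lt _ hlt))) (hp.degree_X_mul_sub_lt n))
      exact (degree_X_mul_derivative_le (hp.degree_eq n).le).trans_lt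
        (by exact_mod_cast Nat.lt_succ_self n)
    · refine (degree_sub_le _ _).trans_lt (max_lt ?_ (hp.degree_sum_kernel_lt _ _))
      rw [degree_neg]
      exact degree_C_mul_lt _ hlt
    · rw [add_mul, map_add, pearson_mul hM, hp.orth _ _ hj, sub_mul, map_sub, neg_mul, map_neg,
        mul_assoc (C _), map_C_mul, hp.map_sum_kernel_mul hj]
      have h3 : ∑ k, c k * t k * (p n).eval (t k) * (p j).eval (t k) =
          ∑ k, c k * t k * ((p n).eval (t k) * (p j).eval (t k)) :=
        Finset.sum_congr rfl fun k _ => by ring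
      rw [h3]
      rcases Nat.lt_succ_iff_lt_or_eq.1 hj with h4 | rfl
      · rw [hp.orth _ _ h4, hp.map_X_mul_derivative_mul_of_lt h4]
        ring
      · rw [hp.norm, hp.map_X_mul_derivative_mul]
        ring
  linear_combination h1

end Ladder

end IsOPS

end JumpLaguerre

namespace JumpLaguerre
open Polynomial

/-! ### The orthogonal polynomials of the jump weight -/

section JumpOPS

variable {m : ℕ} {α : ℝ} {ω : Fin (m + 1) → ℝ} {t : Fin m → ℝ}

lemma P_eq (α : ℝ) (ω : Fin (m + 1) → ℝ) (t : Fin m → ℝ) (n : ℕ) :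
    P α ω t n = X ^ n - ∑ j ∈ Finset.range n,
      C (form α ω t (X ^ n) (P α ω t j) / form α ω t (P α ω t j) (P α ω t j)) * P α ω t j := by
  rw [P, Finset.sum_range]

lemma degree_P (α : ℝ) (ω : Fin (m + 1) → ℝ) (t : Fin m → ℝ) (n : ℕ) :
    (P α ω t n).degree = n := by
  induction n using Nat.strong_induction_on with
  | _ n ih =>
    rw [P_eq, degree_sub_eq_left_of_degree_lt, degree_X_pow]
    rw [degree_X_pow]
    refine (degree_sum_le _ _).trans_lt
      ((Finset.sup_lt_iff (WithBot.bot_lt_coe n)).2 fun j hj => IsOPS.degree_C_mul_lt _ ?_)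
    rw [ih j (Finset.mem_range.1 hj)]
    exact_mod_cast Finset.mem_range.1 hj

lemma monic_P (α : ℝ) (ω : Fin (m + 1) → ℝ) (t : Fin m → ℝ) (n : ℕ) : (P α ω t n).Monic := by
  rw [P_eq]
  refine (monic_X_pow n).sub_of_left ?_
  rw [degree_X_pow]
  refine (degree_sum_le _ _).trans_lt
    ((Finset.sup_lt_iff (WithBot.bot_lt_coe n)).2 fun j hj => IsOPS.degree_C_mul_lt _ ?_)
  rw [degree_P]
  exact_mod_cast Finset.mem_range.1 hj

lemma natDegree_P (α : ℝ) (ω : Fin (m + 1) → ℝ) (t : Fin m → ℝ) (n : ℕ) :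
    (P α ω t n).natDegree = n :=
  natDegree_eq_of_degree_eq_some (degree_P α ω t n)

variable (hα : -1 < α) (hω : ∀ l : Fin (m + 1), 0 ≤ ∑ k ∈ Finset.Iic l, ω k) (hω0 : ω ≠ 0)
  (ht : t ∈ chamber m)

include hα hω hω0 ht in
lemma h_pos (n : ℕ) : 0 < h n α ω t := by
  rw [h, form_eq_mom hα]
  exact mom_mul_self_pos hα hω hω0 ht (monic_P α ω t n).ne_zero

include hω hω0 ht in
lemma isOPS : IsOPS (mom hα ω t) (P α ω t) (fun n => h n α ω t) where
  monic := monic_P α ω t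
  natDegree := natDegree_P α ω t
  norm n := (form_eq_mom hα _ _).symm
  ne_zero n := (h_pos hα hω hω0 ht n).ne'
  orth i := by
    induction i using Nat.strong_induction_on with
    | _ i ih =>
      intro j hj
      -- By induction only the `j`-th term of the Gram–Schmidt sum pairs nontrivially with `P j`,
      -- and it cancels the pairing with `X ^ i`.
      rw [P_eq α ω t i, sub_mul, map_sub, Finset.sum_mul, map_sum,
        Finset.sum_eq_single_of_mem j (Finset.mem_range.2 hj), mul_assoc, IsOPS.map_C_mul,
        form_eq_mom hα, form_eq_mom hα, div_mul_cancel₀, sub_self]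
      · exact (mom_mul_self_pos hα hω hω0 ht (monic_P α ω t j).ne_zero).ne'
      · intro l hl hlj
        rw [mul_assoc, IsOPS.map_C_mul]
        rcases lt_or_gt_of_ne hlj with h1 | h1
        · rw [mul_comm (P α ω t l), ih j hj l h1, mul_zero]
        · rw [ih l (Finset.mem_range.1 hl) j h1, mul_zero]

include ht in
-- The factors are ordered so that `c k = ω k.succ * w0 α (t k)` matches the abstract hypothesis
-- `hM` of the ladder relations.
lemma mom_pearson' (q : ℝ[X]) : mom hα ω t ((C (α + 1) - X) * q + X * derivative q) =
    -∑ k, ω k.succ * w0 α (t k) * t k * q.eval (t k) := by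
  rw [mom_pearson hα ω (fun k => (ht.1 k).le)]
  congr 1
  exact Finset.sum_congr rfl fun k _ => by ring

include hα hω hω0 ht in
-- Comparing subleading coefficients in the recurrence identifies `α_n` with `∫ x P_n² w / h_n`,
-- which `map_X_mul_self` evaluates.
lemma recAlpha_eq (n : ℕ) :
    recAlpha n α ω t = ∑ k, t k * R n α ω t k + 2 * n + 1 + α := by
  have hp := isOPS hα hω hω0 ht
  have hn := (h_pos hα hω hω0 ht n).ne'
  have h1 : recAlpha n α ω t = mom hα ω t (X * P α ω t n * P α ω t n) / h n α ω t := by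
    cases n with
    | zero =>
      have h2 := congrArg (fun q => coeff q 0) hp.X_mul_zero
      simp only [coeff_X_mul_zero, coeff_add, coeff_C_mul, hp.coeff_self, mul_one] at h2
      simp only [recAlpha, subleading, zero_add, one_ne_zero, if_true, if_false, Nat.sub_self]
      linarith
    | succ n =>
      have h2 := congrArg (fun q => coeff q (n + 1)) (hp.X_mul_succ n)
      have h3 : (P α ω t n).coeff (n + 1) = 0 :=
        coeff_eq_zero_of_natDegree_lt (by rw [natDegree_P]; omega)
      simp only [coeff_X_mul, coeff_add, coeff_C_mul, hp.coeff_self, mul_one, h3, mul_zero,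
        add_zero] at h2
      simp only [recAlpha, subleading, Nat.succ_ne_zero, if_false, Nat.add_sub_cancel]
      linarith
  rw [h1, hp.map_X_mul_self (mom_pearson' hα ht), add_div, mul_div_cancel_right₀ _ hn,
    Finset.sum_div]
  have h2 : ∀ k, ω k.succ * w0 α (t k) * t k * (P α ω t n).eval (t k) ^ 2 / h n α ω t =
      t k * R n α ω t k := fun k => by
    rw [R]
    ring
  rw [Finset.sum_congr rfl fun k _ => h2 k]
  ring

include hα hω hω0 ht in
-- This makes the residue matrix at each jump singular, and it lets `R_n` be eliminated in favour of
-- `r² / R` at level `n + 1`.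
lemma r_sq_eq (n : ℕ) (k : Fin m) :
    r (n + 1) α ω t k ^ 2 = recBeta (n + 1) α ω t * R n α ω t k * R (n + 1) α ω t k := by
  have h1 := (h_pos hα hω hω0 ht n).ne'
  have h2 := (h_pos hα hω hω0 ht (n + 1)).ne'
  simp only [r, R, recBeta, Nat.add_sub_cancel]
  field_simp

include hα hω hω0 ht in
lemma recBeta_pos (n : ℕ) : 0 < recBeta (n + 1) α ω t :=
  div_pos (h_pos hα hω hω0 ht _) (h_pos hα hω hω0 ht _)

/-- The Christoffel–Darboux kernel of the jump weight at the jump `t k`, weighted by the jump. -/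
def jumpKernel (n : ℕ) (α : ℝ) (ω : Fin (m + 1) → ℝ) (t : Fin m → ℝ) (k : Fin m) : ℝ[X] :=
  C (ω k.succ * w0 α (t k)) * kernel (P α ω t) (fun n => h n α ω t) n (t k)

include hα hω hω0 ht in
-- Christoffel–Darboux in terms of the ladder quantities. The prefactor `P_{n+1}(t_k)` is the one in
-- the lowering relation; `sub_mul_jumpKernel` is the companion for raising.
lemma sub_mul_jumpKernel_succ (n : ℕ) (k : Fin m) :
    (X - C (t k)) * (C ((P α ω t (n + 1)).eval (t k)) * jumpKernel (n + 1) α ω t k) =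
      C (r (n + 1) α ω t k) * P α ω t (n + 1) -
        C (recBeta (n + 1) α ω t * R (n + 1) α ω t k) * P α ω t n := by
  have h1 := (isOPS hα hω hω0 ht).sub_mul_kernel n (t k)
  have hn := (h_pos hα hω hω0 ht (n + 1)).ne'
  have e1 : r (n + 1) α ω t k = (P α ω t (n + 1)).eval (t k) * (ω k.succ * w0 α (t k)) *
      ((P α ω t n).eval (t k) / h n α ω t) := by
    simp only [r, Nat.add_sub_cancel]
    ring
  have e2 : recBeta (n + 1) α ω t * R (n + 1) α ω t k =
      (P α ω t (n + 1)).eval (t k) * (ω k.succ * w0 α (t k)) *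
      ((P α ω t (n + 1)).eval (t k) / h n α ω t) := by
    simp only [recBeta, R, Nat.add_sub_cancel]
    field_simp
  rw [e1, e2, jumpKernel]
  simp only [C_mul] at h1 ⊢
  linear_combination (C ((P α ω t (n + 1)).eval (t k)) * (C (ω k.succ) * C (w0 α (t k)))) * h1

include hα hω hω0 ht in
lemma sub_mul_jumpKernel (n : ℕ) (k : Fin m) :
    (X - C (t k)) * (C ((P α ω t n).eval (t k)) * jumpKernel (n + 1) α ω t k) =
      C (R n α ω t k) * P α ω t (n + 1) - C (r (n + 1) α ω t k) * P α ω t n := by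
  have h1 := (isOPS hα hω hω0 ht).sub_mul_kernel n (t k)
  have e1 : r (n + 1) α ω t k = (P α ω t n).eval (t k) * (ω k.succ * w0 α (t k)) *
      ((P α ω t (n + 1)).eval (t k) / h n α ω t) := by
    simp only [r, Nat.add_sub_cancel]
    ring
  have e2 : R n α ω t k = (P α ω t n).eval (t k) * (ω k.succ * w0 α (t k)) *
      ((P α ω t n).eval (t k) / h n α ω t) := by
    simp only [R]
    ring
  rw [e1, e2, jumpKernel]
  simp only [C_mul] at h1 ⊢
  linear_combination (C ((P α ω t n).eval (t k)) * (C (ω k.succ) * C (w0 α (t k)))) * h1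

include hω hω0 ht in
lemma mom_jumpKernel (n : ℕ) (k : Fin m) :
    mom hα ω t (jumpKernel (n + 1) α ω t k) = ω k.succ * w0 α (t k) := by
  rw [jumpKernel, IsOPS.map_C_mul, (isOPS hα hω hω0 ht).map_kernel, mul_one]

include hα hω hω0 ht in
lemma X_mul_derivative_P_succ (n : ℕ) : X * derivative (P α ω t (n + 1)) =
    C ((n : ℝ) + 1) * P α ω t (n + 1) + C (recBeta (n + 1) α ω t) * P α ω t n -
      ∑ k, C (t k) * (C ((P α ω t (n + 1)).eval (t k)) * jumpKernel (n + 1) α ω t k) := by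
  rw [(isOPS hα hω hω0 ht).X_mul_derivative_succ (mom_pearson' hα ht)]
  congr 1
  refine Finset.sum_congr rfl fun k _ => ?_
  simp only [jumpKernel, C_mul]
  ring

include hα hω hω0 ht in
lemma X_mul_derivative_P_add (n : ℕ) :
    X * derivative (P α ω t n) + (C α - X) * P α ω t n =
    -P α ω t (n + 1) - C ((n : ℝ) + 1) * P α ω t n -
      ∑ k, C (t k) * (C ((P α ω t n).eval (t k)) * jumpKernel (n + 1) α ω t k) := by
  rw [(isOPS hα hω hω0 ht).X_mul_derivative_add (mom_pearson' hα ht)]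
  congr 1
  refine Finset.sum_congr rfl fun k _ => ?_
  simp only [jumpKernel, C_mul]
  ring

/-! ### Compatibility at the origin -/

include hα hω hω0 ht in
-- At the origin `x P'` vanishes, and `x - t_k = -t_k` absorbs the factors `t_k`, so only the plain
-- sums of `r` and `R` survive.
lemma eval_zero_lowering (n : ℕ) :
    ((n : ℝ) + 1 + ∑ k, r (n + 1) α ω t k) * (P α ω t (n + 1)).eval 0 +
      recBeta (n + 1) α ω t * (1 - ∑ k, R (n + 1) α ω t k) * (P α ω t n).eval 0 = 0 := by
  have h1 := congrArg (eval 0) (X_mul_derivative_P_succ hα hω hω0 ht n)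
  have h2 : ∀ k, t k * ((P α ω t (n + 1)).eval (t k) * (jumpKernel (n + 1) α ω t k).eval 0) =
      -(r (n + 1) α ω t k * (P α ω t (n + 1)).eval 0 -
        recBeta (n + 1) α ω t * R (n + 1) α ω t k * (P α ω t n).eval 0) := by
    intro k
    have h3 := congrArg (eval 0) (sub_mul_jumpKernel_succ hα hω hω0 ht n k)
    simp only [eval_mul, eval_sub, eval_X, eval_C] at h3
    linarith
  simp only [eval_mul, eval_sub, eval_add, eval_X, eval_C, eval_finsetSum, h2] at h1
  rw [Finset.sum_neg_distrib, Finset.sum_sub_distrib, ← Finset.sum_mul, ← Finset.sum_mul,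
    ← Finset.mul_sum] at h1
  linarith

include hα hω hω0 ht in
lemma eval_zero_raising (n : ℕ) :
    ((n : ℝ) + 1 + α + ∑ k, r (n + 1) α ω t k) * (P α ω t n).eval 0 +
      (1 - ∑ k, R n α ω t k) * (P α ω t (n + 1)).eval 0 = 0 := by
  have h1 := congrArg (eval 0) (X_mul_derivative_P_add hα hω hω0 ht n)
  have h2 : ∀ k, t k * ((P α ω t n).eval (t k) * (jumpKernel (n + 1) α ω t k).eval 0) =
      -(R n α ω t k * (P α ω t (n + 1)).eval 0 - r (n + 1) α ω t k * (P α ω t n).eval 0) := by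
    intro k
    have h3 := congrArg (eval 0) (sub_mul_jumpKernel hα hω hω0 ht n k)
    simp only [eval_mul, eval_sub, eval_X, eval_C] at h3
    linarith
  simp only [eval_mul, eval_sub, eval_add, eval_neg, eval_X, eval_C, eval_finsetSum, h2] at h1
  rw [Finset.sum_neg_distrib, Finset.sum_sub_distrib, ← Finset.sum_mul, ← Finset.sum_mul] at h1
  linarith

include hα hω hω0 ht in
-- The lowering and raising relations at `0` form a homogeneous linear system for `P_n(0)` and
-- `P_{n+1}(0)`. Consecutive polynomials have no common zero, so the solution is nontrivial and the
-- determinant vanishes.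
lemma compatibility_zero (n : ℕ) :
    recBeta (n + 1) α ω t * (1 - ∑ k, R (n + 1) α ω t k) * (1 - ∑ k, R n α ω t k) =
      ((n : ℝ) + 1 + ∑ k, r (n + 1) α ω t k) * ((n : ℝ) + 1 + α + ∑ k, r (n + 1) α ω t k) := by
  have h1 := eval_zero_lowering hα hω hω0 ht n
  have h2 := eval_zero_raising hα hω hω0 ht n
  have h3 := (isOPS hα hω hω0 ht).not_common_zero 0 n
  by_cases h4 : (P α ω t n).eval 0 = 0
  · have h5 : (P α ω t (n + 1)).eval 0 ≠ 0 := fun h5 => h3 ⟨h4, h5⟩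
    refine mul_right_cancel₀ h5 ?_
    linear_combination (recBeta (n + 1) α ω t * (1 - ∑ k, R (n + 1) α ω t k)) * h2 -
      ((n : ℝ) + 1 + α + ∑ k, r (n + 1) α ω t k) * h1
  · refine mul_right_cancel₀ h4 ?_
    linear_combination (1 - ∑ k, R n α ω t k) * h1 -
      ((n : ℝ) + 1 + ∑ k, r (n + 1) α ω t k) * h2

include hα hω hω0 ht in
lemma recBeta_eq {n : ℕ} (hR : ∀ k, R (n + 1) α ω t k ≠ 0)
    (hR1 : 1 - ∑ k, R (n + 1) α ω t k ≠ 0) : recBeta (n + 1) α ω t =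
      ((n + 1 : ℕ) + α + ∑ k, r (n + 1) α ω t k) * ((n + 1 : ℕ) + ∑ k, r (n + 1) α ω t k) /
        (1 - ∑ k, R (n + 1) α ω t k) + ∑ k, r (n + 1) α ω t k ^ 2 / R (n + 1) α ω t k := by
  have h1 : ∑ k, r (n + 1) α ω t k ^ 2 / R (n + 1) α ω t k =
      recBeta (n + 1) α ω t * ∑ k, R n α ω t k := by
    rw [Finset.mul_sum]
    refine Finset.sum_congr rfl fun k _ => ?_
    rw [r_sq_eq hα hω hω0 ht, mul_div_cancel_right₀ _ (hR k)]
  have h2 := compatibility_zero hα hω hω0 ht n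
  rw [h1, ← sub_eq_iff_eq_add, eq_div_iff hR1]
  push_cast
  linear_combination h2

end JumpOPS

end JumpLaguerre

namespace JumpLaguerre
open Polynomial MeasureTheory Set Filter Topology

/-! ### Polynomials depending differentiably on a parameter -/

/-- The polynomials `p s` have bounded degree and coefficients differentiable at `s₀`, with
derivatives the coefficients of `p'`. -/
def HasPolyDerivAt (p : ℝ → ℝ[X]) (p' : ℝ[X]) (s₀ : ℝ) : Prop :=
  (∃ N, ∀ s, (p s).natDegree ≤ N) ∧ ∀ i, HasDerivAt (fun s => (p s).coeff i) (p'.coeff i) s₀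

namespace HasPolyDerivAt

variable {p q : ℝ → ℝ[X]} {p' q' : ℝ[X]} {s₀ : ℝ}

lemma const (p : ℝ[X]) (s₀ : ℝ) : HasPolyDerivAt (fun _ => p) 0 s₀ :=
  ⟨⟨p.natDegree, fun _ => le_rfl⟩, fun i => by simpa using hasDerivAt_const s₀ (p.coeff i)⟩

lemma sub (hp : HasPolyDerivAt p p' s₀) (hq : HasPolyDerivAt q q' s₀) :
    HasPolyDerivAt (fun s => p s - q s) (p' - q') s₀ := by
  obtain ⟨⟨N, hN⟩, hp⟩ := hp
  obtain ⟨⟨K, hK⟩, hq⟩ := hq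
  refine ⟨⟨max N K, fun s => (natDegree_sub_le _ _).trans (max_le_max (hN s) (hK s))⟩, fun i => ?_⟩
  simp only [coeff_sub]
  exact (hp i).sub (hq i)

lemma mul (hp : HasPolyDerivAt p p' s₀) (hq : HasPolyDerivAt q q' s₀) :
    HasPolyDerivAt (fun s => p s * q s) (p' * q s₀ + p s₀ * q') s₀ := by
  obtain ⟨⟨N, hN⟩, hp⟩ := hp
  obtain ⟨⟨K, hK⟩, hq⟩ := hq
  refine ⟨⟨N + K, fun s => natDegree_mul_le.trans (Nat.add_le_add (hN s) (hK s))⟩, fun i => ?_⟩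
  simp only [coeff_add, coeff_mul, ← Finset.sum_add_distrib]
  exact HasDerivAt.fun_sum fun x _ => (hp x.1).mul (hq x.2)

lemma C_fun {c : ℝ → ℝ} {c' : ℝ} (hc : HasDerivAt c c' s₀) :
    HasPolyDerivAt (fun s => C (c s)) (C c') s₀ := by
  refine ⟨⟨0, fun s => (natDegree_C _).le⟩, fun i => ?_⟩
  simp only [coeff_C]
  split_ifs
  · exact hc
  · exact hasDerivAt_const _ _

lemma sum {ι : Type*} {S : Finset ι} {p : ι → ℝ → ℝ[X]} {p' : ι → ℝ[X]}
    (hp : ∀ i ∈ S, HasPolyDerivAt (p i) (p' i) s₀) :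
    HasPolyDerivAt (fun s => ∑ i ∈ S, p i s) (∑ i ∈ S, p' i) s₀ := by
  classical
  choose! N hN using fun i hi => (hp i hi).1
  refine ⟨⟨S.sup N, fun s => natDegree_sum_le_of_forall_le _ _ fun i hi =>
    (hN i hi s).trans (Finset.le_sup hi)⟩, fun j => ?_⟩
  simp only [finsetSum_coeff]
  exact HasDerivAt.fun_sum fun i hi => (hp i hi).2 j

lemma natDegree_le (hp : HasPolyDerivAt p p' s₀) {N : ℕ} (hN : ∀ s, (p s).natDegree ≤ N) :
    p'.natDegree ≤ N := by
  refine natDegree_le_iff_coeff_eq_zero.2 fun i hi => ?_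
  have h1 : (fun s => (p s).coeff i) = fun _ => 0 :=
    funext fun s => coeff_eq_zero_of_natDegree_lt ((hN s).trans_lt hi)
  have h2 := hp.2 i
  rw [h1] at h2
  exact h2.unique (hasDerivAt_const _ _)

/-- The leading coefficient is constantly `1`, so its derivative vanishes. -/
lemma degree_lt_of_monic (hp : HasPolyDerivAt p p' s₀) {n : ℕ} (hm : ∀ s, (p s).Monic)
    (hn : ∀ s, (p s).natDegree = n) : p'.degree < n := by
  rw [degree_lt_iff_coeff_zero]
  intro i hi
  rcases hi.eq_or_lt with rfl | hi
  · have h1 : (fun s => (p s).coeff n) = fun _ => 1 := by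
      ext s
      rw [← hn s]
      exact (hm s).coeff_natDegree
    have h2 := hp.2 n
    rw [h1] at h2
    exact h2.unique (hasDerivAt_const _ _)
  · exact coeff_eq_zero_of_natDegree_lt ((hp.natDegree_le fun s => (hn s).le).trans_lt hi)

lemma eval (hp : HasPolyDerivAt p p' s₀) (x : ℝ) :
    HasDerivAt (fun s => (p s).eval x) (p'.eval x) s₀ := by
  obtain ⟨N, hN⟩ := hp.1
  rw [eval_eq_sum_range' (Nat.lt_succ_of_le (hp.natDegree_le hN))]
  simp only [fun s => eval_eq_sum_range' (Nat.lt_succ_of_le (hN s))]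
  exact HasDerivAt.fun_sum fun i _ => (hp.2 i).mul_const _

/-- The evaluation point may move as well, as it does for `R` and `r` when the jump itself is
varied. -/
lemma continuousAt_eval (hp : HasPolyDerivAt p p' s₀) {x : ℝ → ℝ} (hx : ContinuousAt x s₀) :
    ContinuousAt (fun s => (p s).eval (x s)) s₀ := by
  obtain ⟨N, hN⟩ := hp.1
  simp only [fun s => eval_eq_sum_range' (Nat.lt_succ_of_le (hN s))]
  exact tendsto_finsetSum _ fun i _ => (hp.2 i).continuousAt.mul (hx.pow i)

end HasPolyDerivAt

section Param

variable {m : ℕ} {α : ℝ} {ω : Fin (m + 1) → ℝ} {t : Fin m → ℝ}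

/-! ### Dependence on the jump positions -/

lemma hasDerivAt_integral_Ioi_w0 (hα : -1 < α) (q : ℝ[X]) {a : ℝ} (ha : 0 < a) :
    HasDerivAt (fun s => ∫ x in Ioi s, q.eval x * w0 α x) (-(q.eval a * w0 α a)) a := by
  have hint := integrableOn_eval_mul_w0 hα q
  have hcont : ContinuousOn (fun x => q.eval x * w0 α x) (Ioi 0) :=
    q.continuous.continuousOn.mul (w0_continuousOn α)
  have h1 : HasDerivAt (fun s => ∫ x in a..s, q.eval x * w0 α x) (q.eval a * w0 α a) a :=
    intervalIntegral.integral_hasDerivAt_right IntervalIntegrable.refl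
      (hcont.stronglyMeasurableAtFilter isOpen_Ioi a ha)
      (hcont.continuousAt (Ioi_mem_nhds ha))
  refine (h1.const_sub (∫ x in Ioi a, q.eval x * w0 α x)).congr_of_eventuallyEq ?_
  filter_upwards [Ioi_mem_nhds ha] with s hs
  have h2 := intervalIntegral.integral_Ioi_sub_Ioi'
    (hint.mono_set (Ioi_subset_Ioi ha.le)) (hint.mono_set (Ioi_subset_Ioi (le_of_lt hs)))
  rw [← h2]
  ring

lemma mom_eq (hα : -1 < α) (ω : Fin (m + 1) → ℝ) (ht : ∀ k, 0 ≤ t k) (q : ℝ[X]) :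
    mom hα ω t q = ω 0 * (∫ x in Ioi (0 : ℝ), q.eval x * w0 α x) +
      ∑ k, ω k.succ * ∫ x in Ioi (t k), q.eval x * w0 α x := by
  have h1 := ofReal_mom (ω := ω) (t := t) hα q
  rw [integral_weight_mul ω ht (integrableOn_w0_mul hα q (g := fun _ => 1) continuous_const
    (B := 1) (by simp))] at h1
  have h2 : ∀ a : ℝ, ∫ x in Ioi a, (w0 α x : ℂ) * (((q.eval x : ℝ) : ℂ) * 1) =
      ((∫ x in Ioi a, q.eval x * w0 α x : ℝ) : ℂ) := by
    intro a
    rw [← integral_complex_ofReal]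
    congr 1
    ext x
    push_cast
    ring
  simp only [h2] at h1
  exact_mod_cast h1

lemma hasDerivAt_mom (hα : -1 < α) (ω : Fin (m + 1) → ℝ) (ht : ∀ k, 0 < t k) (k : Fin m)
    (q : ℝ[X]) : HasDerivAt (fun s => mom hα ω (Function.update t k s) q)
      (-(ω k.succ * w0 α (t k) * q.eval (t k))) (t k) := by
  have h1 := ((hasDerivAt_integral_Ioi_w0 hα q (ht k)).const_mul (ω k.succ)).const_add
    (ω 0 * (∫ x in Ioi (0 : ℝ), q.eval x * w0 α x) +
      ∑ j ∈ Finset.univ.erase k, ω j.succ * ∫ x in Ioi (t j), q.eval x * w0 α x)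
  refine (h1.congr_deriv (by ring)).congr_of_eventuallyEq ?_
  filter_upwards [Ioi_mem_nhds (ht k)] with s hs
  have h2 : ∀ j, 0 ≤ Function.update t k s j := by
    intro j
    by_cases hj : j = k
    · subst hj
      rw [Function.update_self]
      exact le_of_lt hs
    · rw [Function.update_of_ne hj]
      exact (ht j).le
  rw [mom_eq hα ω h2, ← Finset.sum_erase_add _ _ (Finset.mem_univ k), Function.update_self,
    Finset.sum_congr rfl fun j hj => by rw [Function.update_of_ne (Finset.ne_of_mem_erase hj)]]
  ring

/-- A product rule: one term from the polynomial, one from the moving endpoint. The uniform degree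
bound reduces it to finitely many moments. -/
lemma hasDerivAt_mom_poly (hα : -1 < α) (ω : Fin (m + 1) → ℝ) (ht : ∀ k, 0 < t k) (k : Fin m)
    {p : ℝ → ℝ[X]} {p' : ℝ[X]} (hp : HasPolyDerivAt p p' (t k)) :
    HasDerivAt (fun s => mom hα ω (Function.update t k s) (p s))
      (mom hα ω t p' - ω k.succ * w0 α (t k) * (p (t k)).eval (t k)) (t k) := by
  obtain ⟨N, hN⟩ := hp.1
  have h1 : ∀ (u : Fin m → ℝ) (q : ℝ[X]), q.natDegree ≤ N → mom hα ω u q =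
      ∑ i ∈ Finset.range (N + 1), q.coeff i * mom hα ω u (X ^ i) := by
    intro u q hq
    conv_lhs => rw [as_sum_range_C_mul_X_pow' q (Nat.lt_succ_of_le hq)]
    rw [map_sum]
    exact Finset.sum_congr rfl fun i _ => IsOPS.map_C_mul _ _ _
  rw [h1 t p' (hp.natDegree_le hN)]
  simp only [fun s => h1 (Function.update t k s) (p s) (hN s)]
  have h2 := HasDerivAt.fun_sum (u := Finset.range (N + 1))
    fun i _ => (hp.2 i).mul (hasDerivAt_mom hα ω ht k (X ^ i))
  refine h2.congr_deriv ?_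
  rw [eval_eq_sum_range' (Nat.lt_succ_of_le (hN (t k))), Finset.mul_sum,
    ← Finset.sum_sub_distrib, Function.update_eq_self]
  refine Finset.sum_congr rfl fun i _ => ?_
  rw [eval_pow, eval_X]
  ring

lemma continuousAt_update_apply (t : Fin m → ℝ) (k j : Fin m) (a : ℝ) :
    ContinuousAt (fun s => Function.update t k s j) a := by
  have h1 : Continuous (fun s => Function.update t k s) := continuous_const.update k continuous_id
  exact (continuous_pi_iff.1 h1 j).continuousAt

lemma eventually_update_mem_chamber (ht : t ∈ chamber m) (k : Fin m) :
    ∀ᶠ s in 𝓝 (t k), Function.update t k s ∈ chamber m := by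
  have hc : ∀ j, ContinuousAt (fun s => Function.update t k s j) (t k) := fun j =>
    continuousAt_update_apply t k j _
  have h1 : ∀ᶠ s in 𝓝 (t k), ∀ j, 0 < Function.update t k s j := by
    refine eventually_all.2 fun j => (hc j).eventually (lt_mem_nhds ?_)
    simpa only [Function.update_eq_self] using ht.1 j
  have h2 : ∀ᶠ s in 𝓝 (t k), ∀ i j, i < j →
      Function.update t k s i < Function.update t k s j := by
    refine eventually_all.2 fun i => eventually_all.2 fun j => ?_
    by_cases hij : i < j
    · have h3 := (hc i).eventually_lt (hc j) (by rw [Function.update_eq_self]; exact ht.2 hij)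
      filter_upwards [h3] with s hs _ using hs
    · exact Eventually.of_forall fun s h => absurd h hij
  filter_upwards [h1, h2] with s h1 h2 using ⟨h1, fun i j hij => h2 i j hij⟩

variable (hα : -1 < α) (hω : ∀ l : Fin (m + 1), 0 ≤ ∑ k ∈ Finset.Iic l, ω k) (hω0 : ω ≠ 0)
  (ht : t ∈ chamber m)

include hα hω hω0 ht in
-- The Gram–Schmidt coefficients are quotients of differentiable pairings with nonzero denominators.
-- Mere existence suffices here, since orthogonality will determine the derivative.
lemma exists_hasPolyDerivAt_P (n : ℕ) (k : Fin m) :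
    ∃ p', HasPolyDerivAt (fun s => P α ω (Function.update t k s) n) p' (t k) := by
  induction n using Nat.strong_induction_on with
  | _ n ih =>
    choose! p' hp' using ih
    have h1 : ∀ j ∈ Finset.range n, ∃ q', HasPolyDerivAt (fun s =>
        C (form α ω (Function.update t k s) (X ^ n) (P α ω (Function.update t k s) j) /
          form α ω (Function.update t k s) (P α ω (Function.update t k s) j)
            (P α ω (Function.update t k s) j)) * P α ω (Function.update t k s) j) q' (t k) := by
      intro j hj
      have hj' := hp' j (Finset.mem_range.1 hj)
      simp only [form_eq_mom hα]
      have h2 := hasDerivAt_mom_poly hα ω ht.1 k ((HasPolyDerivAt.const (X ^ n) _).mul hj')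
      have h3 := hasDerivAt_mom_poly hα ω ht.1 k (hj'.mul hj')
      refine ⟨_, (HasPolyDerivAt.C_fun (h2.div h3 ?_)).mul hj'⟩
      rw [Function.update_eq_self]
      exact (mom_mul_self_pos hα hω hω0 ht (monic_P α ω t j).ne_zero).ne'
    choose! q' hq' using h1
    refine ⟨0 - ∑ j ∈ Finset.range n, q' j, ?_⟩
    simp only [fun s => P_eq α ω (Function.update t k s) n]
    exact (HasPolyDerivAt.const _ _).sub (HasPolyDerivAt.sum hq')

include hα hω hω0 ht in
/-- The derivative of an orthogonal polynomial in a jump position. -/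
lemma hasPolyDerivAt_P (n : ℕ) (k : Fin m) :
    HasPolyDerivAt (fun s => P α ω (Function.update t k s) n)
      (C ((P α ω t n).eval (t k)) * jumpKernel n α ω t k) (t k) := by
  obtain ⟨p', hp'⟩ := exists_hasPolyDerivAt_P hα hω hω0 ht n k
  have hp := isOPS hα hω hω0 ht
  have hdeg : p'.degree < n :=
    hp'.degree_lt_of_monic (fun s => monic_P _ _ _ _) (fun s => natDegree_P _ _ _ _)
  convert hp' using 1
  refine (hp.ext_of_pairing hdeg ?_ fun j hj => ?_).symm
  · exact IsOPS.degree_C_mul_lt _ (IsOPS.degree_C_mul_lt _ (hp.degree_kernel_lt n _))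
  · obtain ⟨q', hq'⟩ := exists_hasPolyDerivAt_P hα hω hω0 ht j k
    have hqdeg : q'.degree < n :=
      (hq'.degree_lt_of_monic (fun s => monic_P _ _ _ _) (fun s => natDegree_P _ _ _ _)).trans
        (by exact_mod_cast hj)
    have h1 := hasDerivAt_mom_poly hα ω ht.1 k (hp'.mul hq')
    have h2 : (fun s => mom hα ω (Function.update t k s)
        (P α ω (Function.update t k s) n * P α ω (Function.update t k s) j)) =ᶠ[𝓝 (t k)]
        fun _ => 0 := by
      filter_upwards [eventually_update_mem_chamber ht k] with s hs
      exact (isOPS hα hω hω0 hs).orth n j hj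
    -- In the derivative of the orthogonality relation, the term with the derivative of `P j` drops
    -- out by degree. What remains is the pairing that characterizes the kernel.
    have h3 := h1.unique ((hasDerivAt_const _ _).congr_of_eventuallyEq h2)
    rw [Function.update_eq_self, map_add, mul_comm (P α ω t n), hp.map_mul_eq_zero hqdeg,
      eval_mul] at h3
    rw [jumpKernel, mul_assoc, mul_assoc, IsOPS.map_C_mul, IsOPS.map_C_mul, hp.map_kernel_mul hj]
    linarith

include hα hω hω0 ht in
-- The derivative of `P_n` has degree below `n` and is orthogonal to `P_n`, so only the endpoint
-- term contributes.
lemma hasDerivAt_h (n : ℕ) (k : Fin m) :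
    HasDerivAt (fun s => h n α ω (Function.update t k s)) (-R n α ω t k * h n α ω t) (t k) := by
  have hp := isOPS hα hω hω0 ht
  have h1 := hasPolyDerivAt_P hα hω hω0 ht n k
  have h2 := hasDerivAt_mom_poly hα ω ht.1 k (h1.mul h1)
  have h3 : ∀ s, h n α ω (Function.update t k s) = mom hα ω (Function.update t k s)
      (P α ω (Function.update t k s) n * P α ω (Function.update t k s) n) :=
    fun s => form_eq_mom hα _ _
  simp only [h3]
  refine h2.congr_deriv ?_
  have h4 : (C ((P α ω t n).eval (t k)) * jumpKernel n α ω t k).degree < n :=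
    IsOPS.degree_C_mul_lt _ (IsOPS.degree_C_mul_lt _ (hp.degree_kernel_lt n _))
  rw [Function.update_eq_self, map_add, mul_comm (P α ω t n) (C _ * _), hp.map_mul_eq_zero h4,
    eval_mul, R]
  have h5 := (h_pos hα hω hω0 ht n).ne'
  field_simp
  ring

include hα hω hω0 ht in
lemma hasDerivAt_log_h (n : ℕ) (k : Fin m) :
    HasDerivAt (fun s => Real.log (h n α ω (Function.update t k s))) (-R n α ω t k) (t k) := by
  have h5 := (h_pos hα hω hω0 ht n).ne'
  have h1 := (hasDerivAt_h hα hω hω0 ht n k).log (by rwa [Function.update_eq_self])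
  refine h1.congr_deriv ?_
  rw [Function.update_eq_self, mul_div_cancel_right₀ _ h5]

include hα hω hω0 ht in
-- The Euler weight `t k` is exactly the factor that converts the kernel at `0` into `R` and `r`.
lemma hasDerivAt_P_succ_eval_zero (n : ℕ) (k : Fin m) :
    ∃ d, HasDerivAt (fun s => (P α ω (Function.update t k s) (n + 1)).eval 0) d (t k) ∧
      t k * d = recBeta (n + 1) α ω t * R (n + 1) α ω t k * (P α ω t n).eval 0 -
        r (n + 1) α ω t k * (P α ω t (n + 1)).eval 0 := by
  refine ⟨_, (hasPolyDerivAt_P hα hω hω0 ht (n + 1) k).eval 0, ?_⟩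
  have h3 := congrArg (eval 0) (sub_mul_jumpKernel_succ hα hω hω0 ht n k)
  simp only [eval_mul, eval_sub, eval_X, eval_C] at h3 ⊢
  linarith

include hα hω hω0 ht in
lemma hasDerivAt_P_eval_zero (n : ℕ) (k : Fin m) :
    ∃ d, HasDerivAt (fun s => (P α ω (Function.update t k s) n).eval 0) d (t k) ∧
      t k * d = r (n + 1) α ω t k * (P α ω t n).eval 0 -
        R n α ω t k * (P α ω t (n + 1)).eval 0 - t k * R n α ω t k * (P α ω t n).eval 0 := by
  refine ⟨_, (hasPolyDerivAt_P hα hω hω0 ht n k).eval 0, ?_⟩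
  have h3 := congrArg (eval 0) (sub_mul_jumpKernel hα hω hω0 ht n k)
  -- The derivative of `P_n` involves the kernel with `n` terms, the ladder identity the one with `n
  -- + 1`. The extra term gives the summand with `t k * R n`, which later cancels against the
  -- derivative of `h n`.
  have h4 : (jumpKernel (n + 1) α ω t k).eval 0 = (jumpKernel n α ω t k).eval 0 +
      ω k.succ * w0 α (t k) * ((P α ω t n).eval (t k) / h n α ω t * (P α ω t n).eval 0) := by
    rw [jumpKernel, jumpKernel, kernel, Finset.sum_range_succ, ← kernel]
    simp only [eval_mul, eval_add, eval_C]
    ring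
  simp only [eval_mul, eval_sub, eval_X, eval_C] at h3 ⊢
  rw [h4] at h3
  have h5 : R n α ω t k = ω k.succ * w0 α (t k) * ((P α ω t n).eval (t k) *
      ((P α ω t n).eval (t k) / h n α ω t)) := by
    rw [R]
    ring
  linear_combination -h3 + t k * (P α ω t n).eval 0 * h5

include hα hω hω0 ht in
lemma continuousAt_R (n : ℕ) (k j : Fin m) :
    ContinuousAt (fun s => R n α ω (Function.update t k s) j) (t k) := by
  have hc := continuousAt_update_apply t k j (t k)
  have hw : ContinuousAt (fun s => w0 α (Function.update t k s j)) (t k) := by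
    refine ContinuousAt.comp_of_eq (g := w0 α) (y := t j) ?_ hc (by rw [Function.update_eq_self])
    exact (w0_continuousOn α).continuousAt (Ioi_mem_nhds (ht.1 j))
  have hh := (hasDerivAt_h hα hω hω0 ht n k).continuousAt
  have hP := (hasPolyDerivAt_P hα hω hω0 ht n k).continuousAt_eval hc
  have h5 := (h_pos hα hω hω0 ht n).ne'
  exact (continuousAt_const.mul (hw.div hh (by rwa [Function.update_eq_self]))).mul (hP.pow 2)

include hα hω hω0 ht in
lemma continuousAt_r (n : ℕ) (k j : Fin m) :
    ContinuousAt (fun s => r n α ω (Function.update t k s) j) (t k) := by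
  have hc := continuousAt_update_apply t k j (t k)
  have hw : ContinuousAt (fun s => w0 α (Function.update t k s j)) (t k) := by
    refine ContinuousAt.comp_of_eq (g := w0 α) (y := t j) ?_ hc (by rw [Function.update_eq_self])
    exact (w0_continuousOn α).continuousAt (Ioi_mem_nhds (ht.1 j))
  have hh := (hasDerivAt_h hα hω hω0 ht (n - 1) k).continuousAt
  have hP := (hasPolyDerivAt_P hα hω hω0 ht n k).continuousAt_eval hc
  have hQ := (hasPolyDerivAt_P hα hω hω0 ht (n - 1) k).continuousAt_eval hc
  have h5 := (h_pos hα hω hω0 ht (n - 1)).ne'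
  exact (continuousAt_const.mul (hw.div hh (by rwa [Function.update_eq_self]))).mul (hP.mul hQ)

include hα hω hω0 in
/-- The regular set is open along the coordinate lines. -/
lemma eventually_update_mem_regular {n : ℕ} (ht : t ∈ regular n α ω) (k : Fin m) :
    ∀ᶠ s in 𝓝 (t k), Function.update t k s ∈ regular n α ω := by
  obtain ⟨ht, h1, h2, h3⟩ := ht
  have hR : ∀ j, ContinuousAt (fun s => R n α ω (Function.update t k s) j) (t k) :=
    continuousAt_R hα hω hω0 ht n k
  have e1 : ∀ᶠ s in 𝓝 (t k), ∀ j, R n α ω (Function.update t k s) j ≠ 0 :=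
    eventually_all.2 fun j => (hR j).eventually_ne (by rw [Function.update_eq_self]; exact h1 j)
  have e2 : ∀ᶠ s in 𝓝 (t k), ∑ j, R n α ω (Function.update t k s) j - 1 ≠ 0 := by
    refine ContinuousAt.eventually_ne (ContinuousAt.sub ?_ continuousAt_const)
      (by rw [Function.update_eq_self]; exact h2)
    exact tendsto_finsetSum _ fun j _ => hR j
  have e3 : ∀ᶠ s in 𝓝 (t k), ∑ j, r n α ω (Function.update t k s) j + n ≠ 0 := by
    refine ContinuousAt.eventually_ne (ContinuousAt.add ?_ continuousAt_const)
      (by rw [Function.update_eq_self]; exact h3)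
    exact tendsto_finsetSum _ fun j _ => continuousAt_r hα hω hω0 ht n k j
  filter_upwards [eventually_update_mem_chamber ht k, e1, e2, e3] with s a b c d
    using ⟨a, b, c, d⟩

end Param

end JumpLaguerre

namespace JumpLaguerre
open Polynomial MeasureTheory Set Filter Topology

/-! ### The Cauchy transform -/

lemma ofReal_sub_ne_zero {z : ℂ} (hz : z.im ≠ 0) (x : ℝ) : (x : ℂ) - z ≠ 0 := by
  intro h1
  have h2 := congrArg Complex.im h1
  simp only [Complex.sub_im, Complex.ofReal_im, zero_sub, Complex.zero_im, neg_eq_zero] at h2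
  exact hz h2

lemma abs_im_le_norm_ofReal_sub (z : ℂ) (x : ℝ) : |z.im| ≤ ‖(x : ℂ) - z‖ := by
  have h1 := Complex.abs_im_le_norm ((x : ℂ) - z)
  simpa using h1

lemma norm_inv_ofReal_sub_le {z : ℂ} (hz : z.im ≠ 0) (x : ℝ) :
    ‖((x : ℂ) - z)⁻¹‖ ≤ |z.im|⁻¹ := by
  rw [norm_inv]
  exact inv_anti₀ (abs_pos.2 hz) (abs_im_le_norm_ofReal_sub z x)

lemma continuous_inv_ofReal_sub {z : ℂ} (hz : z.im ≠ 0) :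
    Continuous (fun x : ℝ => ((x : ℂ) - z)⁻¹) :=
  (Complex.continuous_ofReal.sub continuous_const).inv₀ (ofReal_sub_ne_zero hz)

lemma aeval_ofReal (p : ℝ[X]) (x : ℝ) : aeval (x : ℂ) p = ((p.eval x : ℝ) : ℂ) := by
  have := aeval_algebraMap_apply ℂ x p
  rwa [coe_aeval_eq_eval] at this

section Cauchy

variable {m : ℕ} {α : ℝ} {ω : Fin (m + 1) → ℝ} {t : Fin m → ℝ} {z : ℂ}

lemma cauchy_eq (p : ℝ[X]) (z : ℂ) : cauchy α ω t p z =
    ∫ x in Ioi (0 : ℝ), (weight α ω t x : ℂ) * ((p.eval x : ℝ) * ((x : ℂ) - z)⁻¹) := by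
  rw [cauchy]
  congr 1
  ext x
  push_cast
  rw [div_eq_mul_inv]
  ring

lemma integrableOn_weight_mul_eval (hα : -1 < α) (ω : Fin (m + 1) → ℝ) (t : Fin m → ℝ)
    (p : ℝ[X]) : IntegrableOn (fun x => (weight α ω t x : ℂ) * ((p.eval x : ℝ) * (1 : ℂ)))
      (Ioi 0) :=
  integrableOn_weight_mul ω t (integrableOn_w0_mul hα p continuous_const (B := 1) (by simp))

lemma integrableOn_cauchy (hα : -1 < α) (ω : Fin (m + 1) → ℝ) (t : Fin m → ℝ) (hz : z.im ≠ 0)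
    (p : ℝ[X]) : IntegrableOn
      (fun x => (weight α ω t x : ℂ) * ((p.eval x : ℝ) * ((x : ℂ) - z)⁻¹)) (Ioi 0) :=
  integrableOn_weight_mul ω t
    (integrableOn_w0_mul hα p (continuous_inv_ofReal_sub hz) (norm_inv_ofReal_sub_le hz))

lemma integrableOn_cauchy_sq (hα : -1 < α) (ω : Fin (m + 1) → ℝ) (t : Fin m → ℝ) (hz : z.im ≠ 0)
    (p : ℝ[X]) : IntegrableOn
      (fun x => (weight α ω t x : ℂ) * ((p.eval x : ℝ) * ((x : ℂ) - z)⁻¹ ^ 2)) (Ioi 0) := by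
  refine integrableOn_weight_mul ω t (integrableOn_w0_mul hα p
    ((continuous_inv_ofReal_sub hz).pow 2) (B := |z.im|⁻¹ ^ 2) fun x => ?_)
  rw [norm_pow]
  exact pow_le_pow_left₀ (norm_nonneg _) (norm_inv_ofReal_sub_le hz x) 2

/-- The Cauchy transform at `z`, as a linear map on polynomials. -/
def cauchyMap (hα : -1 < α) (ω : Fin (m + 1) → ℝ) (t : Fin m → ℝ) (hz : z.im ≠ 0) :
    ℝ[X] →ₗ[ℝ] ℂ where
  toFun p := cauchy α ω t p z
  map_add' p q := by
    simp only [cauchy_eq]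
    rw [← integral_add (integrableOn_cauchy hα ω t hz p) (integrableOn_cauchy hα ω t hz q)]
    congr 1
    ext x
    rw [eval_add]
    push_cast
    ring
  map_smul' c p := by
    simp only [cauchy_eq, RingHom.id_apply]
    rw [Complex.real_smul, ← integral_const_mul]
    congr 1
    ext x
    rw [eval_smul, smul_eq_mul]
    push_cast
    ring

lemma cauchyMap_apply (hα : -1 < α) (hz : z.im ≠ 0) (p : ℝ[X]) :
    cauchyMap hα ω t hz p = cauchy α ω t p z := rfl

lemma cauchyMap_C_mul (hα : -1 < α) (hz : z.im ≠ 0) (c : ℝ) (p : ℝ[X]) :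
    cauchyMap hα ω t hz (C c * p) = c * cauchyMap hα ω t hz p := by
  rw [← smul_eq_C_mul, map_smul, Complex.real_smul]

/-- From `x / (x - z) = 1 + z / (x - z)`. -/
lemma cauchyMap_X_mul (hα : -1 < α) (hz : z.im ≠ 0) (p : ℝ[X]) :
    cauchyMap hα ω t hz (X * p) = z * cauchyMap hα ω t hz p + mom hα ω t p := by
  rw [cauchyMap_apply, cauchyMap_apply, cauchy_eq, cauchy_eq, ofReal_mom, ← integral_const_mul,
    ← integral_add ((integrableOn_cauchy hα ω t hz p).const_mul z)
      (integrableOn_weight_mul_eval hα ω t p)]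
  congr 1
  ext x
  have h1 := ofReal_sub_ne_zero hz x
  rw [eval_mul, eval_X]
  push_cast
  field_simp
  ring

lemma cauchyMap_X_sub_C_mul (hα : -1 < α) (hz : z.im ≠ 0) (p : ℝ[X]) (s : ℝ) :
    cauchyMap hα ω t hz ((X - C s) * p) =
      (z - s) * cauchyMap hα ω t hz p + mom hα ω t p := by
  rw [sub_mul, map_sub, cauchyMap_X_mul, cauchyMap_C_mul]
  ring

lemma hasDerivAt_cauchy (hα : -1 < α) (ω : Fin (m + 1) → ℝ) (t : Fin m → ℝ) (hz : z.im ≠ 0)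
    (p : ℝ[X]) : HasDerivAt (cauchy α ω t p)
      (∫ x in Ioi (0 : ℝ), (weight α ω t x : ℂ) * ((p.eval x : ℝ) * ((x : ℂ) - z)⁻¹ ^ 2)) z := by
  -- On the ball of this radius `|Im ζ|` stays above `|Im z| / 2`, which gives a dominating function
  -- for differentiation under the integral.
  have hz2 : 0 < |z.im| / 2 := half_pos (abs_pos.2 hz)
  have him : ∀ ζ ∈ Metric.ball z (|z.im| / 2), |z.im| / 2 ≤ |ζ.im| := by
    intro ζ hζ
    have h1 : |z.im - ζ.im| ≤ ‖z - ζ‖ := by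
      simpa using Complex.abs_im_le_norm (z - ζ)
    have h2 : ‖z - ζ‖ < |z.im| / 2 := by
      rw [← dist_eq_norm, dist_comm]
      exact hζ
    have h3 := abs_sub_abs_le_abs_sub z.im ζ.im
    linarith
  have him0 : ∀ ζ ∈ Metric.ball z (|z.im| / 2), ζ.im ≠ 0 := fun ζ hζ =>
    abs_pos.1 (hz2.trans_le (him ζ hζ))
  have hball := Metric.ball_mem_nhds z hz2
  have h1 := hasDerivAt_integral_of_dominated_loc_of_deriv_le
    (μ := volume.restrict (Ioi 0))
    (F := fun (ζ : ℂ) (x : ℝ) => (weight α ω t x : ℂ) * ((p.eval x : ℝ) * ((x : ℂ) - ζ)⁻¹))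
    (F' := fun (ζ : ℂ) (x : ℝ) => (weight α ω t x : ℂ) * ((p.eval x : ℝ) * ((x : ℂ) - ζ)⁻¹ ^ 2))
    (bound := fun x => ‖(weight α ω t x : ℂ) * ((p.eval x : ℝ) * (1 : ℂ))‖ * (|z.im| / 2)⁻¹ ^ 2)
    (x₀ := z) hball ?_ (integrableOn_cauchy hα ω t hz p)
    (integrableOn_cauchy_sq hα ω t hz p).aestronglyMeasurable ?_ ?_ ?_
  · have h2 : cauchy α ω t p = fun ζ => ∫ x in Ioi (0 : ℝ),
        (weight α ω t x : ℂ) * ((p.eval x : ℝ) * ((x : ℂ) - ζ)⁻¹) := funext fun ζ => cauchy_eq p ζ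
    rw [h2]
    exact h1.2
  · filter_upwards [hball] with ζ hζ
    exact (integrableOn_cauchy hα ω t (him0 ζ hζ) p).aestronglyMeasurable
  · refine Eventually.of_forall fun x ζ hζ => ?_
    rw [norm_mul, norm_mul, norm_mul, norm_mul, norm_one, mul_one, norm_pow, mul_assoc]
    gcongr
    refine (norm_inv_ofReal_sub_le (him0 ζ hζ) x).trans ?_
    exact inv_anti₀ hz2 (him ζ hζ)
  · exact (integrableOn_weight_mul_eval hα ω t p).norm.mul_const _
  · refine Eventually.of_forall fun x ζ hζ => ?_
    have hne := ofReal_sub_ne_zero (him0 ζ hζ) x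
    have h3 : HasDerivAt (fun ζ : ℂ => ((x : ℂ) - ζ)⁻¹) (((x : ℂ) - ζ)⁻¹ ^ 2) ζ := by
      refine (((hasDerivAt_id ζ).const_sub (x : ℂ)).inv hne).congr_deriv ?_
      simp only [id]
      field_simp
    exact (h3.const_mul _).const_mul _

/-- The differential equation of the Cauchy transform, from the Pearson equation. -/
lemma exists_hasDerivAt_cauchy (hα : -1 < α) (ω : Fin (m + 1) → ℝ) (ht : ∀ k, 0 ≤ t k)
    (hz : z.im ≠ 0) (p : ℝ[X]) : ∃ d, HasDerivAt (cauchy α ω t p) d z ∧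
      z * d = cauchyMap hα ω t hz (X * derivative p + (C α - X) * p) -
        ∑ k, (ω k.succ * w0 α (t k) * p.eval (t k) : ℝ) * t k / (z - t k) := by
  refine ⟨_, hasDerivAt_cauchy hα ω t hz p, ?_⟩
  have hg : ∀ x : ℝ, HasDerivAt (fun x : ℝ => ((x : ℂ) - z)⁻¹) (-((x : ℂ) - z)⁻¹ ^ 2) x := by
    intro x
    have hne := ofReal_sub_ne_zero hz x
    refine ((((hasDerivAt_id (x : ℂ)).sub_const z).inv hne).comp_ofReal).congr_deriv ?_
    simp only [id]
    field_simp
  have h1 := integral_weight_deriv hα ω ht p hg (((continuous_inv_ofReal_sub hz).pow 2).neg)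
    (norm_inv_ofReal_sub_le hz) (B' := |z.im|⁻¹ ^ 2) (fun x => by
      rw [norm_neg, norm_pow]
      exact pow_le_pow_left₀ (norm_nonneg _) (norm_inv_ofReal_sub_le hz x) 2)
  -- Because `1 / (x - z) - x / (x - z)² = -z / (x - z)²`, the `1` in `α + 1` combines with the
  -- derivative of the Cauchy kernel into `-z` times the derivative of the transform.
  have h2 : ∫ x in Ioi (0 : ℝ), (weight α ω t x : ℂ) *
      ((((C (α + 1) - X) * p + X * derivative p).eval x : ℝ) * ((x : ℂ) - z)⁻¹ +
        ((X * p).eval x : ℝ) * -((x : ℂ) - z)⁻¹ ^ 2) =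
      cauchyMap hα ω t hz (X * derivative p + (C α - X) * p) -
        z * ∫ x in Ioi (0 : ℝ), (weight α ω t x : ℂ) * ((p.eval x : ℝ) * ((x : ℂ) - z)⁻¹ ^ 2) := by
    rw [cauchyMap_apply, cauchy_eq, ← integral_const_mul,
      ← integral_sub (integrableOn_cauchy hα ω t hz _)
        ((integrableOn_cauchy_sq hα ω t hz p).const_mul z)]
    congr 1
    ext x
    have hne := ofReal_sub_ne_zero hz x
    simp only [eval_add, eval_mul, eval_sub, eval_X, eval_C]
    push_cast
    field_simp
    ring
  rw [h2] at h1
  have h3 : ∑ k, ((ω k.succ * t k * w0 α (t k) * p.eval (t k) : ℝ) : ℂ) * ((t k : ℂ) - z)⁻¹ =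
      -∑ k, ((ω k.succ * w0 α (t k) * p.eval (t k) : ℝ) : ℂ) * t k / (z - t k) := by
    rw [← Finset.sum_neg_distrib]
    refine Finset.sum_congr rfl fun k _ => ?_
    rw [← neg_sub z, inv_neg, div_eq_mul_inv]
    push_cast
    ring
  rw [h3] at h1
  linear_combination -h1

/-! ### The common first-order system of both columns -/

variable (hα : -1 < α) (hω : ∀ l : Fin (m + 1), 0 ≤ ∑ k ∈ Finset.Iic l, ω k) (hω0 : ω ≠ 0)
  (ht : t ∈ chamber m)

lemma sub_ofReal_ne_zero (hz : z.im ≠ 0) (x : ℝ) : z - x ≠ 0 := by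
  rw [← neg_sub]
  exact neg_ne_zero.2 (ofReal_sub_ne_zero hz x)

include hα hω hω0 ht in
lemma exists_hasDerivAt_aeval_P_succ (hz : z.im ≠ 0) (n : ℕ) :
    ∃ d, HasDerivAt (fun ζ : ℂ => aeval ζ (P α ω t (n + 1))) d z ∧
      z * d = (n + 1) * aeval z (P α ω t (n + 1)) +
        recBeta (n + 1) α ω t * aeval z (P α ω t n) +
        ∑ k, t k * (recBeta (n + 1) α ω t * R (n + 1) α ω t k * aeval z (P α ω t n) -
          r (n + 1) α ω t k * aeval z (P α ω t (n + 1))) / (z - t k) := by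
  refine ⟨_, (P α ω t (n + 1)).hasDerivAt_aeval z, ?_⟩
  have h1 := congrArg (aeval z) (X_mul_derivative_P_succ hα hω hω0 ht n)
  simp only [map_mul, map_sub, map_add, map_sum, aeval_X, aeval_C, Complex.coe_algebraMap] at h1
  rw [h1, sub_eq_add_neg, ← Finset.sum_neg_distrib]
  push_cast
  congr 1
  refine Finset.sum_congr rfl fun k _ => ?_
  have h2 := congrArg (aeval z) (sub_mul_jumpKernel_succ hα hω hω0 ht n k)
  simp only [map_mul, map_sub, aeval_X, aeval_C, Complex.coe_algebraMap] at h2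
  rw [eq_div_iff (sub_ofReal_ne_zero hz _)]
  linear_combination (-(t k : ℂ)) * h2

include hα hω hω0 ht in
lemma exists_hasDerivAt_aeval_P (hz : z.im ≠ 0) (n : ℕ) :
    ∃ d, HasDerivAt (fun ζ : ℂ => aeval ζ (P α ω t n)) d z ∧
      z * d = (z - α - (n + 1)) * aeval z (P α ω t n) - aeval z (P α ω t (n + 1)) +
        ∑ k, t k * (r (n + 1) α ω t k * aeval z (P α ω t n) -
          R n α ω t k * aeval z (P α ω t (n + 1))) / (z - t k) := by
  refine ⟨_, (P α ω t n).hasDerivAt_aeval z, ?_⟩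
  have h1 := congrArg (aeval z) (X_mul_derivative_P_add hα hω hω0 ht n)
  simp only [map_mul, map_sub, map_add, map_neg, map_sum, aeval_X, aeval_C,
    Complex.coe_algebraMap] at h1
  have h3 : ∑ k, (t k : ℂ) * (r (n + 1) α ω t k * aeval z (P α ω t n) -
      R n α ω t k * aeval z (P α ω t (n + 1))) / (z - t k) =
      -∑ k, (t k : ℂ) * (((P α ω t n).eval (t k) : ℝ) * aeval z (jumpKernel (n + 1) α ω t k)) := by
    rw [← Finset.sum_neg_distrib]
    refine Finset.sum_congr rfl fun k _ => ?_
    have h2 := congrArg (aeval z) (sub_mul_jumpKernel hα hω hω0 ht n k)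
    simp only [map_mul, map_sub, aeval_X, aeval_C, Complex.coe_algebraMap] at h2
    rw [div_eq_iff (sub_ofReal_ne_zero hz _)]
    linear_combination (t k : ℂ) * h2
  rw [h3]
  push_cast at h1
  linear_combination h1

include hα hω hω0 ht in
-- The system is that of the polynomials with diagonal shift `α - z`. The boundary terms of the
-- Pearson equation cancel the masses of the jump kernels that appear when `X - t_k` is pulled out
-- of the transform.
lemma exists_hasDerivAt_cauchy_P_succ (hz : z.im ≠ 0) (n : ℕ) :
    ∃ d, HasDerivAt (cauchy α ω t (P α ω t (n + 1))) d z ∧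
      z * d = (α - z + (n + 1)) * cauchy α ω t (P α ω t (n + 1)) z +
        recBeta (n + 1) α ω t * cauchy α ω t (P α ω t n) z +
        ∑ k, t k * (recBeta (n + 1) α ω t * R (n + 1) α ω t k * cauchy α ω t (P α ω t n) z -
          r (n + 1) α ω t k * cauchy α ω t (P α ω t (n + 1)) z) / (z - t k) := by
  obtain ⟨d, hd, h1⟩ := exists_hasDerivAt_cauchy hα ω (fun k => (ht.1 k).le) hz (P α ω t (n + 1))
  refine ⟨d, hd, ?_⟩
  have hp := isOPS hα hω hω0 ht
  -- Orthogonality to constants lets `X` pass through the transform as multiplication by `z`.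
  have h0 : mom hα ω t (P α ω t (n + 1)) = 0 := by
    have := hp.orth (n + 1) 0 (Nat.succ_pos n)
    rwa [hp.zero_eq, mul_one] at this
  rw [h1, X_mul_derivative_P_succ hα hω hω0 ht, sub_mul (C α)]
  rw [map_add, map_sub, map_add, map_sum, map_sub, cauchyMap_X_mul, h0, cauchyMap_C_mul,
    cauchyMap_C_mul, cauchyMap_C_mul]
  have h3 : ∑ k, (t k : ℂ) * (recBeta (n + 1) α ω t * R (n + 1) α ω t k *
      cauchy α ω t (P α ω t n) z -
      r (n + 1) α ω t k * cauchy α ω t (P α ω t (n + 1)) z) / (z - t k) =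
      -∑ k, cauchyMap hα ω t hz (C (t k) * (C ((P α ω t (n + 1)).eval (t k)) *
        jumpKernel (n + 1) α ω t k)) - ∑ k,
        (ω k.succ * w0 α (t k) * (P α ω t (n + 1)).eval (t k) : ℝ) * t k / (z - t k) := by
    rw [← Finset.sum_neg_distrib, ← Finset.sum_sub_distrib]
    refine Finset.sum_congr rfl fun k _ => ?_
    have h2 := congrArg (cauchyMap hα ω t hz) (sub_mul_jumpKernel_succ hα hω hω0 ht n k)
    rw [cauchyMap_X_sub_C_mul, IsOPS.map_C_mul, mom_jumpKernel hα hω hω0 ht, map_sub,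
      cauchyMap_C_mul, cauchyMap_C_mul hα hz (r _ _ _ _ _), cauchyMap_C_mul hα hz (_ * _)] at h2
    rw [cauchyMap_C_mul, cauchyMap_C_mul]
    simp only [cauchyMap_apply] at h2 ⊢
    have h4 := sub_ofReal_ne_zero hz (t k)
    field_simp
    push_cast at h2 ⊢
    linear_combination (t k : ℂ) * h2
  rw [h3]
  simp only [cauchyMap_apply]
  push_cast
  ring

include hα hω hω0 ht in
lemma exists_hasDerivAt_cauchy_P (hz : z.im ≠ 0) (n : ℕ) :
    ∃ d, HasDerivAt (cauchy α ω t (P α ω t n)) d z ∧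
      z * d = -(n + 1) * cauchy α ω t (P α ω t n) z - cauchy α ω t (P α ω t (n + 1)) z +
        ∑ k, t k * (r (n + 1) α ω t k * cauchy α ω t (P α ω t n) z -
          R n α ω t k * cauchy α ω t (P α ω t (n + 1)) z) / (z - t k) := by
  obtain ⟨d, hd, h1⟩ := exists_hasDerivAt_cauchy hα ω (fun k => (ht.1 k).le) hz (P α ω t n)
  refine ⟨d, hd, ?_⟩
  rw [h1, X_mul_derivative_P_add hα hω hω0 ht]
  simp only [map_sub, map_sum, map_neg]
  rw [cauchyMap_C_mul]
  have h3 : ∑ k, (t k : ℂ) * (r (n + 1) α ω t k * cauchy α ω t (P α ω t n) z -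
      R n α ω t k * cauchy α ω t (P α ω t (n + 1)) z) / (z - t k) =
      -∑ k, cauchyMap hα ω t hz (C (t k) * (C ((P α ω t n).eval (t k)) *
        jumpKernel (n + 1) α ω t k)) - ∑ k,
        (ω k.succ * w0 α (t k) * (P α ω t n).eval (t k) : ℝ) * t k / (z - t k) := by
    rw [← Finset.sum_neg_distrib, ← Finset.sum_sub_distrib]
    refine Finset.sum_congr rfl fun k _ => ?_
    have h2 := congrArg (cauchyMap hα ω t hz) (sub_mul_jumpKernel hα hω hω0 ht n k)
    rw [cauchyMap_X_sub_C_mul, IsOPS.map_C_mul, mom_jumpKernel hα hω hω0 ht, map_sub,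
      cauchyMap_C_mul, cauchyMap_C_mul hα hz (R _ _ _ _ _), cauchyMap_C_mul hα hz (r _ _ _ _ _)]
      at h2
    rw [cauchyMap_C_mul, cauchyMap_C_mul]
    simp only [cauchyMap_apply] at h2 ⊢
    have h4 := sub_ofReal_ne_zero hz (t k)
    field_simp
    push_cast at h2 ⊢
    linear_combination (t k : ℂ) * h2
  rw [h3]
  simp only [cauchyMap_apply]
  push_cast
  ring

include hα hω hω0 ht in
/-- The Casorati determinant of the orthogonal polynomials and their Cauchy transforms. -/
lemma casorati (hz : z.im ≠ 0) (n : ℕ) :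
    aeval z (P α ω t n) * cauchy α ω t (P α ω t (n + 1)) z -
      aeval z (P α ω t (n + 1)) * cauchy α ω t (P α ω t n) z = h n α ω t := by
  have hp := isOPS hα hω hω0 ht
  have hn := (h_pos hα hω hω0 ht n).ne'
  -- Christoffel–Darboux at the points `x` and `z`, integrated in `x`; afterwards only `j = 0` has
  -- nonzero mass.
  have h1 : aeval z (P α ω t n) * cauchy α ω t (P α ω t (n + 1)) z -
      aeval z (P α ω t (n + 1)) * cauchy α ω t (P α ω t n) z =
      ∑ j ∈ Finset.range (n + 1), (h n α ω t : ℂ) * (h j α ω t : ℂ)⁻¹ * aeval z (P α ω t j) *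
        mom hα ω t (P α ω t j) := by
    simp only [ofReal_mom, cauchy_eq]
    simp only [← integral_const_mul]
    rw [← integral_finsetSum _ fun j _ => (integrableOn_weight_mul_eval hα ω t _).const_mul _,
      ← integral_sub ((integrableOn_cauchy hα ω t hz _).const_mul _)
        ((integrableOn_cauchy hα ω t hz _).const_mul _)]
    congr 1
    ext x
    have hne := ofReal_sub_ne_zero hz x
    have h2 := hp.christoffel_darboux (x : ℂ) z n
    simp only [aeval_ofReal, Complex.coe_algebraMap] at h2
    have h3 : ∑ j ∈ Finset.range (n + 1), (h n α ω t : ℂ) * (h j α ω t : ℂ)⁻¹ *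
        aeval z (P α ω t j) * ((weight α ω t x : ℂ) * ((((P α ω t j).eval x : ℝ) : ℂ) * 1)) =
        (h n α ω t : ℂ) * weight α ω t x * ∑ j ∈ Finset.range (n + 1),
          ((h j α ω t)⁻¹ : ℝ) * ((((P α ω t j).eval x : ℝ) : ℂ) * aeval z (P α ω t j)) := by
      rw [Finset.mul_sum]
      refine Finset.sum_congr rfl fun j _ => ?_
      push_cast
      ring
    have hn' : (h n α ω t : ℂ) ≠ 0 := by exact_mod_cast hn
    rw [h3]
    refine mul_left_cancel₀ hne ?_
    rw [mul_left_comm ((x : ℂ) - z), h2]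
    push_cast
    field_simp
  rw [h1, Finset.sum_eq_single_of_mem 0 (Finset.mem_range.2 (Nat.succ_pos n))]
  · have h0 : mom hα ω t (P α ω t 0) = h 0 α ω t := by
      have := hp.norm 0
      rw [hp.zero_eq, mul_one] at this
      rw [hp.zero_eq, this]
    have h4 : (h 0 α ω t : ℂ) ≠ 0 := by exact_mod_cast (h_pos hα hω hω0 ht 0).ne'
    rw [h0, hp.zero_eq, map_one]
    field_simp
  · intro j _ hj
    have h0 : mom hα ω t (P α ω t j) = 0 := by
      have := hp.orth_of_ne hj
      rwa [hp.zero_eq, mul_one] at this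
    rw [h0, Complex.ofReal_zero, mul_zero]

end Cauchy

end JumpLaguerre

namespace JumpLaguerre
open Polynomial Set Filter Topology

/-! ### Rational matrices with simple poles -/

section Rational

/-- A sum of simple fractions with distinct real poles vanishes off the real line only if all its
residues vanish. -/
lemma residue_eq_zero {ι : Type*} [Fintype ι] {s : ι → ℝ} (hs : Function.Injective s) {d : ι → ℂ}
    (hd : ∀ z : ℂ, z.im ≠ 0 → ∑ i, 1 / (z - s i) * d i = 0) (i : ι) : d i = 0 := by
  classical
  -- The pole `s i` is approached vertically, at `s i + I * ε`, where the hypothesis applies;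
  -- multiplying by `I * ε` isolates its residue.
  have hlim : ∀ j, Tendsto (fun ε : ℝ => Complex.I * ε * (1 / (s i + Complex.I * ε - s j) * d j))
      (𝓝[≠] 0) (𝓝 (if j = i then d i else 0)) := by
    intro j
    split_ifs with hj
    · subst hj
      refine tendsto_const_nhds.congr' ?_
      filter_upwards [self_mem_nhdsWithin] with ε hε
      have h1 : (ε : ℂ) ≠ 0 := by exact_mod_cast hε
      have h2 : Complex.I ≠ 0 := Complex.I_ne_zero
      rw [add_sub_cancel_left]
      field_simp
    · have h1 : (s i : ℂ) - s j ≠ 0 := by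
        rw [sub_ne_zero]
        exact_mod_cast fun h => hj (hs h).symm
      have h2 : ContinuousAt (fun ε : ℝ => Complex.I * ε *
          (1 / (s i + Complex.I * ε - s j) * d j)) 0 := by
        refine ContinuousAt.mul (by fun_prop) (ContinuousAt.mul ?_ continuousAt_const)
        refine ContinuousAt.div continuousAt_const (by fun_prop) ?_
        simpa using h1
      have h3 : Tendsto _ (𝓝[≠] (0 : ℝ)) _ := h2.tendsto.mono_left nhdsWithin_le_nhds
      simpa using h3
  have h1 := tendsto_finsetSum Finset.univ fun j _ => hlim j
  simp only [Finset.sum_ite_eq', Finset.mem_univ, if_true] at h1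
  refine tendsto_nhds_unique h1 (tendsto_const_nhds.congr' ?_)
  filter_upwards [self_mem_nhdsWithin] with ε hε
  rw [← Finset.mul_sum, hd _ (by simpa using hε), mul_zero]

variable {m : ℕ} [NeZero m] {t : Fin m → ℝ}

/-- The rational matrix with residue `A₀` at `0` and `A k` at `t k / t 0`, and with the Lax matrix's
value at infinity. -/
def ratMatrix (t : Fin m → ℝ) (A₀ : Matrix (Fin 2) (Fin 2) ℂ) (A : Fin m → Matrix (Fin 2) (Fin 2) ℂ)
    (z : ℂ) : Matrix (Fin 2) (Fin 2) ℂ :=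
  (-((t 0 : ℂ) / 2)) • sigma3 + (1 / z) • A₀ + ∑ k, (1 / (z - ((t k / t 0 : ℝ) : ℂ))) • A k

/-- The values at infinity cancel, and in the chamber the poles `0` and `t k / t 0` are distinct. In
the index type `Option (Fin m)`, `none` stands for the origin. -/
lemma ratMatrix_injective (ht : t ∈ chamber m) {A₀ B₀ : Matrix (Fin 2) (Fin 2) ℂ}
    {A B : Fin m → Matrix (Fin 2) (Fin 2) ℂ}
    (hAB : ∀ z : ℂ, z.im ≠ 0 → ratMatrix t A₀ A z = ratMatrix t B₀ B z) :
    A₀ = B₀ ∧ ∀ k, A k = B k := by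
  have hs : Function.Injective
      (fun i : Option (Fin m) => i.elim (0 : ℝ) fun k => t k / t 0) := by
    have h0 := ht.1 0
    intro i j hij
    rcases i with _ | i <;> rcases j with _ | j
    · rfl
    · exact absurd hij (div_pos (ht.1 j) h0).ne
    · exact absurd hij (div_pos (ht.1 i) h0).ne'
    · have h1 : t i / t 0 = t j / t 0 := hij
      rw [div_left_inj' h0.ne'] at h1
      rw [ht.2.injective h1]
  have h1 : ∀ a b (i : Option (Fin m)),
      (i.elim (A₀ a b - B₀ a b) fun k => A k a b - B k a b) = 0 := by
    intro a b
    refine residue_eq_zero hs fun z hz => ?_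
    have h2 := congrFun (congrFun (hAB z hz) a) b
    simp only [ratMatrix, Matrix.add_apply, Matrix.smul_apply, Matrix.sum_apply, smul_eq_mul] at h2
    rw [Fintype.sum_option]
    simp only [Option.elim_none, Option.elim_some, Complex.ofReal_zero, sub_zero, mul_sub,
      Finset.sum_sub_distrib]
    linear_combination h2
  constructor
  · ext a b
    exact sub_eq_zero.1 (h1 a b none)
  · intro k
    ext a b
    exact sub_eq_zero.1 (h1 a b (some k))

lemma L_eq_ratMatrix (n : ℕ) (α : ℝ) (t : Fin m → ℝ) (u v : Fin m → ℂ) (y z : ℂ) :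
    L n α t u v y z = ratMatrix t (A0 n α u v y) (fun k => Ak (u k) (v k) y) z := rfl

/-- Since `z / (z - t_k/t₁) = 1 + t_k / (t₁ z - t_k)`, the residue at the origin must absorb the sum
of the others; hence the sums in `res0`. -/
lemma mul_partial_fractions (ht : t ∈ chamber m) {z : ℂ} (hz : z.im ≠ 0) (c : ℂ) (a : Fin m → ℂ) :
    z * ((1 / z) * (c - ∑ k, a k) + ∑ k, 1 / (z - ((t k / t 0 : ℝ) : ℂ)) * a k) =
      c + ∑ k, t k * a k / (t 0 * z - t k) := by
  have hz0 : z ≠ 0 := by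
    rintro rfl
    exact hz Complex.zero_im
  have h0 : (t 0 : ℂ) ≠ 0 := by exact_mod_cast (ht.1 0).ne'
  rw [mul_add, ← mul_assoc, mul_one_div_cancel hz0, one_mul, sub_add, Finset.mul_sum,
    ← Finset.sum_sub_distrib, sub_eq_add_neg, ← Finset.sum_neg_distrib]
  congr 1
  refine Finset.sum_congr rfl fun k _ => ?_
  have h1 : z - ((t k / t 0 : ℝ) : ℂ) ≠ 0 := sub_ofReal_ne_zero hz _
  have h2 : (t 0 : ℂ) * z - t k ≠ 0 := by
    have : (t 0 : ℂ) * z - t k = t 0 * (z - ((t k / t 0 : ℝ) : ℂ)) := by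
      push_cast
      field_simp
    rw [this]
    exact mul_ne_zero h0 h1
  push_cast at h1 ⊢
  have h3 : z - (t k : ℂ) / t 0 = (t 0 * z - t k) / t 0 := by field_simp
  rw [h3, one_div_div, eq_div_iff h2]
  linear_combination z * a k * div_mul_cancel₀ (t 0 : ℂ) h2

/-- The residue at the origin of the matrix of the linear system satisfied by `Ψ`. -/
def res0 (N α β γ : ℂ) (r R R' : Fin m → ℂ) : Matrix (Fin 2) (Fin 2) ℂ :=
  !![N + α / 2 + ∑ k, r k, γ * (1 - ∑ k, R k);
    -(β / γ * (1 - ∑ k, R' k)), -(N + α / 2 + ∑ k, r k)]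

/-- The residue at a jump of the matrix of the linear system satisfied by `Ψ`. -/
def resk (β γ r R R' : ℂ) : Matrix (Fin 2) (Fin 2) ℂ :=
  !![-r, γ * R; -(β / γ * R'), r]

/-- A solution of the first-order system of the ladder relations, rescaled, is a column solution of
the linear system with residues `res0` and `resk`. -/
lemma hasDerivAt_column (ht : t ∈ chamber m) {z : ℂ} (hz : z.im ≠ 0) {N α β γ κ κ' : ℂ}
    {r R R' : Fin m → ℂ} (hγ : γ ≠ 0) (hκ : κ' * γ = β * κ) {f g E : ℂ → ℂ} {f' g' ε : ℂ}
    (hf : HasDerivAt f f' (t 0 * z)) (hg : HasDerivAt g g' (t 0 * z))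
    (hE : HasDerivAt E (ε * E z) z)
    (hf' : t 0 * z * f' + z * ε * f (t 0 * z) = (N + α / 2 - t 0 * z / 2) * f (t 0 * z) +
      β * g (t 0 * z) + ∑ k, t k * (β * R k * g (t 0 * z) - r k * f (t 0 * z)) / (t 0 * z - t k))
    (hg' : t 0 * z * g' + z * ε * g (t 0 * z) = (t 0 * z / 2 - α / 2 - N) * g (t 0 * z) -
      f (t 0 * z) + ∑ k, t k * (r k * g (t 0 * z) - R' k * f (t 0 * z)) / (t 0 * z - t k)) :
    HasDerivAt (fun ζ => κ * f (t 0 * ζ) * E ζ)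
      (ratMatrix t (res0 N α β γ r R R') (fun k => resk β γ (r k) (R k) (R' k)) z 0 0 *
        (κ * f (t 0 * z) * E z) +
       ratMatrix t (res0 N α β γ r R R') (fun k => resk β γ (r k) (R k) (R' k)) z 0 1 *
        (κ' * g (t 0 * z) * E z)) z ∧
    HasDerivAt (fun ζ => κ' * g (t 0 * ζ) * E ζ)
      (ratMatrix t (res0 N α β γ r R R') (fun k => resk β γ (r k) (R k) (R' k)) z 1 0 *
        (κ * f (t 0 * z) * E z) +
       ratMatrix t (res0 N α β γ r R R') (fun k => resk β γ (r k) (R k) (R' k)) z 1 1 *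
        (κ' * g (t 0 * z) * E z)) z := by
  have hz0 : z ≠ 0 := by
    rintro rfl
    exact hz Complex.zero_im
  have hlin : HasDerivAt (fun ζ : ℂ => (t 0 : ℂ) * ζ) (t 0) z := by
    simpa using (hasDerivAt_id z).const_mul (t 0 : ℂ)
  have e00 : z * ratMatrix t (res0 N α β γ r R R') (fun k => resk β γ (r k) (R k) (R' k)) z 0 0 =
      N + α / 2 - t 0 * z / 2 - ∑ k, t k * r k / (t 0 * z - t k) := by
    have h1 := mul_partial_fractions ht hz (N + α / 2) (fun k => -r k)
    simp only [ratMatrix, res0, resk, sigma3, Matrix.add_apply, Matrix.smul_apply, Matrix.sum_apply,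
      smul_eq_mul, Matrix.of_apply, Matrix.cons_val', Matrix.cons_val_zero,  Matrix.cons_val_fin_one] at h1 ⊢
    simp only [mul_neg, neg_div, Finset.sum_neg_distrib, sub_neg_eq_add] at h1 ⊢
    linear_combination h1
  have e01 : z * ratMatrix t (res0 N α β γ r R R') (fun k => resk β γ (r k) (R k) (R' k)) z 0 1 =
      γ * (1 + ∑ k, t k * R k / (t 0 * z - t k)) := by
    have h1 := mul_partial_fractions ht hz 1 R
    have h2 : ∑ k, 1 / (z - ((t k / t 0 : ℝ) : ℂ)) * (γ * R k) =
        γ * ∑ k, 1 / (z - ((t k / t 0 : ℝ) : ℂ)) * R k := by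
      rw [Finset.mul_sum]
      exact Finset.sum_congr rfl fun k _ => by ring
    simp only [ratMatrix, res0, resk, sigma3, Matrix.add_apply, Matrix.smul_apply, Matrix.sum_apply,
      smul_eq_mul, Matrix.of_apply, Matrix.cons_val', Matrix.cons_val_zero, Matrix.cons_val_one,
      Matrix.cons_val_fin_one]
    rw [h2]
    linear_combination γ * h1
  have e10 : z * ratMatrix t (res0 N α β γ r R R') (fun k => resk β γ (r k) (R k) (R' k)) z 1 0 =
      -(β / γ) * (1 + ∑ k, t k * R' k / (t 0 * z - t k)) := by
    have h1 := mul_partial_fractions ht hz 1 R'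
    have h2 : ∑ k, 1 / (z - ((t k / t 0 : ℝ) : ℂ)) * -(β / γ * R' k) =
        -(β / γ) * ∑ k, 1 / (z - ((t k / t 0 : ℝ) : ℂ)) * R' k := by
      rw [Finset.mul_sum]
      exact Finset.sum_congr rfl fun k _ => by ring
    simp only [ratMatrix, res0, resk, sigma3, Matrix.add_apply, Matrix.smul_apply, Matrix.sum_apply,
      smul_eq_mul, Matrix.of_apply, Matrix.cons_val', Matrix.cons_val_zero, Matrix.cons_val_one,
      Matrix.cons_val_fin_one]
    rw [h2]
    linear_combination -(β / γ) * h1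
  have e11 : z * ratMatrix t (res0 N α β γ r R R') (fun k => resk β γ (r k) (R k) (R' k)) z 1 1 =
      -(N + α / 2) + t 0 * z / 2 + ∑ k, t k * r k / (t 0 * z - t k) := by
    have h1 := mul_partial_fractions ht hz (-(N + α / 2)) r
    simp only [ratMatrix, res0, resk, sigma3, Matrix.add_apply, Matrix.smul_apply, Matrix.sum_apply,
      smul_eq_mul, Matrix.of_apply, Matrix.cons_val', Matrix.cons_val_one,
      Matrix.cons_val_fin_one]
    linear_combination h1
  have s1 : ∑ k, t k * (β * R k * g (t 0 * z) - r k * f (t 0 * z)) / (t 0 * z - t k) =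
      β * g (t 0 * z) * ∑ k, t k * R k / (t 0 * z - t k) -
        f (t 0 * z) * ∑ k, t k * r k / (t 0 * z - t k) := by
    rw [Finset.mul_sum, Finset.mul_sum, ← Finset.sum_sub_distrib]
    exact Finset.sum_congr rfl fun k _ => by ring
  have s2 : ∑ k, t k * (r k * g (t 0 * z) - R' k * f (t 0 * z)) / (t 0 * z - t k) =
      g (t 0 * z) * ∑ k, t k * r k / (t 0 * z - t k) -
        f (t 0 * z) * ∑ k, t k * R' k / (t 0 * z - t k) := by
    rw [Finset.mul_sum, Finset.mul_sum, ← Finset.sum_sub_distrib]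
    exact Finset.sum_congr rfl fun k _ => by ring
  rw [s1] at hf'
  rw [s2] at hg'
  -- The row scales satisfy `κ' γ = β κ`, which fits the upper right entries; the form needed for
  -- the lower left ones is this.
  have hκ' : β / γ * κ = κ' := by
    rw [div_mul_eq_mul_div, ← hκ, mul_div_cancel_right₀ _ hγ]
  constructor
  · refine ((((hf.comp z hlin).const_mul κ).mul hE)).congr_deriv (mul_left_cancel₀ hz0 ?_)
    simp only [Function.comp_apply]
    linear_combination κ * E z * hf' - κ * f (t 0 * z) * E z * e00 -
      κ' * g (t 0 * z) * E z * e01 -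
      g (t 0 * z) * E z * (1 + ∑ k, t k * R k / (t 0 * z - t k)) * hκ
  · refine ((((hg.comp z hlin).const_mul κ').mul hE)).congr_deriv (mul_left_cancel₀ hz0 ?_)
    simp only [Function.comp_apply]
    linear_combination κ' * E z * hg' - κ * f (t 0 * z) * E z * e10 -
      κ' * g (t 0 * z) * E z * e11 +
      f (t 0 * z) * E z * (1 + ∑ k, t k * R' k / (t 0 * z - t k)) * hκ'

end Rational

end JumpLaguerre

namespace JumpLaguerre
open Polynomial Set Filter Topology

/-! ### The linear system of `Ψ` -/

section LaxPair

variable {m : ℕ} [NeZero m] {α : ℝ} {ω : Fin (m + 1) → ℝ} {t : Fin m → ℝ}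

/-- The scale `- h_n t₁ ^ (-(2 n + α)) / (2 π i)` of the upper right entry of the Lax matrix. -/
def laxScale (n : ℕ) (α : ℝ) (ω : Fin (m + 1) → ℝ) (t : Fin m → ℝ) : ℂ :=
  -(h n α ω t : ℂ) / ((t 0 ^ (2 * n + α : ℝ) : ℝ) : ℂ) / (2 * Real.pi * Complex.I)

/-- The matrix of the linear system of `Ψ` in terms of the ladder quantities. -/
def ladderMatrix (n : ℕ) (α : ℝ) (ω : Fin (m + 1) → ℝ) (t : Fin m → ℝ) (z : ℂ) :
    Matrix (Fin 2) (Fin 2) ℂ :=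
  ratMatrix t
    (res0 (n + 1) α (recBeta (n + 1) α ω t) (laxScale (n + 1) α ω t)
      (fun k => (r (n + 1) α ω t k : ℂ)) (fun k => (R (n + 1) α ω t k : ℂ))
      (fun k => (R n α ω t k : ℂ)))
    (fun k => resk (recBeta (n + 1) α ω t) (laxScale (n + 1) α ω t) (r (n + 1) α ω t k)
      (R (n + 1) α ω t k) (R n α ω t k)) z

lemma hasDerivAt_cpow_mul_exp {c z : ℂ} (s τ : ℂ) (hc : c * z ∈ Complex.slitPlane) (hz : z ≠ 0) :
    HasDerivAt (fun ζ => (c * ζ) ^ s * Complex.exp (τ * ζ))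
      ((s / z + τ) * ((c * z) ^ s * Complex.exp (τ * z))) z := by
  have hlin : HasDerivAt (fun ζ : ℂ => c * ζ) c z := by
    simpa using (hasDerivAt_id z).const_mul c
  have hlin' : HasDerivAt (fun ζ : ℂ => τ * ζ) τ z := by
    simpa using (hasDerivAt_id z).const_mul τ
  have hcz : c * z ≠ 0 := Complex.slitPlane_ne_zero hc
  have hc0 : c ≠ 0 := left_ne_zero_of_mul hcz
  refine ((hlin.cpow_const hc).mul hlin'.cexp).congr_deriv ?_
  rw [Complex.cpow_sub _ _ hcz, Complex.cpow_one]
  field_simp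

variable (hα : -1 < α) (hω : ∀ l : Fin (m + 1), 0 ≤ ∑ k ∈ Finset.Iic l, ω k) (hω0 : ω ≠ 0)
  (ht : t ∈ chamber m)

include hα hω hω0 ht in
lemma laxScale_ne_zero (n : ℕ) : laxScale n α ω t ≠ 0 := by
  have h1 : (h n α ω t : ℂ) ≠ 0 := by exact_mod_cast (h_pos hα hω hω0 ht n).ne'
  have h2 : ((t 0 ^ (2 * n + α : ℝ) : ℝ) : ℂ) ≠ 0 := by
    exact_mod_cast (Real.rpow_pos_of_pos (ht.1 0) _).ne'
  exact div_ne_zero (div_ne_zero (neg_ne_zero.2 h1) h2) Complex.two_pi_I_ne_zero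

include ht in
lemma laxScale_eq (n : ℕ) : laxScale n α ω t =
    -(h n α ω t : ℂ) * ((t 0 : ℂ) ^ (-((n : ℂ) + α / 2))) ^ 2 / (2 * Real.pi * Complex.I) := by
  have h0 : (t 0 : ℂ) ≠ 0 := by exact_mod_cast (ht.1 0).ne'
  have h1 : ((t 0 : ℂ) ^ (-((n : ℂ) + α / 2))) ^ 2 = (((t 0 ^ (2 * n + α : ℝ) : ℝ) : ℂ))⁻¹ := by
    rw [Complex.ofReal_cpow (ht.1 0).le, ← Complex.cpow_neg, ← Complex.cpow_nat_mul]
    congr 1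
    push_cast
    ring
  rw [laxScale, h1, div_eq_mul_inv (-(h n α ω t : ℂ))]

lemma Psi_apply (n : ℕ) (z : ℂ) :
    Psi n α ω t z = !![
      (t 0 : ℂ) ^ (-((n : ℂ) + α / 2)) * Y n α ω t (t 0 * z) 0 0 *
        ((t 0 * z) ^ ((α : ℂ) / 2) * Complex.exp (-((t 0 : ℂ) / 2) * z)),
      (t 0 : ℂ) ^ (-((n : ℂ) + α / 2)) * Y n α ω t (t 0 * z) 0 1 *
        ((t 0 * z) ^ (-((α : ℂ) / 2)) * Complex.exp ((t 0 : ℂ) / 2 * z));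
      ((t 0 : ℂ) ^ (-((n : ℂ) + α / 2)))⁻¹ * Y n α ω t (t 0 * z) 1 0 *
        ((t 0 * z) ^ ((α : ℂ) / 2) * Complex.exp (-((t 0 : ℂ) / 2) * z)),
      ((t 0 : ℂ) ^ (-((n : ℂ) + α / 2)))⁻¹ * Y n α ω t (t 0 * z) 1 1 *
        ((t 0 * z) ^ (-((α : ℂ) / 2)) * Complex.exp ((t 0 : ℂ) / 2 * z))] := by
  rw [Psi, powSigma3, powSigma3, expSigma3, Matrix.eta_fin_two (Y n α ω t (t 0 * z)),
    Matrix.mul_fin_two, Matrix.mul_fin_two, Matrix.mul_fin_two, Complex.cpow_neg _ (-_)]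
  simp only [mul_zero, zero_mul, add_zero, zero_add, neg_mul, neg_neg, mul_assoc, Matrix.of_apply,
    Matrix.cons_val', Matrix.cons_val_zero, Matrix.cons_val_one, Matrix.cons_val_fin_one]

include ht in
lemma im_mul_ne_zero {z : ℂ} (hz : z.im ≠ 0) : ((t 0 : ℂ) * z).im ≠ 0 := by
  rw [Complex.im_ofReal_mul]
  exact mul_ne_zero (ht.1 0).ne' hz

include hα hω hω0 ht in
/-- `Ψ` solves the linear system given by the ladder relations. -/
lemma hasDerivAt_Psi (n : ℕ) {z : ℂ} (hz : z.im ≠ 0) (i j : Fin 2) :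
    HasDerivAt (fun ζ : ℂ => Psi (n + 1) α ω t ζ i j)
      ((ladderMatrix n α ω t z * Psi (n + 1) α ω t z) i j) z := by
  have hz0 : z ≠ 0 := by
    rintro rfl
    exact hz Complex.zero_im
  have hx : ((t 0 : ℂ) * z).im ≠ 0 := im_mul_ne_zero ht hz
  have hslit : (t 0 : ℂ) * z ∈ Complex.slitPlane := Or.inr hx
  have h0 : (t 0 : ℂ) ≠ 0 := by exact_mod_cast (ht.1 0).ne'
  have hn : (h n α ω t : ℂ) ≠ 0 := by exact_mod_cast (h_pos hα hω hω0 ht n).ne'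
  have hγ := laxScale_ne_zero hα hω hω0 ht (n + 1)
  set κ : ℂ := (t 0 : ℂ) ^ (-(((n + 1 : ℕ) : ℂ) + α / 2)) with hκdef
  have hκ0 : κ ≠ 0 := by
    rw [hκdef, Complex.cpow_def_of_ne_zero h0]
    exact Complex.exp_ne_zero _
  set κ' : ℂ := κ⁻¹ * (-(2 * Real.pi * Complex.I) / (h n α ω t : ℂ)) with hκ'def
  have hpi := Complex.two_pi_I_ne_zero
  have hκ : κ' * laxScale (n + 1) α ω t = recBeta (n + 1) α ω t * κ := by
    rw [laxScale_eq ht, ← hκdef, hκ'def, recBeta, Nat.add_sub_cancel]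
    push_cast
    field_simp
  -- The polynomial and Cauchy systems differ by the diagonal shift `α - t₁ z`. The scalar factors
  -- contribute `±(α - t₁ z) / 2`, so both columns obey one system. The constant `1 / (2πi)` goes
  -- into the second factor, leaving `κ` and `κ'` common to both columns.
  have hE1 := hasDerivAt_cpow_mul_exp ((α : ℂ) / 2) (-((t 0 : ℂ) / 2)) hslit hz0
  have hE2 := (hasDerivAt_cpow_mul_exp (-((α : ℂ) / 2)) ((t 0 : ℂ) / 2) hslit hz0).const_mul
    (1 / (2 * Real.pi * Complex.I))
  rw [mul_left_comm (1 / (2 * Real.pi * Complex.I) : ℂ)] at hE2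
  obtain ⟨f1', hf1, hf1'⟩ := exists_hasDerivAt_aeval_P_succ hα hω hω0 ht hx n
  obtain ⟨g1', hg1, hg1'⟩ := exists_hasDerivAt_aeval_P hα hω hω0 ht hx n
  obtain ⟨f2', hf2, hf2'⟩ := exists_hasDerivAt_cauchy_P_succ hα hω hω0 ht hx n
  obtain ⟨g2', hg2, hg2'⟩ := exists_hasDerivAt_cauchy_P hα hω hω0 ht hx n
  have c1 := hasDerivAt_column ht hz (N := n + 1) (α := α)
    (r := fun k => (r (n + 1) α ω t k : ℂ)) (R := fun k => (R (n + 1) α ω t k : ℂ))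
    (R' := fun k => (R n α ω t k : ℂ)) hγ hκ hf1 hg1 hE1
    (by rw [hf1']; field_simp; ring) (by rw [hg1']; field_simp; ring)
  have c2 := hasDerivAt_column ht hz (N := n + 1) (α := α)
    (r := fun k => (r (n + 1) α ω t k : ℂ)) (R := fun k => (R (n + 1) α ω t k : ℂ))
    (R' := fun k => (R n α ω t k : ℂ)) hγ hκ hf2 hg2 hE2
    (by rw [hf2']; field_simp; ring) (by rw [hg2']; field_simp; ring)
  have p00 : ∀ ζ, Psi (n + 1) α ω t ζ 0 0 = κ * aeval ((t 0 : ℂ) * ζ) (P α ω t (n + 1)) *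
      ((t 0 * ζ) ^ ((α : ℂ) / 2) * Complex.exp (-((t 0 : ℂ) / 2) * ζ)) := fun ζ => by
    rw [Psi_apply, ← hκdef]
    simp [Y]
  have p10 : ∀ ζ, Psi (n + 1) α ω t ζ 1 0 = κ' * aeval ((t 0 : ℂ) * ζ) (P α ω t n) *
      ((t 0 * ζ) ^ ((α : ℂ) / 2) * Complex.exp (-((t 0 : ℂ) / 2) * ζ)) := fun ζ => by
    rw [Psi_apply, ← hκdef, hκ'def]
    simp [Y, mul_assoc]
  have p01 : ∀ ζ, Psi (n + 1) α ω t ζ 0 1 = κ * cauchy α ω t (P α ω t (n + 1)) (t 0 * ζ) *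
      (1 / (2 * Real.pi * Complex.I) *
        ((t 0 * ζ) ^ (-((α : ℂ) / 2)) * Complex.exp ((t 0 : ℂ) / 2 * ζ))) := fun ζ => by
    rw [Psi_apply, ← hκdef]
    simp only [Y, Matrix.of_apply, Matrix.cons_val', Matrix.cons_val_zero, Matrix.cons_val_one,
      Matrix.cons_val_fin_one]
    ring
  have p11 : ∀ ζ, Psi (n + 1) α ω t ζ 1 1 = κ' * cauchy α ω t (P α ω t n) (t 0 * ζ) *
      (1 / (2 * Real.pi * Complex.I) *
        ((t 0 * ζ) ^ (-((α : ℂ) / 2)) * Complex.exp ((t 0 : ℂ) / 2 * ζ))) := fun ζ => by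
    rw [Psi_apply, ← hκdef, hκ'def]
    simp only [Y, Matrix.of_apply, Matrix.cons_val', Matrix.cons_val_one,
      Matrix.cons_val_fin_one, Nat.add_sub_cancel]
    field_simp
  fin_cases i <;> fin_cases j
  · simp only [Fin.zero_eta, Matrix.mul_apply, Fin.sum_univ_two, p00, p10]
    exact c1.1
  · simp only [Fin.zero_eta, Fin.mk_one, Matrix.mul_apply, Fin.sum_univ_two, p01, p11]
    exact c2.1
  · simp only [Fin.zero_eta, Fin.mk_one, Matrix.mul_apply, Fin.sum_univ_two, p00, p10]
    exact c1.2
  · simp only [Fin.mk_one, Matrix.mul_apply, Fin.sum_univ_two, p01, p11]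
    exact c2.2

include hα hω hω0 ht in
-- The outer factors have determinant `1` and the middle one is the Casorati determinant.
-- Invertibility of `Ψ` is what makes its coefficient matrix unique.
lemma det_Psi (n : ℕ) {z : ℂ} (hz : z.im ≠ 0) : (Psi (n + 1) α ω t z).det = 1 := by
  have hz0 : z ≠ 0 := by
    rintro rfl
    exact hz Complex.zero_im
  have h0 : (t 0 : ℂ) ≠ 0 := by exact_mod_cast (ht.1 0).ne'
  have hn : (h n α ω t : ℂ) ≠ 0 := by exact_mod_cast (h_pos hα hω hω0 ht n).ne'
  have hpow : ∀ c s : ℂ, c ≠ 0 → (powSigma3 c s).det = 1 := by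
    intro c s hc
    rw [powSigma3, Matrix.det_fin_two_of, mul_zero, sub_zero, ← Complex.cpow_add _ _ hc,
      add_neg_cancel, Complex.cpow_zero]
  have hexp : ∀ s : ℂ, (expSigma3 s).det = 1 := by
    intro s
    rw [expSigma3, Matrix.det_fin_two_of, mul_zero, sub_zero, ← Complex.exp_add, add_neg_cancel,
      Complex.exp_zero]
  have hY : (Y (n + 1) α ω t (t 0 * z)).det = 1 := by
    have h1 := casorati hα hω hω0 ht (im_mul_ne_zero ht hz) n
    have hpi := Complex.two_pi_I_ne_zero
    rw [Y, Matrix.det_fin_two_of, Nat.add_sub_cancel]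
    field_simp
    linear_combination h1
  rw [Psi, Matrix.det_mul, Matrix.det_mul, Matrix.det_mul, hpow _ _ h0, hY,
    hpow _ _ (mul_ne_zero h0 hz0), hexp]
  norm_num

include hα hω hω0 ht in
/-- Lax pair quantities are characterized by the residues of the linear system. -/
lemma isLaxParam_iff (n : ℕ) (u v : Fin m → ℂ) (y : ℂ) :
    IsLaxParam (n + 1) α ω t u v y ↔ y ≠ 0 ∧
      A0 (n + 1) α u v y = res0 (n + 1) α (recBeta (n + 1) α ω t) (laxScale (n + 1) α ω t)
        (fun k => (r (n + 1) α ω t k : ℂ)) (fun k => (R (n + 1) α ω t k : ℂ))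
        (fun k => (R n α ω t k : ℂ)) ∧
      ∀ k, Ak (u k) (v k) y = resk (recBeta (n + 1) α ω t) (laxScale (n + 1) α ω t)
        (r (n + 1) α ω t k) (R (n + 1) α ω t k) (R n α ω t k) := by
  refine and_congr_right fun _ => ⟨fun hL => ?_, fun ⟨h1, h2⟩ z hz i j => ?_⟩
  · refine ratMatrix_injective ht fun z hz => ?_
    have h1 : L (n + 1) α t u v y z * Psi (n + 1) α ω t z =
        ladderMatrix n α ω t z * Psi (n + 1) α ω t z := by
      ext i j
      exact (hL z hz i j).unique (hasDerivAt_Psi hα hω hω0 ht n hz i j)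
    have hdet : IsUnit (Psi (n + 1) α ω t z).det := by
      rw [det_Psi hα hω hω0 ht n hz]
      exact isUnit_one
    have h2 := congrArg (· * (Psi (n + 1) α ω t z)⁻¹) h1
    simp only [Matrix.mul_nonsing_inv_cancel_right _ _ hdet] at h2
    exact h2
  · have h3 := hasDerivAt_Psi hα hω hω0 ht n hz i j
    rw [ladderMatrix, ← h1, ← funext h2, ← L_eq_ratMatrix] at h3
    exact h3

include hα hω hω0 ht in
/-- The scalar equations satisfied by Lax pair quantities. -/
lemma IsLaxParam.equations {n : ℕ} {u v : Fin m → ℂ} {y : ℂ}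
    (hL : IsLaxParam (n + 1) α ω t u v y) :
    (∀ k, u k * v k = r (n + 1) α ω t k) ∧
    (∀ k, u k * y = laxScale (n + 1) α ω t * R (n + 1) α ω t k) ∧
    (∀ k, u k * v k ^ 2 * laxScale (n + 1) α ω t =
      recBeta (n + 1) α ω t * R n α ω t k * y) ∧
    (∑ k, (r (n + 1) α ω t k : ℂ) + (n + 1)) * y =
      (∑ k, (R (n + 1) α ω t k : ℂ) - 1) * laxScale (n + 1) α ω t ∧
    (∑ k, (r (n + 1) α ω t k : ℂ) + (n + 1) + α) * laxScale (n + 1) α ω t =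
      recBeta (n + 1) α ω t * (∑ k, (R n α ω t k : ℂ) - 1) * y := by
  obtain ⟨hy, h0, hk⟩ := (isLaxParam_iff hα hω hω0 ht n u v y).1 hL
  have hγ := laxScale_ne_zero hα hω hω0 ht (n + 1)
  have e1 : ∀ k, u k * v k = r (n + 1) α ω t k := fun k => by
    simpa [Ak, resk] using congrFun (congrFun (hk k) 1) 1
  have e2 : ∀ k, u k * y = laxScale (n + 1) α ω t * R (n + 1) α ω t k := fun k => by
    simpa [Ak, resk] using congrFun (congrFun (hk k) 0) 1
  refine ⟨e1, e2, fun k => ?_, ?_, ?_⟩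
  · have e3 := congrFun (congrFun (hk k) 1) 0
    simp only [Ak, resk, Matrix.of_apply, Matrix.cons_val', Matrix.cons_val_zero,
      Matrix.cons_val_one, Matrix.cons_val_fin_one] at e3
    field_simp at e3
    linear_combination -e3
  · have e3 := congrFun (congrFun h0 0) 1
    simp only [A0, res0, aCoef, e1, Matrix.of_apply, Matrix.cons_val', Matrix.cons_val_zero,
      Matrix.cons_val_one, Matrix.cons_val_fin_one] at e3
    push_cast at e3
    linear_combination -e3
  · have e3 := congrFun (congrFun h0 1) 0
    simp only [A0, res0, aCoef, e1, Matrix.of_apply, Matrix.cons_val', Matrix.cons_val_zero,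
      Matrix.cons_val_one, Matrix.cons_val_fin_one] at e3
    push_cast at e3
    rw [div_eq_iff hy, div_mul_eq_mul_div, ← neg_div, div_mul_eq_mul_div, eq_div_iff hγ] at e3
    linear_combination e3

include hα hω hω0 ht in
-- The lower left entries need not be assumed: at the origin they follow from `compatibility_zero`
-- after dividing by `∑ R - 1`, and at the jumps from `r_sq_eq` after dividing by `R k`.
lemma isLaxParam_of_equations {n : ℕ} {u v : Fin m → ℂ} {y : ℂ} (hy : y ≠ 0)
    (hR : ∀ k, R (n + 1) α ω t k ≠ 0) (hR1 : ∑ k, R (n + 1) α ω t k - 1 ≠ 0)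
    (e1 : ∀ k, u k * v k = r (n + 1) α ω t k)
    (e2 : ∀ k, u k * y = laxScale (n + 1) α ω t * R (n + 1) α ω t k)
    (e3 : (∑ k, (r (n + 1) α ω t k : ℂ) + (n + 1)) * y =
      (∑ k, (R (n + 1) α ω t k : ℂ) - 1) * laxScale (n + 1) α ω t) :
    IsLaxParam (n + 1) α ω t u v y := by
  have hγ := laxScale_ne_zero hα hω hω0 ht (n + 1)
  refine (isLaxParam_iff hα hω hω0 ht n u v y).2 ⟨hy, ?_, fun k => ?_⟩
  · have hR1' : ∑ k, (R (n + 1) α ω t k : ℂ) - 1 ≠ 0 := by exact_mod_cast hR1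
    have hc : (recBeta (n + 1) α ω t : ℂ) * (1 - ∑ k, (R (n + 1) α ω t k : ℂ)) *
        (1 - ∑ k, (R n α ω t k : ℂ)) = (n + 1 + ∑ k, (r (n + 1) α ω t k : ℂ)) *
        (n + 1 + α + ∑ k, (r (n + 1) α ω t k : ℂ)) := by
      exact_mod_cast compatibility_zero hα hω hω0 ht n
    have e4 : (∑ k, (r (n + 1) α ω t k : ℂ) + (n + 1) + α) / y =
        -(recBeta (n + 1) α ω t / laxScale (n + 1) α ω t * (1 - ∑ k, (R n α ω t k : ℂ))) := by
      have e5 : (∑ k, (r (n + 1) α ω t k : ℂ) + (n + 1) + α) * laxScale (n + 1) α ω t =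
          -(recBeta (n + 1) α ω t * (1 - ∑ k, (R n α ω t k : ℂ))) * y := by
        refine mul_left_cancel₀ hR1' ?_
        linear_combination -(∑ k, (r (n + 1) α ω t k : ℂ) + (n + 1) + α) * e3 - y * hc
      rw [div_eq_iff hy, div_mul_eq_mul_div, ← neg_div, div_mul_eq_mul_div, eq_div_iff hγ, e5]
    rw [A0, res0, aCoef, Finset.sum_congr rfl fun k _ => e1 k]
    push_cast
    congr 1
    ext i j
    fin_cases i <;> fin_cases j <;>
      simp only [Fin.zero_eta, Fin.mk_one, Matrix.cons_val_zero, Matrix.cons_val_one,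
        Matrix.cons_val_fin_one]
    · ring
    · linear_combination -e3
    · rw [← e4]
      ring
    · ring
  · have hRk : (R (n + 1) α ω t k : ℂ) ≠ 0 := by exact_mod_cast hR k
    have hr : (r (n + 1) α ω t k : ℂ) ^ 2 =
        recBeta (n + 1) α ω t * R n α ω t k * R (n + 1) α ω t k := by
      exact_mod_cast r_sq_eq hα hω hω0 ht n k
    have e5 : u k * v k ^ 2 / y =
        recBeta (n + 1) α ω t / laxScale (n + 1) α ω t * R n α ω t k := by
      have e6 : u k * v k ^ 2 * laxScale (n + 1) α ω t =
          recBeta (n + 1) α ω t * R n α ω t k * y := by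
        refine mul_left_cancel₀ hRk ?_
        linear_combination -u k * v k ^ 2 * e2 k + y * (u k * v k + r (n + 1) α ω t k) * e1 k +
          y * hr
      rw [div_eq_iff hy, div_mul_eq_mul_div, div_mul_eq_mul_div, eq_div_iff hγ, e6]
    rw [Ak, resk, e1, e2, neg_div, e5]

/-! ### The parametrization of the ladder quantities -/

include hα hω hω0 ht in
-- Both sides are the upper right entry of the sum of all residues, in which the sums over `R`
-- cancel.
lemma IsLaxParam.b1_mul {n : ℕ} {u v : Fin m → ℂ} {y : ℂ}
    (hL : IsLaxParam (n + 1) α ω t u v y) :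
    b1 (n + 1) u v * y = laxScale (n + 1) α ω t := by
  obtain ⟨e1, e2, -, e4, -⟩ := hL.equations hα hω hω0 ht
  have h1 : (∑ k, u k) * y = laxScale (n + 1) α ω t * ∑ k, (R (n + 1) α ω t k : ℂ) := by
    rw [Finset.sum_mul, Finset.mul_sum]
    exact Finset.sum_congr rfl fun k _ => e2 k
  have h2 : ∑ k, u k * (v k - 1) = ∑ k, (r (n + 1) α ω t k : ℂ) - ∑ k, u k := by
    rw [← Finset.sum_sub_distrib]
    exact Finset.sum_congr rfl fun k _ => by rw [mul_sub, e1, mul_one]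
  rw [b1, h2]
  push_cast
  linear_combination h1 - e4

include hα hω hω0 ht in
-- The lower left entry of the sum of all residues is `b₂ / y` on one side and `-β / laxScale` on
-- the other; `b1_mul` then eliminates `y`.
lemma IsLaxParam.b1_mul_b2 {n : ℕ} {u v : Fin m → ℂ} {y : ℂ}
    (hL : IsLaxParam (n + 1) α ω t u v y) :
    (recBeta (n + 1) α ω t : ℂ) = -(b1 (n + 1) u v * b2 (n + 1) α u v) := by
  obtain ⟨e1, e2, e3, e4, e5⟩ := hL.equations hα hω hω0 ht
  have hb := hL.b1_mul hα hω hω0 ht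
  have hy := hL.1
  have h1 : (∑ k, u k * v k ^ 2) * laxScale (n + 1) α ω t =
      recBeta (n + 1) α ω t * (∑ k, (R n α ω t k : ℂ)) * y := by
    rw [Finset.sum_mul, Finset.mul_sum, Finset.sum_mul]
    exact Finset.sum_congr rfl fun k _ => e3 k
  have h2 : ∑ k, u k * v k * (v k - 1) =
      ∑ k, u k * v k ^ 2 - ∑ k, (r (n + 1) α ω t k : ℂ) := by
    rw [← Finset.sum_sub_distrib]
    exact Finset.sum_congr rfl fun k _ => by rw [← e1]; ring
  refine mul_right_cancel₀ hy ?_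
  rw [b2, h2, neg_mul, mul_right_comm (b1 (n + 1) u v), hb]
  push_cast
  linear_combination e5 - h1

end LaxPair

end JumpLaguerre

namespace JumpLaguerre
open Polynomial Set Filter Topology

/-! ### Inverse formulas, existence and uniqueness of the Lax pair quantities -/

section Main

variable {m : ℕ} [NeZero m] {α : ℝ} {ω : Fin (m + 1) → ℝ} {t : Fin m → ℝ}

/-- The direct formulas for `R` and `r` are equivalent to the inverse formulas for `u` and `v`. -/
lemma direct_iff_inverse {n : ℕ} {R r : Fin m → ℝ} (hR : ∀ k, R k ≠ 0)
    (hR1 : ∑ j, R j - 1 ≠ 0) (hr : ∑ j, r j + n ≠ 0) (u v : Fin m → ℂ) :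
    (∀ k, (R k : ℂ) = u k / b1 n u v ∧ (r k : ℂ) = u k * v k) ↔
      ∀ k, u k = (R k * ((∑ j, r j + n) / (∑ j, R j - 1)) : ℝ) ∧
        v k = (r k / R k * ((∑ j, R j - 1) / (∑ j, r j + n)) : ℝ) := by
  have hR' : ∀ k, (R k : ℂ) ≠ 0 := fun k => by exact_mod_cast hR k
  have hR1' : ∑ j, (R j : ℂ) - 1 ≠ 0 := by exact_mod_cast hR1
  have hr' : ∑ j, (r j : ℂ) + n ≠ 0 := by exact_mod_cast hr
  have hsum : (∀ k, (r k : ℂ) = u k * v k) →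
      b1 n u v = ∑ k, u k - (∑ k, (r k : ℂ) + n) := by
    intro h1
    simp only [b1, mul_sub, mul_one, Finset.sum_sub_distrib, ← h1]
    ring
  constructor
  · intro hk
    -- Division by zero gives zero, so `b1 = 0` would force `R 0 = 0`.
    have hb0 : b1 n u v ≠ 0 := by
      intro h0
      have h1 := (hk 0).1
      rw [h0, div_zero] at h1
      exact hR' 0 h1
    have hu : ∀ k, u k = R k * b1 n u v := fun k => by
      rw [(hk k).1, div_mul_cancel₀ _ hb0]
    have h1 := hsum fun k => (hk k).2
    rw [Finset.sum_congr rfl fun k _ => hu k, ← Finset.sum_mul] at h1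
    -- With `u = R * b1` inserted, the definition of `b1` becomes a linear equation for `b1` itself.
    have hb : b1 n u v = (∑ j, (r j : ℂ) + n) / (∑ j, (R j : ℂ) - 1) := by
      rw [eq_div_iff hR1']
      linear_combination -h1
    intro k
    have h2 : u k = (R k * ((∑ j, r j + n) / (∑ j, R j - 1)) : ℝ) := by
      rw [hu k, hb]
      push_cast
      ring
    refine ⟨h2, mul_left_cancel₀ (mul_ne_zero (hR' k) hb0) ?_⟩
    rw [← hu k, ← (hk k).2, hu k, hb]
    push_cast
    have := hR' k
    field_simp
  · intro hk
    have h1 : ∀ k, (r k : ℂ) = u k * v k := fun k => by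
      have := hR' k
      rw [(hk k).1, (hk k).2]
      push_cast
      field_simp
    have hb : b1 n u v = (∑ j, (r j : ℂ) + n) / (∑ j, (R j : ℂ) - 1) := by
      have h2 : ∑ k, u k = (∑ k, (R k : ℂ)) * ((∑ j, (r j : ℂ) + n) / (∑ j, (R j : ℂ) - 1)) := by
        rw [Finset.sum_mul]
        refine Finset.sum_congr rfl fun k _ => ?_
        rw [(hk k).1]
        push_cast
        ring
      rw [hsum h1, h2]
      field_simp
      ring
    refine fun k => ⟨?_, h1 k⟩
    rw [(hk k).1, hb]
    push_cast
    field_simp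

variable (hα : -1 < α) (hω : ∀ l : Fin (m + 1), 0 ≤ ∑ k ∈ Finset.Iic l, ω k) (hω0 : ω ≠ 0)

include hα hω hω0 in
-- The upper right entry at the origin determines `y`, those at the jumps determine `u`, and the
-- diagonal entries determine `v`. Regularity supplies the divisions by `∑ r + n` and `R k`, and
-- ensures `y ≠ 0`.
lemma existsUnique_isLaxParam {n : ℕ} (ht : t ∈ regular (n + 1) α ω) :
    ∃! p : (Fin m → ℂ) × (Fin m → ℂ) × ℂ, IsLaxParam (n + 1) α ω t p.1 p.2.1 p.2.2 := by
  obtain ⟨ht, hR, hR1, hr⟩ := ht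
  have hγ := laxScale_ne_zero hα hω hω0 ht (n + 1)
  have hR' : ∀ k, (R (n + 1) α ω t k : ℂ) ≠ 0 := fun k => by exact_mod_cast hR k
  have hR1' : ∑ k, (R (n + 1) α ω t k : ℂ) - 1 ≠ 0 := by exact_mod_cast hR1
  have hr' : ∑ k, (r (n + 1) α ω t k : ℂ) + (n + 1) ≠ 0 := by exact_mod_cast hr
  set y : ℂ := (∑ k, (R (n + 1) α ω t k : ℂ) - 1) * laxScale (n + 1) α ω t /
    (∑ k, (r (n + 1) α ω t k : ℂ) + (n + 1)) with hy
  have hy0 : y ≠ 0 := div_ne_zero (mul_ne_zero hR1' hγ) hr'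
  refine ⟨(fun k => laxScale (n + 1) α ω t * R (n + 1) α ω t k / y,
    fun k => r (n + 1) α ω t k * y / (laxScale (n + 1) α ω t * R (n + 1) α ω t k), y), ?_, ?_⟩
  · refine isLaxParam_of_equations hα hω hω0 ht hy0 hR hR1 (fun k => ?_) (fun k => ?_) ?_
    · have := hR' k
      dsimp only
      field_simp
    · exact div_mul_cancel₀ _ hy0
    · rw [hy, mul_div_cancel₀ _ hr']
  · rintro ⟨u, v, y'⟩ hL
    obtain ⟨e1, e2, -, e4, -⟩ := IsLaxParam.equations hα hω hω0 ht hL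
    dsimp only at e1 e2 e4
    obtain rfl : y' = y := by
      rw [hy, eq_div_iff hr', mul_comm, e4]
    have hu : ∀ k, u k = laxScale (n + 1) α ω t * R (n + 1) α ω t k / y := fun k => by
      rw [eq_div_iff hy0, e2]
    refine Prod.ext (_root_.funext hu) (Prod.ext (_root_.funext fun k => ?_) rfl)
    have h1 := mul_ne_zero hγ (hR' k)
    dsimp only
    rw [eq_div_iff h1, ← e2 k, ← e1 k]
    ring

/-! ### The derivative of the gauge parameter -/

/-- The scale `t₁` is itself one of the variables, so its power contributes to `δ` through `k = 0`
alone. -/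
lemma hasDerivAt_rpow_update (ht : t ∈ chamber m) (c : ℝ) (k : Fin m) :
    ∃ d, HasDerivAt (fun s => (Function.update t k s 0) ^ c) d (t k) ∧
      t k * d = (if k = 0 then c else 0) * t 0 ^ c := by
  by_cases hk : k = 0
  · subst hk
    refine ⟨c * t 0 ^ (c - 1), ?_, ?_⟩
    · simp only [Function.update_self]
      exact Real.hasDerivAt_rpow_const (Or.inl (ht.1 0).ne')
    · have h0 := (ht.1 0).ne'
      rw [if_pos rfl, Real.rpow_sub_one h0]
      field_simp
  · refine ⟨0, ?_, ?_⟩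
    · simp only [Function.update_of_ne (Ne.symm hk)]
      exact hasDerivAt_const _ _
    · rw [if_neg hk, mul_zero, zero_mul]

/-- The gauge parameter is `I * gauge` at regular points. -/
def gauge (n : ℕ) (α : ℝ) (ω : Fin (m + 1) → ℝ) (t : Fin m → ℝ) : ℝ :=
  h n α ω t * t 0 ^ (-(2 * (n + 1 : ℕ) + α) : ℝ) * (P α ω t (n + 1)).eval 0 /
    (2 * Real.pi * (P α ω t n).eval 0)

include hα hω hω0 in
-- Comparing the lowering relation at `0` with the upper right residue at the origin expresses `b₁`,
-- and hence `y`, through values of polynomials at `0`, whose derivatives in `t` are known.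
lemma IsLaxParam.b1_mul_eval_zero {n : ℕ} (ht : t ∈ regular (n + 1) α ω) {u v : Fin m → ℂ} {y : ℂ}
    (hL : IsLaxParam (n + 1) α ω t u v y) :
    b1 (n + 1) u v * (P α ω t (n + 1)).eval 0 = recBeta (n + 1) α ω t * (P α ω t n).eval 0 := by
  obtain ⟨ht, hR, hR1, hr⟩ := ht
  obtain ⟨-, -, -, e4, -⟩ := hL.equations hα hω hω0 ht
  have hb := hL.b1_mul hα hω hω0 ht
  have hR1' : ∑ k, (R (n + 1) α ω t k : ℂ) - 1 ≠ 0 := by exact_mod_cast hR1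
  have h1 : ((n : ℂ) + 1 + ∑ k, (r (n + 1) α ω t k : ℂ)) * ((P α ω t (n + 1)).eval 0 : ℝ) +
      recBeta (n + 1) α ω t * (1 - ∑ k, (R (n + 1) α ω t k : ℂ)) *
        ((P α ω t n).eval 0 : ℝ) = 0 := by
    exact_mod_cast eval_zero_lowering hα hω hω0 ht n
  refine mul_left_cancel₀ (mul_ne_zero hR1' hL.1) ?_
  linear_combination (∑ k, (R (n + 1) α ω t k : ℂ) - 1) * ((P α ω t (n + 1)).eval 0 : ℝ) * hb -
    ((P α ω t (n + 1)).eval 0 : ℝ) * e4 + y * h1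

include hα hω hω0 in
lemma IsLaxParam.b1_ne_zero {n : ℕ} (ht : t ∈ chamber m) {u v : Fin m → ℂ} {y : ℂ}
    (hL : IsLaxParam (n + 1) α ω t u v y) : b1 (n + 1) u v ≠ 0 := by
  have hb := hL.b1_mul hα hω hω0 ht
  intro h0
  rw [h0, zero_mul] at hb
  exact laxScale_ne_zero hα hω hω0 ht (n + 1) hb.symm

include hα hω hω0 in
-- As `b₁` and `β` are nonzero, the vanishing of one value would force the other to vanish, giving a
-- common zero.
lemma IsLaxParam.eval_zero_ne_zero {n : ℕ} (ht : t ∈ regular (n + 1) α ω) {u v : Fin m → ℂ} {y : ℂ}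
    (hL : IsLaxParam (n + 1) α ω t u v y) :
    (P α ω t n).eval 0 ≠ 0 ∧ (P α ω t (n + 1)).eval 0 ≠ 0 := by
  have hb := hL.b1_mul_eval_zero hα hω hω0 ht
  have hb0 := hL.b1_ne_zero hα hω hω0 ht.1
  have hβ : (recBeta (n + 1) α ω t : ℂ) ≠ 0 := by
    exact_mod_cast (recBeta_pos hα hω hω0 ht.1 n).ne'
  have hP := (isOPS hα hω hω0 ht.1).not_common_zero 0 n
  constructor <;> intro h1 <;> refine hP ⟨?_, ?_⟩ <;> try exact h1
  · rw [h1, Complex.ofReal_zero, mul_zero] at hb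
    exact_mod_cast (mul_eq_zero.1 hb).resolve_left hb0
  · rw [h1, Complex.ofReal_zero, mul_zero] at hb
    exact_mod_cast (mul_eq_zero.1 hb.symm).resolve_left hβ

include hα hω hω0 in
-- Here `y = laxScale / b₁`; the factor `h_{n+1}` cancels against the one in `β`, and `-1 / (2πi) =
-- i / (2π)`.
lemma IsLaxParam.eq_gauge {n : ℕ} (ht : t ∈ regular (n + 1) α ω) {u v : Fin m → ℂ} {y : ℂ}
    (hL : IsLaxParam (n + 1) α ω t u v y) : y = Complex.I * gauge n α ω t := by
  obtain ⟨h1, h2⟩ := hL.eval_zero_ne_zero hα hω hω0 ht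
  have hb := hL.b1_mul_eval_zero hα hω hω0 ht
  have hb0 := hL.b1_ne_zero hα hω hω0 ht.1
  have hby := hL.b1_mul hα hω hω0 ht.1
  have h1' : (((P α ω t n).eval 0 : ℝ) : ℂ) ≠ 0 := by exact_mod_cast h1
  have h3 : (h n α ω t : ℂ) ≠ 0 := by exact_mod_cast (h_pos hα hω hω0 ht.1 n).ne'
  have h4 : ((t 0 ^ (2 * (n + 1 : ℕ) + α : ℝ) : ℝ) : ℂ) ≠ 0 := by
    exact_mod_cast (Real.rpow_pos_of_pos (ht.1.1 0) _).ne'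
  have hpi : (Real.pi : ℂ) ≠ 0 := by exact_mod_cast Real.pi_ne_zero
  have hI := Complex.I_ne_zero
  have hI2 := Complex.I_sq
  refine mul_left_cancel₀ hb0 ?_
  rw [hby, gauge, laxScale, Real.rpow_neg (ht.1.1 0).le]
  rw [Complex.ofReal_div, Complex.ofReal_mul _ ((P α ω t (n + 1)).eval 0), ← mul_div_assoc,
    ← mul_div_assoc, mul_left_comm (b1 _ _ _), mul_left_comm (b1 _ _ _), hb, recBeta, Nat.add_sub_cancel]
  push_cast at h4 ⊢
  field_simp
  rw [hI2]
  ring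

include hα hω hω0 in
lemma hasDerivAt_gauge {n : ℕ} (ht : t ∈ chamber m) (hP : (P α ω t n).eval 0 ≠ 0)
    (hQ : (P α ω t (n + 1)).eval 0 ≠ 0) (k : Fin m) :
    ∃ l, HasDerivAt (fun s => gauge n α ω (Function.update t k s)) (l * gauge n α ω t) (t k) ∧
      t k * l = recBeta (n + 1) α ω t * (P α ω t n).eval 0 / (P α ω t (n + 1)).eval 0 *
        R (n + 1) α ω t k - 2 * r (n + 1) α ω t k +
        (P α ω t (n + 1)).eval 0 / (P α ω t n).eval 0 * R n α ω t k +
        if k = 0 then -(2 * (n + 1 : ℕ) + α) else 0 := by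
  obtain ⟨a, ha, ha'⟩ := hasDerivAt_rpow_update ht (-(2 * (n + 1 : ℕ) + α)) k
  obtain ⟨b, hb, hb'⟩ := hasDerivAt_P_succ_eval_zero hα hω hω0 ht n k
  obtain ⟨c, hc, hc'⟩ := hasDerivAt_P_eval_zero hα hω hω0 ht n k
  have hh := hasDerivAt_h hα hω hω0 ht n k
  have h0 : (t 0) ^ (-(2 * (n + 1 : ℕ) + α) : ℝ) ≠ 0 := (Real.rpow_pos_of_pos (ht.1 0) _).ne'
  have hk := (ht.1 k).ne'
  have hpi := Real.pi_ne_zero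
  refine ⟨-R n α ω t k + a / (t 0) ^ (-(2 * (n + 1 : ℕ) + α) : ℝ) +
    b / (P α ω t (n + 1)).eval 0 - c / (P α ω t n).eval 0, ?_, ?_⟩
  · refine (((hh.mul ha).mul hb).div (hc.const_mul (2 * Real.pi)) ?_).congr_deriv ?_
    · rw [Function.update_eq_self]
      exact mul_ne_zero (mul_ne_zero two_ne_zero hpi) hP
    · simp only [Pi.mul_apply, Function.update_eq_self, gauge]
      field_simp
  · have e1 : t k * (a / (t 0) ^ (-(2 * (n + 1 : ℕ) + α) : ℝ)) =
        if k = 0 then -(2 * (n + 1 : ℕ) + α) else 0 := by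
      rw [← mul_div_assoc, ha', mul_div_cancel_right₀ _ h0]
    -- The term `-t_k R_n` from `h_n` cancels its counterpart from the denominator `P_n(0)`.
    rw [mul_sub, mul_add, mul_add, e1, ← mul_div_assoc (t k) b, ← mul_div_assoc (t k) c, hb', hc']
    field_simp
    ring

include hα hω hω0 in
/-- The logarithmic derivative of the gauge parameter along the Euler field. -/
lemma hasDelta_log {n : ℕ} (u v : (Fin m → ℝ) → Fin m → ℂ) (y : (Fin m → ℝ) → ℂ)
    (hL : ∀ t ∈ regular (n + 1) α ω, IsLaxParam (n + 1) α ω t (u t) (v t) (y t))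
    (ht : t ∈ regular (n + 1) α ω) :
    HasDelta (fun s => Complex.log (y s))
      (∑ k, u t k * (v t k - 1) ^ 2 - 2 * (n + 1 : ℕ) - α) t := by
  have hLt := hL t ht
  obtain ⟨hP, hQ⟩ := hLt.eval_zero_ne_zero hα hω hω0 ht
  choose l hl hl' using hasDerivAt_gauge hα hω hω0 ht.1 hP hQ
  have hyt := hLt.eq_gauge hα hω hω0 ht
  have hg : gauge n α ω t ≠ 0 := by
    intro h0
    rw [h0, Complex.ofReal_zero, mul_zero] at hyt
    exact hLt.1 hyt
  refine ⟨fun k => l k, fun k => ?_, ?_⟩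
  · have h1 : HasDerivAt (fun s : ℝ => Complex.I * (gauge n α ω (Function.update t k s) : ℂ))
        (Complex.I * ((l k * gauge n α ω t : ℝ) : ℂ)) (t k) :=
      (hl k).ofReal_comp.const_mul Complex.I
    -- `y` is a nonzero purely imaginary number, so it avoids the cut of the principal logarithm
    -- whatever its sign.
    have h2 : Complex.I * (gauge n α ω (Function.update t k (t k)) : ℂ) ∈ Complex.slitPlane := by
      rw [Function.update_eq_self]
      right
      simpa using hg
    refine ((h1.clog_real h2).congr_deriv ?_).congr_of_eventuallyEq ?_
    · rw [Function.update_eq_self, div_eq_iff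
        (mul_ne_zero Complex.I_ne_zero (by exact_mod_cast hg))]
      push_cast
      ring
    -- `y` is known to agree with the explicit expression on the regular set only, which contains
    -- all nearby points of the coordinate line.
    · filter_upwards [eventually_update_mem_regular hα hω hω0 ht k] with s hs
      rw [(hL _ hs).eq_gauge hα hω hω0 hs]
  · have hb := hLt.b1_mul_eval_zero hα hω hω0 ht
    have hby := hLt.b1_mul hα hω hω0 ht.1
    have hb0 := hLt.b1_ne_zero hα hω hω0 ht.1
    have hy := hLt.1
    obtain ⟨e1, e2, e3, -, -⟩ := hLt.equations hα hω hω0 ht.1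
    have hP' : (((P α ω t n).eval 0 : ℝ) : ℂ) ≠ 0 := by exact_mod_cast hP
    have hQ' : (((P α ω t (n + 1)).eval 0 : ℝ) : ℂ) ≠ 0 := by exact_mod_cast hQ
    have h1 : (recBeta (n + 1) α ω t : ℂ) * ((P α ω t n).eval 0 : ℝ) /
        ((P α ω t (n + 1)).eval 0 : ℝ) = b1 (n + 1) (u t) (v t) := by
      rw [div_eq_iff hQ', hb]
    have h2 : (((P α ω t (n + 1)).eval 0 : ℝ) : ℂ) / ((P α ω t n).eval 0 : ℝ) =
        recBeta (n + 1) α ω t / b1 (n + 1) (u t) (v t) := by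
      rw [div_eq_div_iff hP' hb0]
      linear_combination hb
    -- The three ladder terms are `u`, `-2 u v` and `u v²`, which complete the square; the power of
    -- `t₁` gives the constant at `k = 0`.
    have h3 : ∀ k, (t k : ℂ) * l k = u t k * (v t k - 1) ^ 2 +
        if k = 0 then -(2 * ((n + 1 : ℕ) : ℂ) + α) else 0 := by
      intro k
      have h4 : (t k : ℂ) * l k = recBeta (n + 1) α ω t * ((P α ω t n).eval 0 : ℝ) /
          ((P α ω t (n + 1)).eval 0 : ℝ) * R (n + 1) α ω t k - 2 * r (n + 1) α ω t k +
          ((P α ω t (n + 1)).eval 0 : ℝ) / ((P α ω t n).eval 0 : ℝ) * R n α ω t k +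
          if k = 0 then -(2 * ((n + 1 : ℕ) : ℂ) + α) else 0 := by
        have h5 := congrArg (fun x : ℝ => (x : ℂ)) (hl' k)
        split_ifs at h5 ⊢ <;> exact_mod_cast h5
      have h6 : u t k = b1 (n + 1) (u t) (v t) * R (n + 1) α ω t k := by
        refine mul_right_cancel₀ hy ?_
        linear_combination e2 k - R (n + 1) α ω t k * hby
      have h7 : u t k * v t k ^ 2 =
          recBeta (n + 1) α ω t / b1 (n + 1) (u t) (v t) * R n α ω t k := by
        rw [div_mul_eq_mul_div, eq_div_iff hb0]
        refine mul_right_cancel₀ hy ?_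
        linear_combination e3 k + u t k * v t k ^ 2 * hby
      rw [h4, h1, h2, ← h6, ← h7, ← e1]
      ring
    rw [Finset.sum_congr rfl fun k _ => h3 k, Finset.sum_add_distrib, Finset.sum_ite_eq']
    simp only [Finset.mem_univ, if_true]
    ring

end Main

end JumpLaguerre

end

/-! ### Assembly of the theorem -/

theorem theorem1p3 (m : ℕ) [NeZero m] (n : ℕ) (hn : 1 ≤ n) (α : ℝ) (hα : -1 < α)
    (ω : Fin (m + 1) → ℝ) (hω : ∀ l : Fin (m + 1), 0 ≤ ∑ k ∈ Finset.Iic l, ω k) (hω0 : ω ≠ 0) :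
    -- existence and uniqueness of the Lax pair quantities
    (∀ t ∈ regular n α ω, ∃! p : (Fin m → ℂ) × (Fin m → ℂ) × ℂ,
      IsLaxParam n α ω t p.1 p.2.1 p.2.2) ∧
    -- the formulas for `α_n` and `∂ ln h_n` in terms of the ladder operator quantities
    (∀ t ∈ chamber m,
      recAlpha n α ω t = ∑ k, t k * R n α ω t k + 2 * n + 1 + α ∧
      0 < h n α ω t ∧
      ∀ k, HasDerivAt (fun s : ℝ => Real.log (h n α ω (Function.update t k s)))
        (-R n α ω t k) (t k)) ∧
    -- the formulas in terms of the Lax pair quantities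
    (∀ t ∈ chamber m, ∀ (u v : Fin m → ℂ) (y : ℂ), IsLaxParam n α ω t u v y →
      b1 n u v ≠ 0 ∧
      (∀ k, (R n α ω t k : ℂ) = u k / b1 n u v) ∧
      (∀ k, (r n α ω t k : ℂ) = u k * v k) ∧
      (recAlpha n α ω t : ℂ) = 1 / b1 n u v * ∑ k, (t k : ℂ) * u k + 2 * n + 1 + α ∧
      (recBeta n α ω t : ℂ) = -(b1 n u v * b2 n α u v) ∧
      (h n α ω t : ℂ) =
        -(2 * Real.pi * Complex.I) * ((t 0 ^ (2 * n + α : ℝ) : ℝ) : ℂ) * b1 n u v * y ∧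
      ∀ k, HasDerivAt (fun s : ℝ => (Real.log (h n α ω (Function.update t k s)) : ℂ))
        (-(u k / b1 n u v)) (t k)) ∧
    -- the inverse formulas, and their equivalence with the direct ones
    (∀ t ∈ regular n α ω, ∀ (u v : Fin m → ℂ) (y : ℂ), IsLaxParam n α ω t u v y →
      ∀ k,
        u k = (R n α ω t k * ((∑ j, r n α ω t j + n) / (∑ j, R n α ω t j - 1)) : ℝ) ∧
        v k = (r n α ω t k / R n α ω t k *
          ((∑ j, R n α ω t j - 1) / (∑ j, r n α ω t j + n)) : ℝ)) ∧
    (∀ t ∈ regular n α ω, ∀ u v : Fin m → ℂ,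
      (∀ k, (R n α ω t k : ℂ) = u k / b1 n u v ∧ (r n α ω t k : ℂ) = u k * v k) ↔
      (∀ k,
        u k = (R n α ω t k * ((∑ j, r n α ω t j + n) / (∑ j, R n α ω t j - 1)) : ℝ) ∧
        v k = (r n α ω t k / R n α ω t k *
          ((∑ j, R n α ω t j - 1) / (∑ j, r n α ω t j + n)) : ℝ))) ∧
    -- `β_n` in terms of the ladder operator quantities
    (∀ t ∈ chamber m, (∀ k, R n α ω t k ≠ 0) → 1 - ∑ k, R n α ω t k ≠ 0 →
      recBeta n α ω t =
        (n + α + ∑ k, r n α ω t k) * (n + ∑ k, r n α ω t k) / (1 - ∑ k, R n α ω t k) +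
          ∑ k, r n α ω t k ^ 2 / R n α ω t k) ∧
    -- the relation between `y` and the `u_k`, `v_k`
    (∀ (u v : (Fin m → ℝ) → Fin m → ℂ) (y : (Fin m → ℝ) → ℂ),
      (∀ t ∈ regular n α ω, IsLaxParam n α ω t (u t) (v t) (y t)) →
      ∀ t ∈ regular n α ω,
        HasDelta (fun s => Complex.log (y s))
          (∑ k, u t k * (v t k - 1) ^ 2 - 2 * n - α) t) := by
  -- The lemmas are stated at level `n + 1`, so that the truncated `n - 1` in `r`, `recBeta` and `Y`
  -- is a true predecessor.
  obtain ⟨n, rfl⟩ : ∃ k, n = k + 1 := ⟨n - 1, by omega⟩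
  have hinv : ∀ t ∈ regular (n + 1) α ω, ∀ u v : Fin m → ℂ, _ := fun t ht u v =>
    direct_iff_inverse (n := n + 1) ht.2.1 ht.2.2.1 ht.2.2.2 u v
  have hdir : ∀ t ∈ chamber m, ∀ (u v : Fin m → ℂ) (y : ℂ), IsLaxParam (n + 1) α ω t u v y →
      ∀ k, (R (n + 1) α ω t k : ℂ) = u k / b1 (n + 1) u v := by
    intro t ht u v y hL k
    obtain ⟨-, e2, -⟩ := hL.equations hα hω hω0 ht
    rw [eq_div_iff (hL.b1_ne_zero hα hω hω0 ht)]
    refine mul_right_cancel₀ hL.1 ?_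
    linear_combination (R (n + 1) α ω t k : ℂ) * hL.b1_mul hα hω hω0 ht - e2 k
  refine ⟨fun t ht => existsUnique_isLaxParam hα hω hω0 ht, fun t ht =>
    ⟨recAlpha_eq hα hω hω0 ht _, h_pos hα hω hω0 ht _, hasDerivAt_log_h hα hω hω0 ht _⟩,
    fun t ht u v y hL => ?_, fun t ht u v y hL => ?_, hinv,
    fun t ht hR hR1 => recBeta_eq hα hω hω0 ht hR hR1,
    fun u v y hL t ht => hasDelta_log hα hω hω0 u v y hL ht⟩
  · have hb0 := hL.b1_ne_zero hα hω hω0 ht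
    have hR := hdir t ht u v y hL
    refine ⟨hb0, hR, fun k => ((hL.equations hα hω hω0 ht).1 k).symm, ?_,
      hL.b1_mul_b2 hα hω hω0 ht, ?_, fun k => ?_⟩
    · rw [recAlpha_eq hα hω hω0 ht]
      push_cast
      rw [Finset.mul_sum]
      congr 3
      refine Finset.sum_congr rfl fun k _ => ?_
      rw [hR k]
      ring
    · have h1 : ((t 0 ^ (2 * (n + 1 : ℕ) + α : ℝ) : ℝ) : ℂ) ≠ 0 := by
        exact_mod_cast (Real.rpow_pos_of_pos (ht.1 0) _).ne'
      have h2 := Complex.two_pi_I_ne_zero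
      rw [mul_assoc _ (b1 _ _ _) y, hL.b1_mul hα hω hω0 ht, laxScale]
      field_simp
    · rw [← hR k, ← Complex.ofReal_neg]
      exact (hasDerivAt_log_h hα hω hω0 ht (n + 1) k).ofReal_comp
  · exact (hinv t ht u v).1 fun k =>
      ⟨hdir t ht.1 u v y hL k, ((hL.equations hα hω hω0 ht.1).1 k).symm⟩
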